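/- Let $W>0$ and $N_0>0$. Let the transmitted signal be $$x(t)=\frac{1}{\sqrt{2W}}\sum_{\ell=1}^{n}x_\ell\, g\Bigl(t-\frac{\ell}{2W}\Bigr),$$ where $g$ is a real unit-energy waveform bandlimited to $W$ Hz. The receiver observes $Y(kT_s)=\operatorname{sgn}\{((x+Z)\star \mathrm{LPF}_W)(kT_s)\}$, $k\in\mathbb Z$, where $Z$ is white Gaussian noise of double-sided power spectral density $N_0/2$, independent of the input, $\mathrm{LPF}_W$ is the ideal unit-gain lowpass filter of cutoff frequency $W$, and $\operatorname{sgn}$ equals $1$ on nonnegative and $-1$ on negative numbers. Put $$\mathbf Y_k=\Bigl(Y(jT_s)\Bigr)_{\lceil (2k-1)/(4WT_s)\rceil\le j\le\lfloor (2k+1)/(4WT_s)\rfloor},\qquad C_{T_s}(P)=\liminf_{n\to\infty}\ \sup\ \frac{2W}{n}\,I(X_1^n;\mathbf Y_1^n)$$ (in nats per second), the supremum being over all such $g$ and all joint laws of $(X_1,\dots,X_n)$ with $\frac1n\sum_{k=1}^n\mathsf E[X_k^2]\le P$, and let $\dot C_{T_s}(0)=\limsup_{P\downarrow0}C_{T_s}(P)/P$.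 Then sampling at rate $4W$ yields $$\dot C_{\frac1{4W}}(0)\ \ge\ \frac{B}{N_0},$$ where, with $\rho=\frac2\pi$, $a=\arcsin\frac{\rho}{\sqrt{1-\rho^2}}$ and $b=\arcsin\frac{\rho^2}{1-\rho^2}$, $$B=\frac2\pi\left[\frac{\bigl(\frac{g_1}{2}+\frac{g_0}{4}+\frac{g_1}{\pi}a-\frac{g_0}{2\pi}b\bigr)^2}{\frac14+\frac1\pi\arcsin\rho}+8\Bigl(\frac{g_0}{4}-\frac{g_1}{\pi}a+\frac{g_0}{2\pi}b\Bigr)^2+\frac{\bigl(\frac{g_1}{2}-\frac{g_0}{4}-\frac{g_1}{\pi}a+\frac{g_0}{2\pi}b\bigr)^2}{\frac14-\frac1\pi\arcsin\rho}\right],$$ $$g_0=\frac{1+\frac2\pi\lambda}{\sqrt{\frac12\lambda^2+\frac4\pi\lambda+1}},\qquad g_1=\frac{\frac2\pi+\frac12\lambda}{\sqrt{\frac12\lambda^2+\frac4\pi\lambda+1}},\qquad \lambda=1.4 .$$ The same lower bound holds if the supremum is restricted further to those pairs of a waveform and an input law for which the transmitted signal itself has average power at most $P$, i.e. $\frac{2W}{n}\,\mathsf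 E\int_{\mathbb R} X(t)^2\,dt\le P$. Numerically, $0.7464<B<0.7465$ (so $B\approx0.747$ up to one unit in the third decimal). In particular $\frac{B}{N_0}>\frac{2}{\pi}\frac1{N_0}$. -/

import Mathlib

open MeasureTheory ProbabilityTheory Filter Topology
open scoped ENNReal

noncomputable section

namespace OneBitAWGN

/-- Impulse response of the ideal unit-gain lowpass filter of cutoff frequency `W`. -/
def lpf (W t : ℝ) : ℝ := 2 * W * Real.sinc (2 * Real.pi * W * t)

/-- `g` is bandlimited to `W` Hz: it is the inverse Fourier transform of a square-integrable
spectrum that vanishes outside `[-W, W]`. -/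
def Bandlimited (W : ℝ) (g : ℝ → ℝ) : Prop :=
  ∃ G : ℝ → ℂ, MemLp G 2 (volume.restrict (Set.Icc (-W) W)) ∧
    ∀ t : ℝ, (g t : ℂ) =
      ∫ f in Set.Icc (-W) W, G f * Complex.exp (2 * Real.pi * Complex.I * f * t)

/-- `g` has unit energy. -/
def UnitEnergy (g : ℝ → ℝ) : Prop := MemLp g 2 volume ∧ ∫ t, g t ^ 2 = 1

/-- The transmitted signal `x(t) = (2W)^{-1/2} ∑_{ℓ=1}^n x_ℓ g(t - ℓ/(2W))`; the coordinate
`ℓ : Fin n` stands for the symbol with number `ℓ + 1`. -/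
def pamSignal (W : ℝ) (g : ℝ → ℝ) {n : ℕ} (x : Fin n → ℝ) (t : ℝ) : ℝ :=
  1 / √(2 * W) * ∑ ℓ : Fin n, x ℓ * g (t - ((ℓ : ℝ) + 1) / (2 * W))

/-- The transmitted signal after the lowpass filter, at time `t` (a convolution). -/
def filteredSignal (W : ℝ) (g : ℝ → ℝ) {n : ℕ} (x : Fin n → ℝ) (t : ℝ) : ℝ :=
  ∫ u, pamSignal W g x u * lpf W (t - u)

/-- Autocovariance at lag `τ` of white noise of double-sided power spectral density `N0 / 2` after
the ideal lowpass filter: the inverse Fourier transform of `N0 / 2` on `[-W, W]`. -/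
def noiseAutocov (W N0 τ : ℝ) : ℝ :=
  ∫ f in Set.Icc (-W) W, N0 / 2 * Real.cos (2 * Real.pi * f * τ)

/-- The covariance matrix of the filtered noise at the times `j * Ts`, `j ∈ s`. -/
def noiseCov (W N0 Ts : ℝ) (s : Finset ℤ) : Matrix s s ℝ :=
  Matrix.of fun i j => noiseAutocov W N0 ((i : ℝ) * Ts - (j : ℝ) * Ts)

/-- `noiseCov` is a genuine covariance matrix. -/
theorem noiseCov_posSemidef (W N0 Ts : ℝ) (hN : 0 ≤ N0) (s : Finset ℤ) :
    (noiseCov W N0 Ts s).PosSemidef := by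
  refine Matrix.PosSemidef.of_dotProduct_mulVec_nonneg ?_ fun x => ?_
  · ext i j
    simp only [noiseCov, noiseAutocov, Matrix.conjTranspose_apply, Matrix.of_apply, star_trivial]
    congr 1
    ext f
    rw [← Real.cos_neg]
    ring_nf
  · have key : star x ⬝ᵥ (noiseCov W N0 Ts s).mulVec x
        = ∫ f in Set.Icc (-W) W, N0 / 2 *
            ((∑ i, x i * Real.cos (2 * Real.pi * f * ((i : ℝ) * Ts))) ^ 2
              + (∑ i, x i * Real.sin (2 * Real.pi * f * ((i : ℝ) * Ts))) ^ 2) := by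
      have hc : ∀ i j : s, IntegrableOn (fun f : ℝ => x i * (N0 / 2 * Real.cos (2 * Real.pi * f *
          ((i : ℝ) * Ts - (j : ℝ) * Ts)) * x j)) (Set.Icc (-W) W) := fun i j =>
        (by fun_prop : Continuous fun f : ℝ => x i * (N0 / 2 * Real.cos (2 * Real.pi * f *
          ((i : ℝ) * Ts - (j : ℝ) * Ts)) * x j)).integrableOn_Icc
      simp only [dotProduct, Matrix.mulVec, noiseCov, noiseAutocov, Matrix.of_apply, star_trivial,
        Finset.mul_sum]
      simp_rw [← integral_mul_const, ← integral_const_mul]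
      simp_rw [← integral_finsetSum _ fun j _ => hc _ j]
      rw [← integral_finsetSum _ fun i _ => integrable_finsetSum _ fun j _ => hc i j]
      congr 1
      ext f
      rw [sq, sq, Finset.sum_mul_sum, Finset.sum_mul_sum]
      simp only [← Finset.sum_add_distrib, Finset.mul_sum]
      refine Finset.sum_congr rfl fun i _ => Finset.sum_congr rfl fun j _ => ?_
      rw [mul_sub, Real.cos_sub]
      ring
    rw [key]
    exact integral_nonneg fun f => by positivity

/-- The law of the filtered noise samples at the times `j * Ts`, `j ∈ s`. -/
def noiseLaw (W N0 Ts : ℝ) (s : Finset ℤ) : Measure (EuclideanSpace ℝ s) :=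
  multivariateGaussian 0 (noiseCov W N0 Ts s)

/-- Every set of output symbols `1`, `-1` is measurable. -/
instance instDiscreteSigns : DiscreteMeasurableSpace ℤˣ where
  forall_measurableSet s := ⟨Units.val '' s, MeasurableSet.of_discrete,
    Set.preimage_image_eq s Units.val_injective⟩

/-- The hard-limiter: `1` for a nonnegative input and `-1` for a negative input. -/
def hardLimiter (r : ℝ) : ℤˣ := if 0 ≤ r then 1 else -1

/-- The numbers `j` of the samples `Y(j Ts)` that make up the block `𝐘_k`. -/
def blockSamples (W Ts : ℝ) (k : ℕ) : Finset ℤ :=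
  Finset.Icc ⌈(2 * (k : ℝ) - 1) / (4 * W * Ts)⌉ ⌊(2 * (k : ℝ) + 1) / (4 * W * Ts)⌋

/-- The numbers of all samples that occur in the blocks `𝐘_1, …, 𝐘_n` (neighbouring blocks may
share a sample; a repetition of the same sample carries no information). -/
def samples (W Ts : ℝ) (n : ℕ) : Finset ℤ :=
  (Finset.Icc 1 n).biUnion (blockSamples W Ts)

/-- Joint law of the input symbols `X_1^n ∼ μ` and the quantized output samples `𝐘_1^n`; the noise is
independent of the input. -/
def jointLaw (W N0 Ts : ℝ) (g : ℝ → ℝ) {n : ℕ} (μ : Measure (Fin n → ℝ)) :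
    Measure ((Fin n → ℝ) × (samples W Ts n → ℤˣ)) :=
  (μ.prod (noiseLaw W N0 Ts (samples W Ts n))).map fun p =>
    (p.1, fun j => hardLimiter (filteredSignal W g p.1 ((j : ℝ) * Ts) + p.2 j))

/-- Mutual information, in nats, of the two components of a law on a product space. -/
def mutualInfo {α β : Type*} [MeasurableSpace α] [MeasurableSpace β] (ν : Measure (α × β)) : ℝ≥0∞ :=
  InformationTheory.klDiv ν (ν.fst.prod ν.snd)

/-- The information rate `(2W/n) I(X_1^n; 𝐘_1^n)` in nats per second. -/
def infoRate (W N0 Ts : ℝ) (g : ℝ → ℝ) {n : ℕ} (μ : Measure (Fin n → ℝ)) : ℝ≥0∞ :=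
  ENNReal.ofReal (2 * W / n) * mutualInfo (jointLaw W N0 Ts g μ)

/-- The constraint `(1/n) ∑ E[X_k²] ≤ P` on the symbols. -/
def SymbolPower (P : ℝ) {n : ℕ} (μ : Measure (Fin n → ℝ)) : Prop :=
  (∑ k : Fin n, ∫⁻ x, ENNReal.ofReal (x k ^ 2) ∂μ) / n ≤ ENNReal.ofReal P

/-- The average-power constraint on the transmitted signal: its expected energy, divided by the
duration `n / (2W)` of `n` symbols, is at most `P`. -/
def SignalPower (W P : ℝ) (g : ℝ → ℝ) {n : ℕ} (μ : Measure (Fin n → ℝ)) : Prop :=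
  (∫⁻ x, (∫⁻ t, ENNReal.ofReal (pamSignal W g x t ^ 2)) ∂μ) / ENNReal.ofReal (n / (2 * W))
    ≤ ENNReal.ofReal P

/-- The capacity (nats per second): the limit inferior of the largest information rate over all
unit-energy waveforms bandlimited to `W` Hz and all input laws that satisfy the power constraint. -/
def capacity (W N0 Ts P : ℝ) : ℝ≥0∞ :=
  liminf (fun n : ℕ =>
    ⨆ (g : ℝ → ℝ) (_ : UnitEnergy g) (_ : Bandlimited W g)
      (μ : ProbabilityMeasure (Fin n → ℝ)) (_ : SymbolPower P (μ : Measure (Fin n → ℝ))),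
      infoRate W N0 Ts g (μ : Measure (Fin n → ℝ))) atTop

/-- The capacity when the transmitted signal, too, has to satisfy the power constraint. -/
def signalCapacity (W N0 Ts P : ℝ) : ℝ≥0∞ :=
  liminf (fun n : ℕ =>
    ⨆ (g : ℝ → ℝ) (_ : UnitEnergy g) (_ : Bandlimited W g)
      (μ : ProbabilityMeasure (Fin n → ℝ)) (_ : SymbolPower P (μ : Measure (Fin n → ℝ)))
      (_ : SignalPower W P g (μ : Measure (Fin n → ℝ))),
      infoRate W N0 Ts g (μ : Measure (Fin n → ℝ))) atTop

/-- Capacity per unit-cost: `limsup_{P ↓ 0} C(P) / P`. -/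
def perUnitCost (C : ℝ → ℝ≥0∞) : ℝ≥0∞ :=
  limsup (fun P : ℝ => C P / ENNReal.ofReal P) (𝓝[>] 0)

/-- The value of the pulse `g / √(2W)` at time `0`, for the pulse parameter `l`. -/
def pulseZero (l : ℝ) : ℝ :=
  (1 + 2 / Real.pi * l) / √(1 / 2 * l ^ 2 + 4 / Real.pi * l + 1)

/-- The value of the pulse `g / √(2W)` at time `1/(4W)`, for the pulse parameter `l`. -/
def pulseOne (l : ℝ) : ℝ :=
  (2 / Real.pi + 1 / 2 * l) / √(1 / 2 * l ^ 2 + 4 / Real.pi * l + 1)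

/-- The arcsin expression, multiplied by `2 / π`. -/
def arcsinBound (ρ g0 g1 : ℝ) : ℝ :=
  2 / Real.pi *
    ((g1 / 2 + g0 / 4 + g1 / Real.pi * Real.arcsin (ρ / √(1 - ρ ^ 2))
        - g0 / (2 * Real.pi) * Real.arcsin (ρ ^ 2 / (1 - ρ ^ 2))) ^ 2
      / (1 / 4 + 1 / Real.pi * Real.arcsin ρ)
    + 8 * (g0 / 4 - g1 / Real.pi * Real.arcsin (ρ / √(1 - ρ ^ 2))
        + g0 / (2 * Real.pi) * Real.arcsin (ρ ^ 2 / (1 - ρ ^ 2))) ^ 2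
    + (g1 / 2 - g0 / 4 - g1 / Real.pi * Real.arcsin (ρ / √(1 - ρ ^ 2))
        + g0 / (2 * Real.pi) * Real.arcsin (ρ ^ 2 / (1 - ρ ^ 2))) ^ 2
      / (1 / 4 - 1 / Real.pi * Real.arcsin ρ))

end OneBitAWGN

end

/-!
The capacity is bounded from below by one signalling scheme: independent equiprobable symbols `±ε` with
`ε² = P`, sent with the pulse `waveform W l`, a sinc pulse plus `l/2` times each of its shifts by
`±1/(4W)`, normalized. The shifts of `lpf W` reproduce one another under convolution
(`integral_lpf_mul_lpf`, Plancherel), so the pulse passes the lowpass filter unchanged and the filtered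
signal at time `j/(4W)` is `∑ ℓ, x ℓ * pulseSample l (j - 2(ℓ+1))`. Symbol `ℓ` reaches the sample at its
peak and the two neighbours with the weights `pulseZero l` and `pulseOne l`. The noise at these three
samples is Gaussian with correlations `ρ = 2/π` at lag one and `0` at lag two
(`isNoiseTriple_noiseTriple`).

Mutual information is bounded from below by the Donsker–Varadhan inequality
(`ofReal_integral_log_le_klDiv`) with the test density `∏ k, (1 + x k * s * φ k)`, where `φ k` is a
function (`signPoly`) of the three signs that surround the peak of pulse `k`. Because the symbols are
independent and centred, this product has mean one under the input law whatever the outputs are, so that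
the bound is a sum of one-symbol terms `E log (1 + x k * s * φ k)`, even though neighbouring triples
overlap and the noise has memory (`sum_integral_log_le_mutualInfo`).

Each term is expanded to second order in `ε` (`integral_log_one_add_signPoly_ge`). The linear part needs
the mean response of a product of signs to a shift of the samples: shifting sample `i` flips its sign
only if the noise there is nearly zero, and given that it vanishes, the other two noise samples form a
Gaussian pair with the conditional covariance, whose sign correlation is an arcsine by Grothendieck's
identity (`integral_sgn_mul_sgn`, `IsNoiseTriple.abs_integral_sgn_shift_sub_le`). The interference of the
other symbols has mean zero and, by square-summability of the pulse samples, power of order `ε²`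
uniformly in `n`; after averaging it enters only at order `ε³`. The coefficients of the statistic are
chosen by the Cauchy–Schwarz inequality (`exists_signPoly_optimal`), which makes response and second
moment both equal to `B`, so that each symbol contributes `ε² B / (2 N₀ W) - O(ε³)`. Multiplication by
`2W`, division by `P = ε²` and `P ↓ 0` give `B / N₀`.

Uncorrelated symbols also satisfy the power constraint on the transmitted signal, with equality
(`signalPower_antipodal`). The numerical value of `B` follows from interval arithmetic with the Taylor
polynomial of the sine (`arcsinBound_bounds`).
-/

noncomputable section

namespace OneBitAWGN

/-! ### The ideal lowpass filter in the frequency domain -/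

open scoped FourierTransform ContDiff in
/-- On `L¹ ∩ L²` the Fourier transform given by the integral agrees with the one on `L²`: both
define the same tempered distribution. -/
theorem fourier_toLp_ae_eq {f : ℝ → ℂ} (h1 : Integrable f) (h2 : MemLp f 2) :
    (𝓕 (h2.toLp f) : Lp ℂ 2 (volume : Measure ℝ)) =ᵐ[volume] 𝓕 f := by
  have hcont : Continuous (𝓕 f) :=
    VectorFourier.fourierIntegral_continuous Real.continuous_fourierChar
      (innerSL ℝ).continuous₂ h1
  have hloc : LocallyIntegrable (𝓕 (h2.toLp f) : Lp ℂ 2 (volume : Measure ℝ)) volume :=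
    (Lp.memLp _).locallyIntegrable (by norm_num)
  refine ae_eq_of_integral_contDiff_smul_eq hloc hcont.locallyIntegrable fun g hg hgc => ?_
  have hg₁ : HasCompactSupport (Complex.ofRealCLM ∘ g) := hgc.comp_left rfl
  have hg₂ : ContDiff ℝ ∞ (Complex.ofRealCLM ∘ g) := by fun_prop
  have key := congrArg (fun T : TemperedDistribution ℝ ℂ => T (hg₁.toSchwartzMap hg₂))
    (Lp.fourier_toTemperedDistribution_eq (h2.toLp f))
  simp only [TemperedDistribution.fourier_apply, Lp.toTemperedDistribution_apply] at key
  have e1 : ∫ x, (hg₁.toSchwartzMap hg₂) x • (𝓕 (h2.toLp f) : Lp ℂ 2 (volume : Measure ℝ)) x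
      = ∫ x, g x • (𝓕 (h2.toLp f) : Lp ℂ 2 (volume : Measure ℝ)) x := by
    refine integral_congr_ae (Eventually.of_forall fun x => ?_)
    simp
  have e2 : ∫ x, (𝓕 (hg₁.toSchwartzMap hg₂)) x • (h2.toLp f : Lp ℂ 2 (volume : Measure ℝ)) x
      = ∫ x, (𝓕 (hg₁.toSchwartzMap hg₂)) x • f x := by
    refine integral_congr_ae ?_
    filter_upwards [h2.coeFn_toLp] with x hx
    rw [hx]
  have e3 : ∫ x, (𝓕 (hg₁.toSchwartzMap hg₂)) x • f x = ∫ x, g x • 𝓕 f x := by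
    have := VectorFourier.integral_fourierIntegral_smul_eq_flip (L := innerₗ ℝ)
      (μ := volume) (ν := volume) Real.continuous_fourierChar continuous_inner
      (hg₁.toSchwartzMap hg₂).integrable h1
    rw [SchwartzMap.fourier_coe]
    refine Eq.trans this ?_
    refine integral_congr_ae (Eventually.of_forall fun x => ?_)
    simp only [flip_innerₗ]
    simp only [HasCompactSupport.toSchwartzMap_toFun, Function.comp_apply,
      Complex.ofRealCLM_apply, Complex.real_smul, smul_eq_mul]
    rfl
  rw [← e1, ← key, e2, e3]

theorem lpf_neg (W t : ℝ) : lpf W (-t) = lpf W t := by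
  unfold lpf
  rw [← Real.sinc_neg]; congr 2; ring

/-- The impulse response of the lowpass filter is the inverse Fourier transform of the indicator of
the pass band. -/
theorem integral_exp_eq_lpf {W : ℝ} (hW : 0 < W) (t : ℝ) :
    ∫ f in Set.Icc (-W) W, Complex.exp (2 * Real.pi * Complex.I * f * t) = lpf W t := by
  rw [integral_Icc_eq_integral_Ioc, ← intervalIntegral.integral_of_le (by linarith)]
  rcases eq_or_ne t 0 with rfl | ht
  · simp [lpf]; ring
  have hc : (2 * Real.pi * Complex.I * t : ℂ) ≠ 0 := by
    simp [Real.pi_ne_zero, ht]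
  have := integral_exp_mul_complex (a := -W) (b := W) hc
  have e : ∀ f : ℝ, Complex.exp (2 * Real.pi * Complex.I * f * t)
      = Complex.exp (2 * Real.pi * Complex.I * t * f) := fun f => by ring_nf
  simp_rw [e, this, lpf]
  rw [Real.sinc_of_ne_zero (by positivity)]
  push_cast
  rw [Complex.sin]
  have hp : (Real.pi : ℂ) ≠ 0 := by exact_mod_cast Real.pi_ne_zero
  have hW' : (W : ℂ) ≠ 0 := by exact_mod_cast hW.ne'
  have ht' : (t : ℂ) ≠ 0 := by exact_mod_cast ht
  field_simp
  ring_nf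
  simp only [Complex.I_sq]
  ring

/-- The pass band indicator, modulated so that its Fourier transform is centred at `a`. -/
def bandIndicator (W a : ℝ) : ℝ → ℂ :=
  (Set.Icc (-W) W).indicator fun f => Complex.exp (2 * Real.pi * Complex.I * f * a)

theorem memLp_bandIndicator (W a : ℝ) (p : ℝ≥0∞) : MemLp (bandIndicator W a) p := by
  have hc : Continuous fun f : ℝ => Complex.exp (2 * Real.pi * Complex.I * f * a) := by fun_prop
  have hr : MemLp (fun f : ℝ => Complex.exp (2 * Real.pi * Complex.I * f * a)) p
      (volume.restrict (Set.Icc (-W) W)) := by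
    refine MemLp.of_bound hc.aestronglyMeasurable 1 (Eventually.of_forall fun f => ?_)
    rw [show (2 * Real.pi * Complex.I * f * a : ℂ) = ((2 * Real.pi * f * a : ℝ) : ℂ) * Complex.I by
      push_cast; ring, Complex.norm_exp_ofReal_mul_I]
  exact (memLp_indicator_iff_restrict measurableSet_Icc).2 hr

open scoped FourierTransform in
theorem fourier_bandIndicator {W : ℝ} (hW : 0 < W) (a : ℝ) :
    𝓕 (bandIndicator W a) = fun u => (lpf W (u - a) : ℂ) := by
  ext u
  rw [← lpf_neg, ← integral_exp_eq_lpf hW, Real.fourier_eq', ← integral_indicator measurableSet_Icc]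
  refine integral_congr_ae (Eventually.of_forall fun f => ?_)
  by_cases hf : f ∈ Set.Icc (-W) W
  · simp only [bandIndicator, Set.indicator_of_mem hf, smul_eq_mul, ← Complex.exp_add]
    congr 1
    simp
    ring
  · simp [bandIndicator, hf]

theorem integrable_bandIndicator (W a : ℝ) : Integrable (bandIndicator W a) :=
  memLp_one_iff_integrable.1 (memLp_bandIndicator W a 1)

open scoped FourierTransform in
/-- The `L²` Fourier transform of `bandIndicator W a`. -/
def fourierLp (W a : ℝ) : Lp ℂ 2 (volume : Measure ℝ) :=
  𝓕 ((memLp_bandIndicator W a 2).toLp (bandIndicator W a))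

theorem fourier_toLp_bandIndicator {W : ℝ} (hW : 0 < W) (a : ℝ) :
    (fourierLp W a : Lp ℂ 2 (volume : Measure ℝ)) =ᵐ[volume] fun u => (lpf W (u - a) : ℂ) := by
  rw [← fourier_bandIndicator hW]
  exact fourier_toLp_ae_eq (integrable_bandIndicator W a) (memLp_bandIndicator W a 2)

theorem memLp_lpf {W : ℝ} (hW : 0 < W) (a : ℝ) : MemLp (fun u => lpf W (u - a)) 2 := by
  have h : MemLp (fun u => (lpf W (u - a) : ℂ)) 2 (volume : Measure ℝ) :=
    (memLp_congr_ae (fourier_toLp_bandIndicator hW a)).1 (Lp.memLp _)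
  exact h.re

/-- Shifted copies of the impulse response reproduce it, by Plancherel's theorem. -/
theorem integral_lpf_mul_lpf {W : ℝ} (hW : 0 < W) (a b : ℝ) :
    ∫ u, lpf W (u - a) * lpf W (u - b) = lpf W (a - b) := by
  have h := Lp.inner_fourier_eq ((memLp_bandIndicator W a 2).toLp _)
    ((memLp_bandIndicator W b 2).toLp _)
  rw [L2.inner_def, L2.inner_def] at h
  have e1 : ∫ u, (lpf W (u - a) * lpf W (u - b) : ℂ) = (lpf W (a - b) : ℂ) := by
    calc _ = _ := integral_congr_ae ?_
      _ = _ := h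
      _ = ∫ f in Set.Icc (-W) W, Complex.exp (2 * Real.pi * Complex.I * f * (b - a : ℝ)) := ?_
      _ = _ := by rw [integral_exp_eq_lpf hW, ← lpf_neg, neg_sub]
    · filter_upwards [fourier_toLp_bandIndicator hW a, fourier_toLp_bandIndicator hW b]
        with u ha hb
      rw [fourierLp] at ha hb
      rw [ha, hb]
      simp [mul_comm]
    · rw [← integral_indicator measurableSet_Icc]
      refine integral_congr_ae ?_
      filter_upwards [(memLp_bandIndicator W a 2).coeFn_toLp,
        (memLp_bandIndicator W b 2).coeFn_toLp] with f ha hb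
      rw [ha, hb]
      by_cases hf : f ∈ Set.Icc (-W) W
      · simp only [bandIndicator, Set.indicator_of_mem hf, RCLike.inner_apply,
          ← Complex.exp_conj, ← Complex.exp_add]
        congr 1
        have h2 : (starRingEnd ℂ) 2 = 2 := Complex.conj_ofReal 2
        simp [h2]
        ring
      · simp [bandIndicator, hf]
  exact_mod_cast e1

/-! ### The pulse -/

/-- The squared norm of the unnormalized pulse `φ + (l/2)(φ(· - T) + φ(· + T))`, where `φ` is the
unit-energy sinc pulse and `T = 1/(4W)`. -/
def pulseEnergy (l : ℝ) : ℝ := 1 / 2 * l ^ 2 + 4 / Real.pi * l + 1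

theorem pulseEnergy_pos {l : ℝ} (hl : 0 ≤ l) : 0 < pulseEnergy l := by
  unfold pulseEnergy
  have := Real.pi_pos
  positivity

/-- A normalized combination of the sinc pulse and its two shifts by `1/(4W)`. -/
def waveform (W l t : ℝ) : ℝ :=
  1 / (√(2 * W) * √(pulseEnergy l)) *
    (lpf W t + l / 2 * (lpf W (t - 1 / (4 * W)) + lpf W (t + 1 / (4 * W))))

/-- The samples of `waveform W l / √(2W)`, at time `m / (4W)`. -/
def pulseSample (l m : ℝ) : ℝ :=
  1 / √(pulseEnergy l) * (Real.sinc (Real.pi * m / 2)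
    + l / 2 * (Real.sinc (Real.pi * (m - 1) / 2) + Real.sinc (Real.pi * (m + 1) / 2)))

theorem lpf_sample {W : ℝ} (hW : 0 < W) (m : ℝ) :
    lpf W (m / (4 * W)) = 2 * W * Real.sinc (Real.pi * m / 2) := by
  unfold lpf; congr 2; field_simp; ring

theorem sinc_pi_div_two : Real.sinc (Real.pi / 2) = 2 / Real.pi := by
  rw [Real.sinc_of_ne_zero (by positivity), Real.sin_pi_div_two]; field_simp

theorem sinc_pi : Real.sinc Real.pi = 0 := by
  rw [Real.sinc_of_ne_zero (by positivity), Real.sin_pi]; simp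

theorem waveform_sample {W : ℝ} (hW : 0 < W) (l m : ℝ) :
    1 / √(2 * W) * waveform W l (m / (4 * W)) = pulseSample l m := by
  have h : √(2 * W) * √(2 * W) = 2 * W := Real.mul_self_sqrt (by positivity)
  have e1 : m / (4 * W) - 1 / (4 * W) = (m - 1) / (4 * W) := by ring
  have e2 : m / (4 * W) + 1 / (4 * W) = (m + 1) / (4 * W) := by ring
  have h0 : √(2 * W) ≠ 0 := by positivity
  rw [waveform, e1, e2, lpf_sample hW, lpf_sample hW, lpf_sample hW, pulseSample]
  calc _ = (2 * W) / (√(2 * W) * √(2 * W)) * (1 / √(pulseEnergy l)) *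
        (Real.sinc (Real.pi * m / 2)
    + l / 2 * (Real.sinc (Real.pi * (m - 1) / 2) + Real.sinc (Real.pi * (m + 1) / 2))) := by
        field_simp
    _ = _ := by rw [h, div_self (by positivity), one_mul]

theorem pulseSample_neg (l m : ℝ) : pulseSample l (-m) = pulseSample l m := by
  unfold pulseSample
  rw [← Real.sinc_neg (Real.pi * -m / 2), ← Real.sinc_neg (Real.pi * (-m - 1) / 2),
    ← Real.sinc_neg (Real.pi * (-m + 1) / 2), add_comm (Real.sinc (-(Real.pi * (-m - 1) / 2)))]
  ring_nf

theorem pulseSample_zero (l : ℝ) : pulseSample l 0 = pulseZero l := by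
  have e : Real.pi * (0 - 1) / 2 = -(Real.pi / 2) := by ring
  have e' : Real.pi * (0 + 1) / 2 = (Real.pi / 2) := by ring
  rw [pulseSample, e, e', Real.sinc_neg, sinc_pi_div_two, pulseZero, pulseEnergy]
  simp
  ring

theorem pulseSample_one (l : ℝ) : pulseSample l 1 = pulseOne l := by
  have e : Real.pi * (1 + 1) / 2 = Real.pi := by ring
  have e' : Real.pi * 1 / 2 = Real.pi / 2 := by ring
  rw [pulseSample, e, e', sinc_pi, sinc_pi_div_two, pulseOne, pulseEnergy]
  simp
  ring

theorem pulseSample_neg_one (l : ℝ) : pulseSample l (-1) = pulseOne l := by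
  rw [pulseSample_neg, pulseSample_one]

theorem summable_sinc_sq : Summable fun m : ℤ => Real.sinc (Real.pi * m / 2) ^ 2 := by
  refine Summable.of_norm_bounded_eventually (g := fun m : ℤ => 1 / (m : ℝ) ^ 2)
    (Real.summable_one_div_int_pow.2 (by norm_num)) ?_
  filter_upwards [(Set.finite_singleton (0 : ℤ)).compl_mem_cofinite] with m hm
  have hm' : (m : ℝ) ≠ 0 := by simpa using hm
  rw [Real.sinc_of_ne_zero (by positivity), Real.norm_of_nonneg (by positivity), div_pow]
  have h1 : Real.sin (Real.pi * m / 2) ^ 2 ≤ 1 := Real.sin_sq_le_one _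
  have h2 : (m : ℝ) ^ 2 ≤ (Real.pi * m / 2) ^ 2 := by
    have : 0 < (m : ℝ) ^ 2 := by positivity
    rw [div_pow, mul_pow, le_div_iff₀ (by norm_num), mul_comm]
    exact mul_le_mul_of_nonneg_right (by nlinarith [Real.pi_gt_three]) this.le
  gcongr

/-- The samples of the pulse are square-summable, so that the interference of all other symbols has
bounded power. -/
theorem summable_pulseSample_sq (l : ℝ) : Summable fun m : ℤ => pulseSample l m ^ 2 := by
  have h0 := summable_sinc_sq
  have h1 := (Equiv.subRight (1 : ℤ)).summable_iff.2 h0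
  have h2 := (Equiv.addRight (1 : ℤ)).summable_iff.2 h0
  have := (((h0.mul_left 3).add ((h1.mul_left (3 * (l / 2) ^ 2)))).add
    (h2.mul_left (3 * (l / 2) ^ 2))).mul_left ((1 / √(pulseEnergy l)) ^ 2)
  refine Summable.of_nonneg_of_le (fun m => sq_nonneg _) (fun m => ?_) this
  rw [pulseSample, mul_pow]
  refine mul_le_mul_of_nonneg_left ?_ (sq_nonneg _)
  simp only [Function.comp_apply, Equiv.subRight_apply, Equiv.coe_addRight, Int.cast_sub,
    Int.cast_add, Int.cast_one]
  generalize Real.sinc (Real.pi * m / 2) = a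
  generalize Real.sinc (Real.pi * (m - 1) / 2) = b
  generalize Real.sinc (Real.pi * (m + 1) / 2) = c
  nlinarith [sq_nonneg (a - l / 2 * b), sq_nonneg (a - l / 2 * c), sq_nonneg (l / 2 * b - l / 2 * c)]

theorem sum_pulseSample_sq_le (l : ℝ) (n : ℕ) (j : ℤ) :
    ∑ ℓ : Fin n, pulseSample l ((j : ℝ) - 2 * ((ℓ : ℝ) + 1)) ^ 2
      ≤ ∑' m : ℤ, pulseSample l m ^ 2 := by
  have hinj : Function.Injective fun ℓ : Fin n => j - 2 * ((ℓ : ℤ) + 1) := fun a b h => by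
    ext; simp only at h; omega
  have := (summable_pulseSample_sq l).sum_le_tsum (Finset.univ.map ⟨_, hinj⟩)
    fun m _ => sq_nonneg _
  simpa using this

theorem memLp_waveform {W : ℝ} (hW : 0 < W) (l a : ℝ) :
    MemLp (fun u => waveform W l (u - a)) 2 := by
  have h0 := memLp_lpf hW a
  have h1 := memLp_lpf hW (a + 1 / (4 * W))
  have h2 := memLp_lpf hW (a - 1 / (4 * W))
  have := (h0.add ((h1.add h2).const_mul (l / 2))).const_mul (1 / (√(2 * W) * √(pulseEnergy l)))
  convert this using 2 with u
  simp only [waveform, Pi.add_apply]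
  congr 5 <;> ring

theorem integrable_lpf_mul_lpf {W : ℝ} (hW : 0 < W) (a b : ℝ) :
    Integrable fun u => lpf W (u - a) * lpf W (u - b) :=
  (memLp_lpf hW a).integrable_mul (memLp_lpf hW b)

theorem integral_const_mul_add_const_mul_add {α 𝕜 : Type*} [RCLike 𝕜] {_ : MeasurableSpace α}
    {μ : Measure α} {f₁ f₂ f₃ : α → 𝕜} (c d : 𝕜) (h₁ : Integrable f₁ μ) (h₂ : Integrable f₂ μ)
    (h₃ : Integrable f₃ μ) :
    ∫ x, c * (f₁ x + d * (f₂ x + f₃ x)) ∂μ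
      = c * (∫ x, f₁ x ∂μ + d * (∫ x, f₂ x ∂μ + ∫ x, f₃ x ∂μ)) := by
  have h : Integrable (fun x => d * (f₂ x + f₃ x)) μ := (h₂.add h₃).const_mul d
  rw [integral_const_mul, integral_add h₁ h, integral_const_mul, integral_add h₂ h₃]

/-- The waveform passes the lowpass filter unchanged. -/
theorem integral_waveform_mul_lpf {W : ℝ} (hW : 0 < W) (l a t : ℝ) :
    ∫ u, waveform W l (u - a) * lpf W (u - t) = waveform W l (t - a) := by
  have e : ∀ u, waveform W l (u - a) * lpf W (u - t)
      = 1 / (√(2 * W) * √(pulseEnergy l)) * (lpf W (u - a) * lpf W (u - t)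
        + l / 2 * (lpf W (u - (a + 1 / (4 * W))) * lpf W (u - t)
          + lpf W (u - (a - 1 / (4 * W))) * lpf W (u - t))) := fun u => by
    rw [waveform, show u - a - 1 / (4 * W) = u - (a + 1 / (4 * W)) by ring,
      show u - a + 1 / (4 * W) = u - (a - 1 / (4 * W)) by ring]
    ring
  simp_rw [e]
  have i0 := integrable_lpf_mul_lpf hW a t
  have i1 := integrable_lpf_mul_lpf hW (a + 1 / (4 * W)) t
  have i2 := integrable_lpf_mul_lpf hW (a - 1 / (4 * W)) t
  rw [integral_const_mul_add_const_mul_add _ _ i0 i1 i2, integral_lpf_mul_lpf hW,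
    integral_lpf_mul_lpf hW, integral_lpf_mul_lpf hW,
    waveform, ← lpf_neg W (a - t), ← lpf_neg W (a + _ - t), ← lpf_neg W (a - _ - t)]
  ring_nf

theorem integral_waveform_sq {W l : ℝ} (hW : 0 < W) (hl : 0 ≤ l) (a : ℝ) :
    ∫ u, waveform W l (u - a) ^ 2 = 1 := by
  have e : ∀ u, waveform W l (u - a) ^ 2
      = 1 / (√(2 * W) * √(pulseEnergy l)) * (waveform W l (u - a) * lpf W (u - a)
        + l / 2 * (waveform W l (u - a) * lpf W (u - (a + 1 / (4 * W)))
          + waveform W l (u - a) * lpf W (u - (a - 1 / (4 * W))))) := fun u => by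
    rw [sq]
    nth_rw 2 [waveform]
    rw [show u - a - 1 / (4 * W) = u - (a + 1 / (4 * W)) by ring,
      show u - a + 1 / (4 * W) = u - (a - 1 / (4 * W)) by ring]
    ring
  have i (t : ℝ) : Integrable fun u => waveform W l (u - a) * lpf W (u - t) :=
    (memLp_waveform hW l a).integrable_mul (memLp_lpf hW t)
  simp_rw [e]
  rw [integral_const_mul_add_const_mul_add _ _ (i _) (i _) (i _), integral_waveform_mul_lpf hW,
    integral_waveform_mul_lpf hW,
    integral_waveform_mul_lpf hW]
  have h0 := waveform_sample hW l 0
  have h1 := waveform_sample hW l 1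
  have h2 := waveform_sample hW l (-1)
  rw [pulseSample_zero] at h0
  rw [pulseSample_one] at h1
  rw [pulseSample_neg_one] at h2
  have hs : (0 : ℝ) < √(2 * W) := by positivity
  have hD := pulseEnergy_pos hl
  have hE : √(pulseEnergy l) ^ 2 = pulseEnergy l := Real.sq_sqrt hD.le
  have hE0 : (0 : ℝ) < √(pulseEnergy l) := by positivity
  have f0 : waveform W l (a - a) = √(2 * W) * pulseZero l := by
    rw [← h0]; field_simp; simp
  have f1 : waveform W l (a + 1 / (4 * W) - a) = √(2 * W) * pulseOne l := by
    rw [← h1]; field_simp; ring_nf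
  have f2 : waveform W l (a - 1 / (4 * W) - a) = √(2 * W) * pulseOne l := by
    rw [← h2]; field_simp; ring_nf
  rw [f0, f1, f2, pulseZero, pulseOne]
  change 1 / (√(2 * W) * √(pulseEnergy l)) *
      (√(2 * W) * ((1 + 2 / Real.pi * l) / √(pulseEnergy l)) +
        l / 2 * (√(2 * W) * ((2 / Real.pi + 1 / 2 * l) / √(pulseEnergy l)) +
            √(2 * W) * ((2 / Real.pi + 1 / 2 * l) / √(pulseEnergy l)))) = 1
  have : 1 / (√(2 * W) * √(pulseEnergy l)) *
      (√(2 * W) * ((1 + 2 / Real.pi * l) / √(pulseEnergy l)) +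
        l / 2 * (√(2 * W) * ((2 / Real.pi + 1 / 2 * l) / √(pulseEnergy l)) +
            √(2 * W) * ((2 / Real.pi + 1 / 2 * l) / √(pulseEnergy l))))
      = (1 + 2 / Real.pi * l + l * (2 / Real.pi + 1 / 2 * l)) / √(pulseEnergy l) ^ 2 := by
    field_simp
    ring
  rw [this, hE, div_eq_one_iff_eq hD.ne', pulseEnergy]
  ring

theorem unitEnergy_waveform {W l : ℝ} (hW : 0 < W) (hl : 0 ≤ l) : UnitEnergy (waveform W l) := by
  have h1 := memLp_waveform hW l 0
  have h2 := integral_waveform_sq hW hl 0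
  simp only [sub_zero] at h1 h2
  exact ⟨h1, h2⟩

theorem bandlimited_waveform {W : ℝ} (hW : 0 < W) (l : ℝ) : Bandlimited W (waveform W l) := by
  let E : ℝ → ℝ → ℂ := fun f t => Complex.exp (2 * Real.pi * Complex.I * f * t)
  have hE : ∀ t, Continuous fun f => E f t := fun t => by fun_prop
  have hadd : ∀ f s t, E f s * E f t = E f (s + t) := fun f s t => by
    simp only [E, ← Complex.exp_add]; congr 1; push_cast; ring
  let c : ℂ := ((1 / (√(2 * W) * √(pulseEnergy l)) : ℝ) : ℂ)
  let G : ℝ → ℂ := fun f => c * (1 + (l / 2 : ℝ) * (E f (-(1 / (4 * W))) + E f (1 / (4 * W))))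
  have hG : Continuous G :=
    continuous_const.mul (continuous_const.add (continuous_const.mul ((hE _).add (hE _))))
  refine ⟨G, ?_, fun t => ?_⟩
  · obtain ⟨C, hC⟩ := isCompact_Icc.exists_bound_of_continuousOn (s := Set.Icc (-W) W)
      hG.continuousOn
    refine MemLp.of_bound hG.aestronglyMeasurable C ?_
    exact (ae_restrict_iff' measurableSet_Icc).2 (Eventually.of_forall hC)
  · have hI : ∀ s, IntegrableOn (fun f => E f s) (Set.Icc (-W) W) := fun s =>
      (hE s).integrableOn_Icc
    have e : ∀ f : ℝ, G f * Complex.exp (2 * Real.pi * Complex.I * f * t)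
        = c * (E f t + (l / 2 : ℝ) * (E f (t - 1 / (4 * W)) + E f (t + 1 / (4 * W)))) := fun f => by
      rw [sub_eq_add_neg, ← hadd f t (-(1 / (4 * W))), ← hadd f t (1 / (4 * W))]
      simp only [G, E]
      ring
    simp_rw [e]
    rw [integral_const_mul_add_const_mul_add _ _ (hI _) (hI _) (hI _)]
    simp only [E]
    rw [integral_exp_eq_lpf hW, integral_exp_eq_lpf hW, integral_exp_eq_lpf hW, waveform]
    push_cast
    simp [c]

/-- At the sampling times, the filtered signal is the discrete convolution of the symbols with the
pulse samples. -/
theorem filteredSignal_waveform {W : ℝ} (hW : 0 < W) (l : ℝ) {n : ℕ} (x : Fin n → ℝ) (j : ℤ) :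
    filteredSignal W (waveform W l) x ((j : ℝ) * (1 / (4 * W)))
      = ∑ ℓ : Fin n, x ℓ * pulseSample l ((j : ℝ) - 2 * ((ℓ : ℝ) + 1)) := by
  set t := (j : ℝ) * (1 / (4 * W)) with ht
  have e : ∀ u, pamSignal W (waveform W l) x u * lpf W (t - u)
      = ∑ ℓ : Fin n, (1 / √(2 * W) * x ℓ) *
        (waveform W l (u - ((ℓ : ℝ) + 1) / (2 * W)) * lpf W (u - t)) := fun u => by
    rw [pamSignal, ← lpf_neg W (t - u), neg_sub, Finset.mul_sum, Finset.sum_mul]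
    exact Finset.sum_congr rfl fun ℓ _ => by ring
  unfold filteredSignal
  have i : ∀ ℓ : Fin n, Integrable fun u => (1 / √(2 * W) * x ℓ) *
      (waveform W l (u - ((ℓ : ℝ) + 1) / (2 * W)) * lpf W (u - t)) := fun ℓ =>
    ((memLp_waveform hW l _).integrable_mul (memLp_lpf hW t)).const_mul _
  simp_rw [e]
  rw [integral_finsetSum _ fun ℓ _ => i ℓ]
  refine Finset.sum_congr rfl fun ℓ _ => ?_
  rw [integral_const_mul, integral_waveform_mul_lpf hW, ← waveform_sample hW,
    show t - ((ℓ : ℝ) + 1) / (2 * W) = ((j : ℝ) - 2 * ((ℓ : ℝ) + 1)) / (4 * W) by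
      rw [ht]; field_simp; ring]
  ring

theorem memLp_pamSignal {W : ℝ} (hW : 0 < W) (l : ℝ) {n : ℕ} (x : Fin n → ℝ) :
    MemLp (pamSignal W (waveform W l) x) 2 := by
  have := (memLp_finsetSum (Finset.univ : Finset (Fin n)) fun ℓ _ =>
    (memLp_waveform hW l (((ℓ : ℝ) + 1) / (2 * W))).const_mul (x ℓ)).const_mul (1 / √(2 * W))
  exact this

/-- The energy of the transmitted signal, as a quadratic form in the symbols. -/
theorem integral_pamSignal_sq {W : ℝ} (hW : 0 < W) (l : ℝ) {n : ℕ} (x : Fin n → ℝ) :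
    ∫ t, pamSignal W (waveform W l) x t ^ 2
      = 1 / (2 * W) * ∑ ℓ : Fin n, ∑ m : Fin n, x ℓ * x m *
        ∫ t, waveform W l (t - ((ℓ : ℝ) + 1) / (2 * W)) *
          waveform W l (t - ((m : ℝ) + 1) / (2 * W)) := by
  have e : ∀ t, pamSignal W (waveform W l) x t ^ 2
      = 1 / (2 * W) * ∑ ℓ : Fin n, ∑ m : Fin n, x ℓ * x m *
        (waveform W l (t - ((ℓ : ℝ) + 1) / (2 * W)) *
          waveform W l (t - ((m : ℝ) + 1) / (2 * W))) := fun t => by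
    rw [pamSignal, mul_pow, div_pow, Real.sq_sqrt (by positivity), one_pow, sq, Finset.sum_mul_sum]
    congr 1
    exact Finset.sum_congr rfl fun ℓ _ => Finset.sum_congr rfl fun m _ => by ring
  have i : ∀ ℓ m : Fin n, Integrable fun t => x ℓ * x m *
        (waveform W l (t - ((ℓ : ℝ) + 1) / (2 * W)) *
          waveform W l (t - ((m : ℝ) + 1) / (2 * W))) := fun ℓ m =>
    ((memLp_waveform hW l _).integrable_mul (memLp_waveform hW l _)).const_mul _
  simp_rw [e]
  rw [integral_const_mul, integral_finsetSum _ fun ℓ _ => integrable_finsetSum _ fun m _ => i ℓ m]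
  congr 1
  refine Finset.sum_congr rfl fun ℓ _ => ?_
  rw [integral_finsetSum _ fun m _ => i ℓ m]
  exact Finset.sum_congr rfl fun m _ => integral_const_mul _ _

/-! ### Signs of Gaussian variables -/

/-- The hard-limiter as a real-valued function. -/
def sgn (r : ℝ) : ℝ := if 0 ≤ r then 1 else -1

theorem measurable_sgn : Measurable sgn :=
  Measurable.ite measurableSet_Ici measurable_const measurable_const

theorem sgn_eq_or (r : ℝ) : sgn r = 1 ∨ sgn r = -1 := by
  unfold sgn; split_ifs <;> simp

theorem abs_sgn (r : ℝ) : |sgn r| = 1 := by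
  rcases sgn_eq_or r with h | h <;> simp [h]

theorem sgn_mul_of_pos {c : ℝ} (hc : 0 < c) (r : ℝ) : sgn (c * r) = sgn r := by
  simp [sgn, hc]

/-- A shift changes the sign only of numbers that are at most as large as the shift. -/
theorem abs_sgn_add_sub_sgn_le (z m : ℝ) :
    |sgn (z + m) - sgn z| ≤ 2 * (Set.Icc (-|m|) |m|).indicator 1 z := by
  by_cases h : z ∈ Set.Icc (-|m|) |m|
  · simp only [Set.indicator_of_mem h, Pi.one_apply]
    rcases sgn_eq_or z with h1 | h1 <;> rcases sgn_eq_or (z + m) with h2 | h2 <;>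
      rw [h1, h2] <;> norm_num
  · rw [Set.indicator_of_notMem h]
    have : sgn (z + m) = sgn z := by
      rw [Set.mem_Icc, ← abs_le, not_le] at h
      unfold sgn
      rcases le_or_gt 0 z with hz | hz
      · rw [abs_of_nonneg hz] at h
        rw [if_pos hz, if_pos (by linarith [neg_abs_le m])]
      · rw [abs_of_neg hz] at h
        rw [if_neg hz.not_ge, if_neg (by linarith [le_abs_self m])]
    simp [this]

theorem lintegral_Ioi_mul_exp_neg_sq {c : ℝ} (hc : 0 < c) :
    ∫⁻ x in Set.Ioi (0 : ℝ), ENNReal.ofReal (x * Real.exp (-(c * x ^ 2 / 2)))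
      = ENNReal.ofReal c⁻¹ := by
  have hd : ∀ x ∈ Set.Ici (0 : ℝ), HasDerivAt (fun x : ℝ => -(c⁻¹ * Real.exp (-(c * x ^ 2 / 2))))
      (x * Real.exp (-(c * x ^ 2 / 2))) x := fun x _ => by
    have h1 : HasDerivAt (fun x : ℝ => -(c * x ^ 2 / 2)) (-(c * x)) x := by
      have := ((((hasDerivAt_id x).pow 2).const_mul c).div_const 2).neg
      refine this.congr_deriv ?_
      simp
      ring
    refine ((h1.exp.const_mul c⁻¹).neg).congr_deriv ?_
    field_simp
  have hlim : Tendsto (fun x : ℝ => -(c⁻¹ * Real.exp (-(c * x ^ 2 / 2)))) atTop (𝓝 0) := by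
    have h1 : Tendsto (fun x : ℝ => c * x ^ 2 / 2) atTop atTop :=
      ((tendsto_pow_atTop two_ne_zero).const_mul_atTop hc).atTop_div_const (by norm_num)
    have := ((Real.tendsto_exp_neg_atTop_nhds_zero.comp h1).const_mul c⁻¹).neg
    simpa using this
  have hpos : ∀ x ∈ Set.Ioi (0 : ℝ), 0 ≤ x * Real.exp (-(c * x ^ 2 / 2)) := fun x hx => by
    have : (0 : ℝ) < x := hx
    positivity
  have hint := integrableOn_Ioi_deriv_of_nonneg' hd hpos hlim
  rw [← ofReal_integral_eq_lintegral_ofReal hint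
    ((ae_restrict_iff' measurableSet_Ioi).2 (Eventually.of_forall hpos)),
    integral_Ioi_of_hasDerivAt_of_tendsto' hd hint hlim]
  simp

/-- The standard Gaussian measure of the sector bounded by the upper half of the second axis and a
ray of slope `-t`: in the coordinates `x` and `y / x` the density integrates to an arctangent. -/
theorem gaussian_sector (t : ℝ) :
    ((gaussianReal 0 1).prod (gaussianReal 0 1)) {p | 0 < p.1 ∧ 0 ≤ t * p.1 + p.2}
      = ENNReal.ofReal (1 / 4 + Real.arctan t / (2 * Real.pi)) := by
  have hpi := Real.pi_pos
  have hm : MeasurableSet {p : ℝ × ℝ | 0 < p.1 ∧ 0 ≤ t * p.1 + p.2} := by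
    have h1 : Measurable fun p : ℝ × ℝ => t * p.1 + p.2 := by fun_prop
    exact (measurableSet_lt measurable_const measurable_fst).inter
      (measurableSet_le measurable_const h1)
  have hpdf : ∀ x, gaussianPDF 0 1 x = ENNReal.ofReal ((√(2 * Real.pi))⁻¹ * Real.exp (-(x ^ 2 / 2))) :=
    fun x => by simp [gaussianPDF, gaussianPDFReal, neg_div]
  have hγ : gaussianReal 0 1 = volume.withDensity (gaussianPDF 0 1) :=
    gaussianReal_of_var_ne_zero _ one_ne_zero
  have hslice : ∀ x : ℝ, (gaussianReal 0 1) (Prod.mk x ⁻¹' {p : ℝ × ℝ | 0 < p.1 ∧ 0 ≤ t * p.1 + p.2})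
      = (Set.Ioi (0 : ℝ)).indicator (fun x => ∫⁻ τ in Set.Ici (-t),
        ENNReal.ofReal x * gaussianPDF 0 1 (τ * x)) x := fun x => by
    by_cases hx : 0 < x
    · rw [Set.indicator_of_mem (by exact hx)]
      have e1 : Prod.mk x ⁻¹' {p : ℝ × ℝ | 0 < p.1 ∧ 0 ≤ t * p.1 + p.2}
          = (fun τ => τ * x) '' Set.Ici (-t) := by
        ext y
        simp only [Set.mem_preimage, Set.mem_ofPred_eq, hx, true_and, Set.mem_image, Set.mem_Ici]
        constructor
        · intro h
          refine ⟨y / x, ?_, by field_simp⟩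
          rw [le_div_iff₀ hx]; linarith
        · rintro ⟨τ, hτ, rfl⟩
          nlinarith
      have e2 := lintegral_image_eq_lintegral_abs_deriv_mul (f := fun τ : ℝ => τ * x)
        (f' := fun _ => x) (s := Set.Ici (-t)) measurableSet_Ici
        (fun τ _ => by simpa using ((hasDerivAt_id τ).mul_const x).hasDerivWithinAt)
        (fun a _ b _ h => mul_right_cancel₀ hx.ne' h) (gaussianPDF 0 1)
      rw [e1, hγ, withDensity_apply', e2, abs_of_pos hx]
    · rw [Set.indicator_of_notMem (by exact hx)]
      simp [hx]
  have hswap : ∀ x τ : ℝ, 0 < x → gaussianPDF 0 1 x * (ENNReal.ofReal x * gaussianPDF 0 1 (τ * x))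
      = ENNReal.ofReal (2 * Real.pi)⁻¹ *
        ENNReal.ofReal (x * Real.exp (-((1 + τ ^ 2) * x ^ 2 / 2))) := fun x τ hx => by
    rw [hpdf, hpdf, ← ENNReal.ofReal_mul hx.le, ← ENNReal.ofReal_mul (by positivity),
      ← ENNReal.ofReal_mul (by positivity)]
    congr 1
    have h2 : (√(2 * Real.pi))⁻¹ * (√(2 * Real.pi))⁻¹ = (2 * Real.pi)⁻¹ := by
      rw [← mul_inv, Real.mul_self_sqrt (by positivity)]
    have h3 : Real.exp (-(x ^ 2 / 2)) * Real.exp (-((τ * x) ^ 2 / 2))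
        = Real.exp (-((1 + τ ^ 2) * x ^ 2 / 2)) := by
      rw [← Real.exp_add]; congr 1; ring
    rw [← h2, ← h3]; ring
  rw [Measure.prod_apply hm]
  simp_rw [hslice]
  rw [lintegral_indicator measurableSet_Ioi]
  rw [show (gaussianReal 0 1) = volume.withDensity (gaussianPDF 0 1) from hγ]
  have hmeas : Measurable (Function.uncurry fun x τ : ℝ => ENNReal.ofReal x * gaussianPDF 0 1 (τ * x)) :=
    (measurable_fst.ennreal_ofReal).mul ((measurable_gaussianPDF 0 1).comp
      (measurable_snd.mul measurable_fst))
  have hinner : Measurable fun x : ℝ => ∫⁻ τ in Set.Ici (-t),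
      ENNReal.ofReal x * gaussianPDF 0 1 (τ * x) := hmeas.lintegral_prod_right'
  refine (setLIntegral_withDensity_eq_setLIntegral_mul _ (measurable_gaussianPDF 0 1)
    hinner measurableSet_Ioi).trans ?_
  have e1 : ∀ x ∈ Set.Ioi (0 : ℝ), (gaussianPDF 0 1 * fun x => ∫⁻ τ in Set.Ici (-t),
      ENNReal.ofReal x * gaussianPDF 0 1 (τ * x)) x = ∫⁻ τ in Set.Ici (-t),
      ENNReal.ofReal (2 * Real.pi)⁻¹ *
        ENNReal.ofReal (x * Real.exp (-((1 + τ ^ 2) * x ^ 2 / 2))) := fun x hx => by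
    rw [Pi.mul_apply, ← lintegral_const_mul' _ _ (by simp [gaussianPDF])]
    exact lintegral_congr fun τ => hswap x τ hx
  refine (setLIntegral_congr_fun measurableSet_Ioi e1).trans ?_
  rw [lintegral_lintegral_swap (by fun_prop)]
  have e2 : ∀ τ : ℝ, ∫⁻ x in Set.Ioi (0 : ℝ), ENNReal.ofReal (2 * Real.pi)⁻¹ *
      ENNReal.ofReal (x * Real.exp (-((1 + τ ^ 2) * x ^ 2 / 2)))
      = ENNReal.ofReal ((2 * Real.pi)⁻¹ * (1 + τ ^ 2)⁻¹) := fun τ => by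
    rw [lintegral_const_mul' _ _ ENNReal.ofReal_ne_top, lintegral_Ioi_mul_exp_neg_sq (by positivity),
      ENNReal.ofReal_mul (by positivity)]
  simp_rw [e2]
  rw [← ofReal_integral_eq_lintegral_ofReal (integrable_inv_one_add_sq.const_mul _).integrableOn
    (Eventually.of_forall fun τ => by positivity), integral_const_mul, integral_Ici_eq_integral_Ioi,
    integral_Ioi_inv_one_add_sq, Real.arctan_neg]
  congr 1
  field_simp
  ring

theorem ae_ne_gaussianReal {v : NNReal} (hv : v ≠ 0) (μ c : ℝ) : ∀ᵐ x ∂gaussianReal μ v, x ≠ c := by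
  have := nullSingletonClass_gaussianReal (μ := μ) hv
  exact compl_mem_ae_iff.2 (measure_singleton c)

theorem integrable_of_abs_le {Ω : Type*} {_ : MeasurableSpace Ω} {P : Measure Ω} [IsFiniteMeasure P]
    {f : Ω → ℝ} (hf : AEStronglyMeasurable f P) {C : ℝ} (h : ∀ ω, |f ω| ≤ C) : Integrable f P :=
  Integrable.of_bound hf C (Eventually.of_forall h)

/-- Grothendieck's identity for a standard Gaussian pair, in terms of the slope `t`. -/
theorem integral_sgn_mul_sgn_std (t : ℝ) :
    ∫ p : ℝ × ℝ, sgn p.1 * sgn (t * p.1 + p.2) ∂(gaussianReal 0 1).prod (gaussianReal 0 1)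
      = 2 / Real.pi * Real.arctan t := by
  set γ := gaussianReal 0 1 with hγ
  set S : Set (ℝ × ℝ) := {p | 0 < p.1 ∧ 0 ≤ t * p.1 + p.2} with hS
  have hl : Measurable fun p : ℝ × ℝ => t * p.1 + p.2 := by fun_prop
  have hSm : MeasurableSet S :=
    (measurableSet_lt measurable_const measurable_fst).inter (measurableSet_le measurable_const hl)
  have hHm : MeasurableSet {p : ℝ × ℝ | 0 < p.1} := measurableSet_lt measurable_const measurable_fst
  have hneg : MeasurePreserving (fun p : ℝ × ℝ => (-p.1, -p.2)) (γ.prod γ) (γ.prod γ) := by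
    have h1 : MeasurePreserving (fun x : ℝ => -x) γ γ :=
      ⟨measurable_neg, by rw [hγ, gaussianReal_map_neg, neg_zero]⟩
    exact h1.prod h1
  have hae1 : ∀ᵐ p ∂γ.prod γ, p.1 ≠ 0 :=
    Measure.quasiMeasurePreserving_fst.ae (ae_ne_gaussianReal one_ne_zero 0 0)
  have hae2 : ∀ᵐ p ∂γ.prod γ, t * p.1 + p.2 ≠ 0 := by
    refine (Measure.ae_prod_iff_ae_ae (p := fun p : ℝ × ℝ => t * p.1 + p.2 ≠ 0)
      (measurableSet_eq_fun hl measurable_const).compl).2 ?_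
    refine Eventually.of_forall fun x => ?_
    filter_upwards [ae_ne_gaussianReal one_ne_zero 0 (-(t * x))] with y hy h
    exact hy (by linarith)
  have hsym : ∀ F : ℝ × ℝ → ℝ, Measurable F →
      ∫ p : ℝ × ℝ, F (-p.1, -p.2) ∂γ.prod γ = ∫ p, F p ∂γ.prod γ := fun F hF => by
    conv_rhs => rw [← hneg.map_eq]
    exact (integral_map hneg.measurable.aemeasurable hF.aestronglyMeasurable).symm
  set f : ℝ × ℝ → ℝ := {p : ℝ × ℝ | 0 < p.1}.indicator fun p => sgn (t * p.1 + p.2) with hf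
  have hfm : Measurable f := (measurable_sgn.comp hl).indicator hHm
  have hS1 : Integrable (S.indicator (1 : ℝ × ℝ → ℝ)) (γ.prod γ) :=
    (integrable_const (1 : ℝ)).indicator hSm
  have hH1 : Integrable ({p : ℝ × ℝ | 0 < p.1}.indicator (1 : ℝ × ℝ → ℝ)) (γ.prod γ) :=
    (integrable_const (1 : ℝ)).indicator hHm
  have hfe : ∀ p, f p = 2 * S.indicator 1 p - Set.indicator {p : ℝ × ℝ | 0 < p.1} 1 p := fun p => by
    simp only [hf, hS, sgn, Set.indicator_apply, Set.mem_ofPred_eq, Pi.one_apply]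
    split_ifs <;> grind
  have hfi : Integrable f (γ.prod γ) := by
    rw [show f = fun p => 2 * S.indicator 1 p - Set.indicator {p : ℝ × ℝ | 0 < p.1} 1 p from
      funext hfe]
    exact (hS1.const_mul 2).sub hH1
  have hsum : ∀ᵐ p ∂γ.prod γ, sgn p.1 * sgn (t * p.1 + p.2) = f p + f (-p.1, -p.2) := by
    filter_upwards [hae1, hae2] with p h1 h2
    simp only [hf, sgn, Set.indicator_apply, Set.mem_ofPred_eq]
    grind
  have hhalf : (γ.prod γ).real {p : ℝ × ℝ | 0 < p.1} = 1 / 2 := by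
    have h1 : ∀ᵐ p ∂γ.prod γ, (1 : ℝ) = {p : ℝ × ℝ | 0 < p.1}.indicator 1 p
        + {p : ℝ × ℝ | 0 < p.1}.indicator 1 (-p.1, -p.2) := by
      filter_upwards [hae1] with p h1
      simp only [Set.indicator_apply, Set.mem_ofPred_eq, Pi.one_apply]
      grind
    have h2 := integral_congr_ae h1
    have hH2 : Integrable (fun p : ℝ × ℝ =>
        {p : ℝ × ℝ | 0 < p.1}.indicator (1 : ℝ × ℝ → ℝ) (-p.1, -p.2)) (γ.prod γ) :=
      hneg.integrable_comp_of_integrable hH1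
    rw [integral_add hH1 hH2,
      hsym _ (measurable_one.indicator hHm), integral_indicator_one hHm] at h2
    simp at h2
    linarith
  have hint : ∫ p, f p ∂γ.prod γ = 1 / Real.pi * Real.arctan t := by
    simp_rw [hfe]
    rw [integral_sub (hS1.const_mul 2) hH1, integral_const_mul, integral_indicator_one hSm,
      integral_indicator_one hHm, hhalf, measureReal_def, hS, hγ, gaussian_sector,
      ENNReal.toReal_ofReal]
    · field_simp; ring
    · have := Real.neg_pi_div_two_lt_arctan t
      have hp := Real.pi_pos
      rw [div_add_div _ _ (by norm_num) (by positivity)]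
      apply div_nonneg <;> nlinarith
  have hfi' : Integrable (fun p : ℝ × ℝ => f (-p.1, -p.2)) (γ.prod γ) :=
    hneg.integrable_comp_of_integrable hfi
  rw [integral_congr_ae hsum, integral_add hfi hfi', hsym f hfm, hint]
  ring

/-! ### The arcsine identity and small shifts -/

/-- **Grothendieck's identity** for a centred Gaussian pair. -/
theorem integral_sgn_mul_sgn {Ω : Type*} {_ : MeasurableSpace Ω} {P : Measure Ω} {U V : Ω → ℝ}
    (h : HasGaussianLaw (fun ω => (U ω, V ω)) P) (hU : P[U] = 0) (hV : P[V] = 0) {a b c : ℝ}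
    (ha : 0 < a) (hc : c ^ 2 < a * b) (hVU : Var[U; P] = a) (hVV : Var[V; P] = b)
    (hcov : cov[U, V; P] = c) :
    ∫ ω, sgn (U ω) * sgn (V ω) ∂P = 2 / Real.pi * Real.arcsin (c / √(a * b)) := by
  have := h.isProbabilityMeasure
  have hUL := h.fst.memLp_two
  have hVL := h.snd.memLp_two
  set r := b - c ^ 2 / a with hr
  have hr0 : 0 < r := by
    rw [hr, sub_pos, div_lt_iff₀ ha]; linarith
  have hsa : 0 < √a := by positivity
  have hsr : 0 < √r := by positivity
  have hsa2 : √a * √a = a := Real.mul_self_sqrt ha.le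
  have hsr2 : √r * √r = r := Real.mul_self_sqrt hr0.le
  let X : Ω → ℝ := fun ω => (√a)⁻¹ * U ω
  let Y : Ω → ℝ := fun ω => (√r)⁻¹ * (V ω - c / a * U ω)
  have hXY : HasGaussianLaw (fun ω => (X ω, Y ω)) P := by
    have := h.map_fun (((√a)⁻¹ • ContinuousLinearMap.fst ℝ ℝ ℝ).prod
      ((√r)⁻¹ • (ContinuousLinearMap.snd ℝ ℝ ℝ - (c / a) • ContinuousLinearMap.fst ℝ ℝ ℝ)))
    simpa [X, Y] using this
  have hW : MemLp (fun ω => V ω - c / a * U ω) 2 P := hVL.sub (hUL.const_mul _)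
  have hcUU : cov[U, U; P] = a := by rw [covariance_self hUL.aemeasurable, hVU]
  have hcVV : cov[V, V; P] = b := by rw [covariance_self hVL.aemeasurable, hVV]
  have hcUW : cov[U, fun ω => V ω - c / a * U ω; P] = 0 := by
    rw [covariance_fun_sub_right hUL hVL (hUL.const_mul _), covariance_const_mul_right, hcUU, hcov]
    field_simp
    ring
  have hcVW : cov[V, fun ω => V ω - c / a * U ω; P] = r := by
    rw [covariance_fun_sub_right hVL hVL (hUL.const_mul _), covariance_const_mul_right, hcVV,
      covariance_comm, hcov, hr]
    ring
  have hcWW : cov[fun ω => V ω - c / a * U ω, fun ω => V ω - c / a * U ω; P] = r := by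
    rw [covariance_fun_sub_left hVL (hUL.const_mul _) hW, covariance_const_mul_left, hcUW, hcVW]
    ring
  have hind : IndepFun X Y P := hXY.indepFun_of_covariance_eq_zero (by
    simp only [X, Y]
    rw [covariance_const_mul_left, covariance_const_mul_right, hcUW]
    ring)
  have hlX : P.map X = gaussianReal 0 1 := by
    rw [hXY.fst.map_eq_gaussianReal]
    congr 1
    · simp only [X]; rw [integral_const_mul, hU, mul_zero]
    · rw [← covariance_self hXY.fst.aemeasurable]
      simp only [X]
      rw [covariance_const_mul_left, covariance_const_mul_right, hcUU]
      rw [← mul_assoc, ← mul_inv, hsa2, inv_mul_cancel₀ ha.ne', Real.toNNReal_one]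
  have hlY : P.map Y = gaussianReal 0 1 := by
    rw [hXY.snd.map_eq_gaussianReal]
    congr 1
    · simp only [Y]
      rw [integral_const_mul, integral_sub h.snd.integrable (h.fst.integrable.const_mul _),
        integral_const_mul, hU, hV]
      ring
    · rw [← covariance_self hXY.snd.aemeasurable]
      simp only [Y]
      rw [covariance_const_mul_left, covariance_const_mul_right, hcWW]
      rw [← mul_assoc, ← mul_inv, hsr2, inv_mul_cancel₀ hr0.ne', Real.toNNReal_one]
  have hprod : P.map (fun ω => (X ω, Y ω)) = (gaussianReal 0 1).prod (gaussianReal 0 1) := by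
    rw [(indepFun_iff_map_prod_eq_prod_map_map hXY.fst.aemeasurable hXY.snd.aemeasurable).1 hind,
      hlX, hlY]
  set t := c / a * √a / √r with ht
  have e : ∀ ω, sgn (U ω) * sgn (V ω) = sgn (X ω) * sgn (t * X ω + Y ω) := fun ω => by
    rw [← sgn_mul_of_pos hsr (t * X ω + Y ω), sgn_mul_of_pos (inv_pos.2 hsa) (U ω)]
    congr 2
    simp only [X, Y, ht]
    field_simp
    ring
  have hm : Measurable fun p : ℝ × ℝ => sgn p.1 * sgn (t * p.1 + p.2) :=
    (measurable_sgn.comp measurable_fst).mul (measurable_sgn.comp (by fun_prop))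
  simp_rw [e]
  rw [← integral_map (φ := fun ω => (X ω, Y ω)) (f := fun p : ℝ × ℝ => sgn p.1 * sgn (t * p.1 + p.2))
    hXY.aemeasurable hm.aestronglyMeasurable, hprod, integral_sgn_mul_sgn_std, Real.arcsin_eq_arctan]
  · have hb : 0 < a * b := lt_of_le_of_lt (sq_nonneg c) hc
    have hb0 : b ≠ 0 := by rintro rfl; simp at hb
    congr 2
    have h1 : 1 - (c / √(a * b)) ^ 2 = a * r / (a * b) := by
      rw [div_pow, Real.sq_sqrt hb.le, hr]; field_simp
    rw [h1, Real.sqrt_div (by positivity), Real.sqrt_mul ha.le r, ht, div_div_div_cancel_right₀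
      (by positivity)]
    have : a = √a * √a := hsa2.symm
    nth_rw 1 [this]
    field_simp
  · have hb : 0 < a * b := lt_of_le_of_lt (sq_nonneg c) hc
    have h1 : |c / √(a * b)| < 1 := by
      rw [abs_div, abs_of_nonneg (Real.sqrt_nonneg _), div_lt_one (by positivity)]
      exact Real.lt_sqrt_of_sq_lt (by rwa [sq_abs])
    exact ⟨(abs_lt.1 h1).1, (abs_lt.1 h1).2⟩

/-- A Gaussian variable of variance at least `1/4` has density at most `1`. -/
theorem gaussianReal_Icc_le {v : NNReal} (hv : (1 : ℝ) / 4 ≤ v) {a : ℝ} (ha : 0 ≤ a) :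
    (gaussianReal 0 v).real (Set.Icc (-a) a) ≤ 2 * a := by
  have hv0 : v ≠ 0 := by rintro rfl; norm_num at hv
  have hpdf : ∀ x, gaussianPDF 0 v x ≤ 1 := fun x => by
    rw [gaussianPDF, ← ENNReal.ofReal_one]
    refine ENNReal.ofReal_le_ofReal ?_
    rw [gaussianPDFReal]
    have h1 : 1 ≤ √(2 * Real.pi * v) := by
      rw [Real.one_le_sqrt]; nlinarith [Real.pi_gt_three]
    have h2 : Real.exp (-(x - 0) ^ 2 / (2 * v)) ≤ 1 := by
      rw [Real.exp_le_one_iff, neg_div]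
      have : 0 ≤ (x - 0) ^ 2 / (2 * (v : ℝ)) := by positivity
      linarith
    exact mul_le_one₀ (inv_le_one_of_one_le₀ h1) (Real.exp_nonneg _) h2
  have h : (gaussianReal 0 v) (Set.Icc (-a) a) ≤ ENNReal.ofReal (2 * a) := by
    rw [gaussianReal_apply _ hv0]
    calc _ ≤ ∫⁻ _ in Set.Icc (-a) a, 1 := lintegral_mono fun x => hpdf x
      _ = _ := by rw [setLIntegral_one, Real.volume_Icc]; congr 1; ring
  exact ENNReal.toReal_le_of_le_ofReal (by linarith) h

theorem measureReal_abs_le {Ω : Type*} {_ : MeasurableSpace Ω} {P : Measure Ω} {U : Ω → ℝ}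
    (h : HasGaussianLaw U P) (hU : P[U] = 0) (hv : 1 / 4 ≤ Var[U; P]) {a : ℝ} (ha : 0 ≤ a) :
    P.real {ω | U ω ∈ Set.Icc (-a) a} ≤ 2 * a := by
  have h1 := gaussianReal_Icc_le (v := Var[U; P].toNNReal) (hv.trans (Real.le_coe_toNNReal _)) ha
  rw [← hU, ← h.map_eq_gaussianReal, map_measureReal_apply_of_aemeasurable h.aemeasurable
    measurableSet_Icc] at h1
  exact h1

/-- The mean response of the hard-limiter to a shift `m` of a standard Gaussian. -/
theorem abs_integral_sgn_add_sub_sgn_le (m : ℝ) :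
    |∫ z, (sgn (z + m) - sgn z) ∂gaussianReal 0 1 - 2 / √(2 * Real.pi) * m| ≤ 2 * m ^ 2 := by
  set D : ℝ → ℝ := fun z => sgn (z + m) - sgn z with hD
  have hDm : Measurable D := (measurable_sgn.comp (by fun_prop)).sub measurable_sgn
  have hDle : ∀ z, |D z| ≤ 2 * (Set.Icc (-|m|) |m|).indicator 1 z := fun z =>
    abs_sgn_add_sub_sgn_le z m
  have hI1 : Integrable ((Set.Icc (-|m|) |m|).indicator (1 : ℝ → ℝ)) :=
    (integrable_indicator_iff measurableSet_Icc).2 (integrableOn_const (by simp))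
  have hDi : Integrable D := (hI1.const_mul 2).mono' hDm.aestronglyMeasurable
    (Eventually.of_forall hDle)
  have hD2 : ∫ z, D z = 2 * m := by
    rcases le_or_gt 0 m with hm | hm
    · have : D = fun z => 2 * (Set.Ico (-m) 0).indicator 1 z := by
        ext z
        simp only [hD, sgn, Set.indicator_apply, Set.mem_Ico, Pi.one_apply]
        split_ifs <;> grind
      rw [this, integral_const_mul, integral_indicator_one measurableSet_Ico]
      simp [measureReal_def, hm]
    · have : D = fun z => (-2) * (Set.Ico 0 (-m)).indicator 1 z := by
        ext z
        simp only [hD, sgn, Set.indicator_apply, Set.mem_Ico, Pi.one_apply]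
        split_ifs <;> grind
      rw [this, integral_const_mul, integral_indicator_one measurableSet_Ico]
      simp [measureReal_def, hm.le]
  set p0 := (√(2 * Real.pi))⁻¹ with hp0
  have hp0p : 0 < p0 := by have := Real.pi_pos; positivity
  have hp01 : p0 ≤ 1 / 2 := by
    rw [hp0, ← one_div]
    refine one_div_le_one_div_of_le (by norm_num) ?_
    rw [Real.le_sqrt' (by norm_num)]; linarith [Real.pi_gt_three]
  have hpdf : ∀ z, |gaussianPDFReal 0 1 z - p0| ≤ p0 * |z| := fun z => by
    have e : gaussianPDFReal 0 1 z = p0 * Real.exp (-(z ^ 2 / 2)) := by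
      simp [gaussianPDFReal, hp0, neg_div]
    rw [e, show p0 * Real.exp (-(z ^ 2 / 2)) - p0 = -(p0 * (1 - Real.exp (-(z ^ 2 / 2)))) by ring,
      abs_neg, abs_mul, abs_of_pos hp0p]
    refine mul_le_mul_of_nonneg_left ?_ hp0p.le
    have h1 : Real.exp (-(z ^ 2 / 2)) ≤ 1 := by
      rw [Real.exp_le_one_iff]; have := sq_nonneg z; linarith
    rw [abs_of_nonneg (by linarith)]
    have h2 := Real.add_one_le_exp (-(z ^ 2 / 2))
    have h3 := Real.exp_pos (-(z ^ 2 / 2))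
    rcases le_or_gt |z| 2 with hz | hz
    · have : z ^ 2 / 2 ≤ |z| := by rw [← sq_abs]; nlinarith [abs_nonneg z]
      linarith
    · linarith
  have hmul : Integrable fun z => gaussianPDFReal 0 1 z * D z := by
    refine ((hI1.const_mul 2).const_mul (p0 * |m| + p0)).mono'
      ((measurable_gaussianPDFReal 0 1).mul hDm).aestronglyMeasurable (Eventually.of_forall fun z => ?_)
    rw [Real.norm_eq_abs, abs_mul]
    by_cases hz : z ∈ Set.Icc (-|m|) |m|
    · refine mul_le_mul ?_ (hDle z) (abs_nonneg _) (by positivity)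
      have h1 := abs_le.1 (hpdf z)
      have h2 : p0 * |z| ≤ p0 * |m| := mul_le_mul_of_nonneg_left (abs_le.2 hz) hp0p.le
      rw [abs_of_nonneg (gaussianPDFReal_nonneg _ _ _)]
      linarith
    · have := hDle z
      rw [Set.indicator_of_notMem hz] at this ⊢
      have h0 : |D z| = 0 := le_antisymm (by linarith) (abs_nonneg _)
      rw [h0]; simp
  have e1 : ∫ z, D z ∂gaussianReal 0 1 - 2 / √(2 * Real.pi) * m
      = ∫ z, (gaussianPDFReal 0 1 z - p0) * D z := by
    rw [integral_gaussianReal_eq_integral_smul one_ne_zero]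
    simp only [smul_eq_mul, sub_mul]
    rw [integral_sub hmul (hDi.const_mul _), integral_const_mul, hD2, hp0]
    ring
  rw [e1, ← Real.norm_eq_abs]
  calc ‖∫ z, (gaussianPDFReal 0 1 z - p0) * D z‖
      ≤ ∫ z, (|m| * (Set.Icc (-|m|) |m|).indicator 1 z) := by
        refine norm_integral_le_of_norm_le (hI1.const_mul _) (Eventually.of_forall fun z => ?_)
        rw [Real.norm_eq_abs, abs_mul]
        by_cases hz : z ∈ Set.Icc (-|m|) |m|
        · have h1 := hDle z
          rw [Set.indicator_of_mem hz, Pi.one_apply] at h1 ⊢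
          have h2 : p0 * |z| ≤ 1 / 2 * |m| :=
            mul_le_mul hp01 (abs_le.2 hz) (abs_nonneg _) (by norm_num)
          calc _ ≤ (1 / 2 * |m|) * (2 * 1) :=
                mul_le_mul ((hpdf z).trans h2) h1 (abs_nonneg _) (by positivity)
            _ = _ := by ring
        · have := hDle z
          rw [Set.indicator_of_notMem hz] at this ⊢
          have h0 : |D z| = 0 := le_antisymm (by linarith) (abs_nonneg _)
          rw [h0]; simp
    _ = 2 * m ^ 2 := by
        rw [integral_const_mul, integral_indicator_one measurableSet_Icc, measureReal_def,
          Real.volume_Icc, ENNReal.toReal_ofReal (by linarith [abs_nonneg m]), ← sq_abs m]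
        ring

/-! ### Response of a product of three signs -/

theorem abs_sgn_mul_sub_sgn_mul_le (x y x' y' : ℝ) :
    |sgn x * sgn y - sgn x' * sgn y'| ≤ |sgn x - sgn x'| + |sgn y - sgn y'| := by
  have e : sgn x * sgn y - sgn x' * sgn y' = (sgn x - sgn x') * sgn y + sgn x' * (sgn y - sgn y') := by
    ring
  rw [e]
  refine (abs_add_le _ _).trans ?_
  rw [abs_mul, abs_mul, abs_sgn, abs_sgn, mul_one, one_mul]

section Response

variable {Ω : Type*} {mΩ : MeasurableSpace Ω} {P : Measure Ω} [IsProbabilityMeasure P]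

/-- Mean response of a product of three hard-limited variables to a shift `m₁` of the first one. The
factor `sgn (Z + m₁) - sgn Z` restricts to `|Z| ≤ |m₁|`, where the other two variables can be
replaced by their parts `U`, `V` independent of `Z`, at a cost of second order. -/
theorem abs_integral_sgn_shift_sub_le {Z U V : Ω → ℝ} (hZ : HasLaw Z (gaussianReal 0 1) P)
    (hU : AEMeasurable U P) (hV : AEMeasurable V P) (hind : IndepFun Z (fun ω => (U ω, V ω)) P)
    (hUs : ∀ a, 0 ≤ a → P.real {ω | U ω ∈ Set.Icc (-a) a} ≤ 2 * a)
    (hVs : ∀ a, 0 ≤ a → P.real {ω | V ω ∈ Set.Icc (-a) a} ≤ 2 * a)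
    {c d : ℝ} (hc : |c| ≤ 1) (hd : |d| ≤ 1) (m₁ m₂ m₃ : ℝ) :
    |∫ ω, (sgn (Z ω + m₁) - sgn (Z ω)) * (sgn (U ω + c * Z ω + m₂) * sgn (V ω + d * Z ω + m₃)) ∂P
      - 2 / √(2 * Real.pi) * m₁ * ∫ ω, sgn (U ω) * sgn (V ω) ∂P|
      ≤ 60 * (m₁ ^ 2 + m₂ ^ 2 + m₃ ^ 2) := by
  have hZm := hZ.aemeasurable
  set A : Ω → ℝ := fun ω => sgn (Z ω + m₁) - sgn (Z ω) with hA
  set B : Ω → ℝ := fun ω => sgn (U ω + c * Z ω + m₂) * sgn (V ω + d * Z ω + m₃) with hB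
  set B' : Ω → ℝ := fun ω => sgn (U ω) * sgn (V ω) with hB'
  set κ := ∫ ω, B' ω ∂P with hκ
  have hfA : Measurable fun z : ℝ => sgn (z + m₁) - sgn z :=
    (measurable_sgn.comp (by fun_prop)).sub measurable_sgn
  have hAm : AEStronglyMeasurable A P := (hfA.comp_aemeasurable hZm).aestronglyMeasurable
  have hfB : Measurable fun p : ℝ × ℝ => sgn p.1 * sgn p.2 :=
    (measurable_sgn.comp measurable_fst).mul (measurable_sgn.comp measurable_snd)
  have hB'm : AEStronglyMeasurable B' P := (hfB.comp_aemeasurable (hU.prodMk hV)).aestronglyMeasurable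
  have hBm : AEStronglyMeasurable B P :=
    (measurable_sgn.comp_aemeasurable ((hU.add (hZm.const_mul c)).add_const m₂)).aestronglyMeasurable.mul
    (measurable_sgn.comp_aemeasurable ((hV.add (hZm.const_mul d)).add_const m₃)).aestronglyMeasurable
  have hAb : ∀ ω, |A ω| ≤ 2 := fun ω => by
    refine (abs_sub _ _).trans ?_
    rw [abs_sgn, abs_sgn]; norm_num
  have hBb : ∀ ω, |B ω| ≤ 1 := fun ω => by simp only [hB]; rw [abs_mul, abs_sgn, abs_sgn]; norm_num
  have hB'b : ∀ ω, |B' ω| ≤ 1 := fun ω => by simp only [hB']; rw [abs_mul, abs_sgn, abs_sgn]; norm_num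
  have hκ1 : |κ| ≤ 1 := by
    have := norm_integral_le_of_norm_le_const (μ := P) (f := B') (C := 1)
      (Eventually.of_forall hB'b)
    simpa using this
  have iAB : Integrable (fun ω => A ω * B ω) P := integrable_of_abs_le (hAm.mul hBm) (C := 2) fun ω => by
    rw [abs_mul]; nlinarith [hAb ω, hBb ω, abs_nonneg (A ω), abs_nonneg (B ω)]
  have iAB' : Integrable (fun ω => A ω * B' ω) P :=
    integrable_of_abs_le (hAm.mul hB'm) (C := 2) fun ω => by
      rw [abs_mul]; nlinarith [hAb ω, hB'b ω, abs_nonneg (A ω), abs_nonneg (B' ω)]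
  -- `A` depends on `Z` only and `B'` on `U`, `V` only, so the mean of their product factors
  have hmain : ∫ ω, A ω * B' ω ∂P = (∫ ω, A ω ∂P) * κ := by
    have h1 : IndepFun A B' P := hind.comp hfA hfB
    exact h1.integral_fun_mul_eq_mul_integral hAm hB'm
  have hEA : |∫ ω, A ω ∂P - 2 / √(2 * Real.pi) * m₁| ≤ 2 * m₁ ^ 2 := by
    have : ∫ ω, A ω ∂P = ∫ z, (sgn (z + m₁) - sgn z) ∂gaussianReal 0 1 :=
      hZ.integral_comp hfA.aestronglyMeasurable
    rw [this]
    exact abs_integral_sgn_add_sub_sgn_le m₁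
  have hmain2 : |∫ ω, A ω * B' ω ∂P - 2 / √(2 * Real.pi) * m₁ * κ| ≤ 2 * m₁ ^ 2 := by
    rw [hmain, ← sub_mul, abs_mul]
    nlinarith [abs_nonneg (∫ ω, A ω ∂P - 2 / √(2 * Real.pi) * m₁), abs_nonneg κ]
  -- replacing `B` by `B'` matters only if `Z` and one of `U`, `V` are small; these are independent
  -- events whose probabilities are each of first order in the shifts
  set a := |m₁| + |m₂| with ha
  set b := |m₁| + |m₃| with hb
  have ha0 : 0 ≤ a := by positivity
  have hb0 : 0 ≤ b := by positivity
  set SZ := {ω | Z ω ∈ Set.Icc (-|m₁|) |m₁|} with hSZ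
  set SU := {ω | U ω ∈ Set.Icc (-a) a} with hSU
  set SV := {ω | V ω ∈ Set.Icc (-b) b} with hSV
  have nSZ : NullMeasurableSet SZ P := hZm.nullMeasurable measurableSet_Icc
  have nSU : NullMeasurableSet SU P := hU.nullMeasurable measurableSet_Icc
  have nSV : NullMeasurableSet SV P := hV.nullMeasurable measurableSet_Icc
  have hpZ : P.real SZ ≤ 2 * |m₁| := by
    have h1 := gaussianReal_Icc_le (v := 1) (by norm_num) (abs_nonneg m₁)
    rwa [← hZ.map_eq, map_measureReal_apply_of_aemeasurable hZm measurableSet_Icc] at h1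
  have hpZU : P.real (SZ ∩ SU) = P.real SZ * P.real SU := by
    have := (hind.comp measurable_id measurable_fst).measure_inter_preimage_eq_mul
      (Set.Icc (-|m₁|) |m₁|) (Set.Icc (-a) a) measurableSet_Icc measurableSet_Icc
    rw [measureReal_def, measureReal_def, measureReal_def, ← ENNReal.toReal_mul]
    exact congrArg _ this
  have hpZV : P.real (SZ ∩ SV) = P.real SZ * P.real SV := by
    have := (hind.comp measurable_id measurable_snd).measure_inter_preimage_eq_mul
      (Set.Icc (-|m₁|) |m₁|) (Set.Icc (-b) b) measurableSet_Icc measurableSet_Icc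
    rw [measureReal_def, measureReal_def, measureReal_def, ← ENNReal.toReal_mul]
    exact congrArg _ this
  have hpoint : ∀ ω, |A ω * B ω - A ω * B' ω|
      ≤ 4 * ((SZ ∩ SU).indicator 1 ω + (SZ ∩ SV).indicator 1 ω) := fun ω => by
    have hz := abs_sgn_add_sub_sgn_le (Z ω) m₁
    rw [← mul_sub, abs_mul]
    by_cases hω : Z ω ∈ Set.Icc (-|m₁|) |m₁|
    · have hωa := abs_le.2 hω
      have h1 := abs_sgn_mul_sub_sgn_mul_le (U ω + c * Z ω + m₂) (V ω + d * Z ω + m₃) (U ω) (V ω)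
      have key : ∀ (x e q : ℝ), |e| ≤ 1 → |sgn (x + e * Z ω + q) - sgn x|
          ≤ 2 * (Set.Icc (-(|m₁| + |q|)) (|m₁| + |q|)).indicator 1 x := fun x e q he => by
        have h2 := abs_sgn_add_sub_sgn_le x (e * Z ω + q)
        rw [← add_assoc] at h2
        refine h2.trans ?_
        have h3 : |e * Z ω + q| ≤ |m₁| + |q| := by
          refine (abs_add_le _ _).trans ?_
          rw [abs_mul]; nlinarith [abs_nonneg e, abs_nonneg (Z ω)]
        refine mul_le_mul_of_nonneg_left ?_ (by norm_num)
        exact Set.indicator_le_indicator_of_subset (Set.Icc_subset_Icc (by linarith) h3)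
          (fun _ => zero_le_one) x
      have hu := key (U ω) c m₂ hc
      have hv := key (V ω) d m₃ hd
      have iU : (SZ ∩ SU).indicator (1 : Ω → ℝ) ω = (Set.Icc (-a) a).indicator 1 (U ω) := by
        simp [Set.indicator_apply, hSZ, hSU, abs_le.1 hωa]
      have iV : (SZ ∩ SV).indicator (1 : Ω → ℝ) ω = (Set.Icc (-b) b).indicator 1 (V ω) := by
        simp [Set.indicator_apply, hSZ, hSV, abs_le.1 hωa]
      rw [iU, iV]
      have hb1 : |B ω - B' ω| ≤ 2 * (Set.Icc (-a) a).indicator 1 (U ω)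
          + 2 * (Set.Icc (-b) b).indicator 1 (V ω) := by
        simp only [hB, hB']; linarith
      calc _ ≤ 2 * (2 * (Set.Icc (-a) a).indicator 1 (U ω)
          + 2 * (Set.Icc (-b) b).indicator 1 (V ω)) :=
            mul_le_mul (hAb ω) hb1 (abs_nonneg _) (by norm_num)
        _ = _ := by ring
    · rw [Set.indicator_of_notMem hω] at hz
      have h0 : |A ω| = 0 := le_antisymm (by simpa [hA] using hz) (abs_nonneg _)
      rw [h0, zero_mul]
      have h1 : 0 ≤ (SZ ∩ SU).indicator (1 : Ω → ℝ) ω := Set.indicator_nonneg (fun _ _ => zero_le_one) _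
      have h2 : 0 ≤ (SZ ∩ SV).indicator (1 : Ω → ℝ) ω := Set.indicator_nonneg (fun _ _ => zero_le_one) _
      linarith
  have iU : Integrable ((SZ ∩ SU).indicator (1 : Ω → ℝ)) P :=
    (integrable_const (1 : ℝ)).indicator₀ (nSZ.inter nSU)
  have iV : Integrable ((SZ ∩ SV).indicator (1 : Ω → ℝ)) P :=
    (integrable_const (1 : ℝ)).indicator₀ (nSZ.inter nSV)
  have herr : |∫ ω, A ω * B ω ∂P - ∫ ω, A ω * B' ω ∂P| ≤ 4 * (P.real (SZ ∩ SU) + P.real (SZ ∩ SV)) := by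
    rw [← integral_sub iAB iAB', ← Real.norm_eq_abs]
    refine (norm_integral_le_of_norm_le ((iU.add iV).const_mul 4) (Eventually.of_forall hpoint)).trans ?_
    rw [integral_const_mul]
    simp only [Pi.add_apply]
    rw [integral_add iU iV, integral_indicator₀ (nSZ.inter nSU), integral_indicator₀ (nSZ.inter nSV)]
    simp
  have hU2 := hUs a ha0
  have hV2 := hVs b hb0
  rw [hpZU, hpZV] at herr
  have h1 : P.real SZ * P.real SU ≤ 2 * |m₁| * (2 * a) :=
    mul_le_mul hpZ hU2 measureReal_nonneg (by positivity)
  have h2 : P.real SZ * P.real SV ≤ 2 * |m₁| * (2 * b) :=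
    mul_le_mul hpZ hV2 measureReal_nonneg (by positivity)
  have h3 := abs_sub_le (∫ ω, A ω * B ω ∂P) (∫ ω, A ω * B' ω ∂P) (2 / √(2 * Real.pi) * m₁ * κ)
  rw [← sq_abs m₁, ← sq_abs m₂, ← sq_abs m₃]
  rw [← sq_abs m₁] at hmain2
  change |∫ ω, A ω * B ω ∂P - 2 / √(2 * Real.pi) * m₁ * κ| ≤ _
  have h4 : 2 * |m₁| * (2 * a) + 2 * |m₁| * (2 * b)
      = 8 * |m₁| ^ 2 + 4 * (|m₁| * |m₂|) + 4 * (|m₁| * |m₃|) := by rw [ha, hb]; ring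
  nlinarith [sq_nonneg (|m₁| - |m₂|), sq_nonneg (|m₁| - |m₃|), sq_nonneg |m₂|, sq_nonneg |m₃|]

end Response

/-! ### Three consecutive noise samples -/

/-- The correlation of two neighbouring noise samples at sampling rate `4W`. -/
def rho : ℝ := 2 / Real.pi

theorem rho_pos : 0 < rho := div_pos two_pos Real.pi_pos

theorem rho_le : rho ≤ 2 / 3 :=
  div_le_div_of_nonneg_left (by norm_num) (by norm_num) Real.pi_gt_three.le

theorem rho_sq_le : rho ^ 2 ≤ 4 / 9 := by nlinarith [rho_pos, rho_le]

/-- The correlation matrix of three consecutive noise samples at sampling rate `4W`. -/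
def noiseCorr : Matrix (Fin 3) (Fin 3) ℝ := !![1, rho, 0; rho, 1, rho; 0, rho, 1]

/-- `Z` consists of three consecutive noise samples, normalized to unit variance. -/
structure IsNoiseTriple {Ω : Type*} {_ : MeasurableSpace Ω} (Z : Fin 3 → Ω → ℝ) (P : Measure Ω) :
    Prop where
  hasGaussianLaw : HasGaussianLaw (fun ω i => Z i ω) P
  integral_eq : ∀ i, P[Z i] = 0
  cov_eq : ∀ i j, cov[Z i, Z j; P] = noiseCorr i j

namespace IsNoiseTriple

variable {Ω : Type*} {mΩ : MeasurableSpace Ω} {P : Measure Ω} {Z : Fin 3 → Ω → ℝ}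

theorem gauss (h : IsNoiseTriple Z P) (i : Fin 3) : HasGaussianLaw (Z i) P :=
  h.hasGaussianLaw.eval i

theorem isProbabilityMeasure (h : IsNoiseTriple Z P) : IsProbabilityMeasure P :=
  h.hasGaussianLaw.isProbabilityMeasure

theorem variance_eq (h : IsNoiseTriple Z P) (i : Fin 3) : Var[Z i; P] = 1 := by
  rw [← covariance_self (h.gauss i).aemeasurable, h.cov_eq]
  fin_cases i <;> simp [noiseCorr]

theorem hasLaw (h : IsNoiseTriple Z P) (i : Fin 3) : HasLaw (Z i) (gaussianReal 0 1) P :=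
  ⟨(h.gauss i).aemeasurable, by
    rw [(h.gauss i).map_eq_gaussianReal, h.integral_eq, h.variance_eq, Real.toNNReal_one]⟩

/-- Second moments of the hard-limited noise. -/
theorem integral_sgn_mul_sgn (h : IsNoiseTriple Z P) {i j : Fin 3} (hij : noiseCorr i j ^ 2 < 1) :
    ∫ ω, sgn (Z i ω) * sgn (Z j ω) ∂P = 2 / Real.pi * Real.arcsin (noiseCorr i j) := by
  rw [OneBitAWGN.integral_sgn_mul_sgn (h.hasGaussianLaw.prodMk i j) (h.integral_eq i)
    (h.integral_eq j) one_pos (by simpa using hij) (h.variance_eq i) (h.variance_eq j) (h.cov_eq i j)]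
  simp

/-- The mean response of the product of three hard-limited noise samples to a shift of sample `i`:
a zero of sample `i` leaves the other two with the conditional covariance given that `Z i = 0`. -/
theorem abs_integral_sgn_shift_sub_le (h : IsNoiseTriple Z P) {i j k : Fin 3} {p q s : ℝ}
    (hp : noiseCorr i j = p) (hq : noiseCorr i k = q) (hs : noiseCorr j k = s)
    (hp1 : p ^ 2 ≤ 3 / 4) (hq1 : q ^ 2 ≤ 3 / 4) (hs1 : (s - p * q) ^ 2 < (1 - p ^ 2) * (1 - q ^ 2))
    (m₁ m₂ m₃ : ℝ) :
    |∫ ω, (sgn (Z i ω + m₁) - sgn (Z i ω)) * (sgn (Z j ω + m₂) * sgn (Z k ω + m₃)) ∂P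
      - 2 / √(2 * Real.pi) * m₁ *
        (2 / Real.pi * Real.arcsin ((s - p * q) / √((1 - p ^ 2) * (1 - q ^ 2))))|
      ≤ 60 * (m₁ ^ 2 + m₂ ^ 2 + m₃ ^ 2) := by
  have := h.isProbabilityMeasure
  have hL : ∀ i, MemLp (Z i) 2 P := fun i => (h.gauss i).memLp_two
  let U : Ω → ℝ := fun ω => Z j ω - p * Z i ω
  let V : Ω → ℝ := fun ω => Z k ω - q * Z i ω
  have hU2 : MemLp U 2 P := (hL j).sub ((hL i).const_mul _)
  have hV2 : MemLp V 2 P := (hL k).sub ((hL i).const_mul _)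
  have hji : noiseCorr j i = p := by rw [← hp, ← h.cov_eq, ← h.cov_eq, covariance_comm]
  have hki : noiseCorr k i = q := by rw [← hq, ← h.cov_eq, ← h.cov_eq, covariance_comm]
  have hkj : noiseCorr k j = s := by rw [← hs, ← h.cov_eq, ← h.cov_eq, covariance_comm]
  have h11 : ∀ i, noiseCorr i i = 1 := fun i => by
    rw [← h.cov_eq, covariance_self (h.gauss i).aemeasurable, h.variance_eq]
  have cU : ∀ l, cov[Z l, U; P] = noiseCorr l j - p * noiseCorr l i := fun l => by
    simp only [U]
    rw [covariance_fun_sub_right (hL l) (hL j) ((hL i).const_mul _), covariance_const_mul_right,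
      h.cov_eq, h.cov_eq]
  have cV : ∀ l, cov[Z l, V; P] = noiseCorr l k - q * noiseCorr l i := fun l => by
    simp only [V]
    rw [covariance_fun_sub_right (hL l) (hL k) ((hL i).const_mul _), covariance_const_mul_right,
      h.cov_eq, h.cov_eq]
  have hUU : cov[U, U; P] = 1 - p ^ 2 := by
    nth_rw 1 [show U = fun ω => Z j ω - p * Z i ω from rfl]
    rw [covariance_fun_sub_left (hL j) ((hL i).const_mul _) hU2, covariance_const_mul_left, cU, cU,
      h11, h11, hji, hp]
    ring
  have hVV : cov[V, V; P] = 1 - q ^ 2 := by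
    nth_rw 1 [show V = fun ω => Z k ω - q * Z i ω from rfl]
    rw [covariance_fun_sub_left (hL k) ((hL i).const_mul _) hV2, covariance_const_mul_left, cV, cV,
      h11, h11, hki, hq]
    ring
  have hUV : cov[U, V; P] = s - p * q := by
    nth_rw 1 [show U = fun ω => Z j ω - p * Z i ω from rfl]
    rw [covariance_fun_sub_left (hL j) ((hL i).const_mul _) hV2, covariance_const_mul_left, cV, cV,
      h11, hs, hji, hq]
    ring
  have hUV' : HasGaussianLaw (fun ω => (U ω, V ω)) P := by
    have := h.hasGaussianLaw.map_fun
      ((ContinuousLinearMap.proj (R := ℝ) (φ := fun _ : Fin 3 => ℝ) j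
        - p • ContinuousLinearMap.proj (R := ℝ) (φ := fun _ : Fin 3 => ℝ) i).prod
      (ContinuousLinearMap.proj (R := ℝ) (φ := fun _ : Fin 3 => ℝ) k
        - q • ContinuousLinearMap.proj (R := ℝ) (φ := fun _ : Fin 3 => ℝ) i))
    simpa [U, V] using this
  have hall : HasGaussianLaw (fun ω => ((fun _ : Fin 1 => Z i ω), (fun l : Fin 2 => ![U, V] l ω))) P := by
    have := h.hasGaussianLaw.map_fun
      ((ContinuousLinearMap.pi fun _ : Fin 1 =>
        ContinuousLinearMap.proj (R := ℝ) (φ := fun _ : Fin 3 => ℝ) i).prod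
      (ContinuousLinearMap.pi fun l : Fin 2 => ![ContinuousLinearMap.proj (R := ℝ) (φ := fun _ : Fin 3 => ℝ) j
        - p • ContinuousLinearMap.proj (R := ℝ) (φ := fun _ : Fin 3 => ℝ) i,
        ContinuousLinearMap.proj (R := ℝ) (φ := fun _ : Fin 3 => ℝ) k
        - q • ContinuousLinearMap.proj (R := ℝ) (φ := fun _ : Fin 3 => ℝ) i] l))
    refine this.congr (Eventually.of_forall fun ω => Prod.ext rfl (funext fun l => ?_))
    fin_cases l <;> simp [U, V]
  have hind : IndepFun (Z i) (fun ω => (U ω, V ω)) P := by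
    have h1 := HasGaussianLaw.indepFun_of_covariance_eval (X := fun _ : Fin 1 => Z i) (Y := ![U, V])
      hall (by
        intro _ l
        fin_cases l
        · simp only [Fin.zero_eta, Matrix.cons_val_zero]
          rw [cU, h11, hp]; ring
        · change cov[Z i, V; P] = 0
          rw [cV, h11, hq]; ring)
    exact h1.comp (φ := fun x : Fin 1 → ℝ => x 0) (ψ := fun y : Fin 2 → ℝ => (y 0, y 1))
      (by fun_prop) (by fun_prop)
  have eU : P[U] = 0 := by
    simp only [U]
    rw [integral_sub (h.gauss j).integrable ((h.gauss i).integrable.const_mul _), integral_const_mul,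
      h.integral_eq, h.integral_eq]
    ring
  have eV : P[V] = 0 := by
    simp only [V]
    rw [integral_sub (h.gauss k).integrable ((h.gauss i).integrable.const_mul _), integral_const_mul,
      h.integral_eq, h.integral_eq]
    ring
  have vU : Var[U; P] = 1 - p ^ 2 := by rw [← covariance_self hU2.aemeasurable, hUU]
  have vV : Var[V; P] = 1 - q ^ 2 := by rw [← covariance_self hV2.aemeasurable, hVV]
  have key := OneBitAWGN.abs_integral_sgn_shift_sub_le (h.hasLaw i) hU2.aemeasurable hV2.aemeasurable
    hind (fun a ha => measureReal_abs_le hUV'.fst eU (by rw [vU]; linarith) ha)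
    (fun a ha => measureReal_abs_le hUV'.snd eV (by rw [vV]; linarith) ha)
    (c := p) (d := q) (abs_le.2 (by constructor <;> nlinarith)) (abs_le.2 (by constructor <;> nlinarith))
    m₁ m₂ m₃
  rw [OneBitAWGN.integral_sgn_mul_sgn hUV' eU eV (by linarith) hs1 vU vV hUV] at key
  have e1 : ∀ ω, U ω + p * Z i ω = Z j ω := fun ω => by simp only [U]; ring
  have e2 : ∀ ω, V ω + q * Z i ω = Z k ω := fun ω => by simp only [V]; ring
  simpa only [e1, e2] using key

end IsNoiseTriple

/-! ### Statistics of three signs -/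

/-- The general statistic of three signs `x, y, z` that is odd and invariant under time reversal. -/
def signPoly (α β γ x y z : ℝ) : ℝ := α * (x + z) + β * y + γ * (x * (y * z))

/-- Correlation of the signs of samples `1` and `2` when sample `0` vanishes. -/
def kappaSide : ℝ := 2 / Real.pi * Real.arcsin (rho / √(1 - rho ^ 2))

/-- Minus the correlation of the signs of samples `0` and `2` when sample `1` vanishes. -/
def kappaMid : ℝ := 2 / Real.pi * Real.arcsin (rho ^ 2 / (1 - rho ^ 2))

/-- The second moment of `signPoly` under the noise law. -/
def signPolyMoment (α β γ : ℝ) : ℝ :=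
  2 * α ^ 2 + β ^ 2 + γ ^ 2 + 2 / Real.pi * Real.arcsin rho * (4 * α * β + 4 * α * γ)

theorem abs_signPoly_sgn_le (α β γ x y z : ℝ) :
    |signPoly α β γ (sgn x) (sgn y) (sgn z)| ≤ 2 * (|α| + |β| + |γ|) := by
  have h1 := le_abs_self α
  have h2 := neg_abs_le α
  have h3 := le_abs_self β
  have h4 := neg_abs_le β
  have h5 := le_abs_self γ
  have h6 := neg_abs_le γ
  rw [abs_le, signPoly]
  rcases sgn_eq_or x with hx | hx <;> rcases sgn_eq_or y with hy | hy <;>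
    rcases sgn_eq_or z with hz | hz <;> rw [hx, hy, hz] <;> constructor <;> linarith

theorem signPoly_sgn_sq (α β γ x y z : ℝ) : signPoly α β γ (sgn x) (sgn y) (sgn z) ^ 2
    = 2 * α ^ 2 + β ^ 2 + γ ^ 2 + (2 * α * β + 2 * α * γ) * (sgn x * sgn y)
      + (2 * α * β + 2 * α * γ) * (sgn y * sgn z) + (2 * α ^ 2 + 2 * β * γ) * (sgn x * sgn z) := by
  rw [signPoly]
  rcases sgn_eq_or x with hx | hx <;> rcases sgn_eq_or y with hy | hy <;>
    rcases sgn_eq_or z with hz | hz <;> rw [hx, hy, hz] <;> ring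

namespace IsNoiseTriple

variable {Ω : Type*} {mΩ : MeasurableSpace Ω} {P : Measure Ω} {Z : Fin 3 → Ω → ℝ}

theorem aestronglyMeasurable_sgn (h : IsNoiseTriple Z P) (i : Fin 3) (m : ℝ) :
    AEStronglyMeasurable (fun ω => sgn (Z i ω + m)) P :=
  (measurable_sgn.comp_aemeasurable ((h.gauss i).aemeasurable.add_const m)).aestronglyMeasurable

theorem abs_integral_sgn_sub_le (h : IsNoiseTriple Z P) (i : Fin 3) (m : ℝ) :
    |∫ ω, sgn (Z i ω + m) ∂P - ∫ ω, sgn (Z i ω) ∂P - 2 / √(2 * Real.pi) * m| ≤ 2 * m ^ 2 := by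
  have := h.isProbabilityMeasure
  have i1 : Integrable (fun ω => sgn (Z i ω + m)) P :=
    integrable_of_abs_le (h.aestronglyMeasurable_sgn i m) (C := 1) fun ω => (abs_sgn _).le
  have i0 : Integrable (fun ω => sgn (Z i ω)) P := by
    simpa using integrable_of_abs_le (h.aestronglyMeasurable_sgn i 0) (C := 1) fun ω => (abs_sgn _).le
  have hf : Measurable fun z : ℝ => sgn (z + m) - sgn z :=
    (measurable_sgn.comp (by fun_prop)).sub measurable_sgn
  rw [← integral_sub i1 i0]
  have e : ∫ ω, (sgn (Z i ω + m) - sgn (Z i ω)) ∂P = ∫ z, (sgn (z + m) - sgn z) ∂gaussianReal 0 1 :=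
    (h.hasLaw i).integral_comp hf.aestronglyMeasurable
  rw [e]
  exact abs_integral_sgn_add_sub_sgn_le m

theorem integral_abs_sgn_sub_le (h : IsNoiseTriple Z P) (i : Fin 3) (m : ℝ) :
    ∫ ω, |sgn (Z i ω + m) - sgn (Z i ω)| ∂P ≤ 4 * |m| := by
  have := h.isProbabilityMeasure
  have hn : NullMeasurableSet {ω | Z i ω ∈ Set.Icc (-|m|) |m|} P :=
    (h.gauss i).aemeasurable.nullMeasurable measurableSet_Icc
  have i1 : Integrable ({ω | Z i ω ∈ Set.Icc (-|m|) |m|}.indicator (1 : Ω → ℝ)) P :=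
    (integrable_const (1 : ℝ)).indicator₀ hn
  calc ∫ ω, |sgn (Z i ω + m) - sgn (Z i ω)| ∂P
      ≤ ∫ ω, 2 * {ω | Z i ω ∈ Set.Icc (-|m|) |m|}.indicator (1 : Ω → ℝ) ω ∂P :=
        integral_mono_of_nonneg (Eventually.of_forall fun ω => abs_nonneg _) (i1.const_mul 2)
          (Eventually.of_forall fun ω => abs_sgn_add_sub_sgn_le (Z i ω) m)
    _ = 2 * P.real {ω | Z i ω ∈ Set.Icc (-|m|) |m|} := by
        rw [integral_const_mul, integral_indicator₀ hn]; simp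
    _ ≤ 2 * (2 * |m|) := by
        have := measureReal_abs_le (h.gauss i) (h.integral_eq i) (by rw [h.variance_eq]; norm_num)
          (abs_nonneg m)
        linarith
    _ = _ := by ring

theorem integrable_sgn_mul_sgn (h : IsNoiseTriple Z P) (i j : Fin 3) (m m' : ℝ) :
    Integrable (fun ω => sgn (Z i ω + m) * sgn (Z j ω + m')) P := by
  have := h.isProbabilityMeasure
  refine integrable_of_abs_le ((h.aestronglyMeasurable_sgn i m).mul (h.aestronglyMeasurable_sgn j m'))
    (C := 1) fun ω => ?_
  rw [abs_mul, abs_sgn, abs_sgn, one_mul]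

theorem abs_integral_sgn_mul_sgn_sub_le (h : IsNoiseTriple Z P) (i j : Fin 3) (m m' : ℝ) :
    |∫ ω, sgn (Z i ω + m) * sgn (Z j ω + m') ∂P - ∫ ω, sgn (Z i ω) * sgn (Z j ω) ∂P|
      ≤ 4 * |m| + 4 * |m'| := by
  have := h.isProbabilityMeasure
  have i1 := h.integrable_sgn_mul_sgn i j m m'
  have i0 : Integrable (fun ω => sgn (Z i ω) * sgn (Z j ω)) P := by
    simpa using h.integrable_sgn_mul_sgn i j 0 0
  have iA : ∀ i m, Integrable (fun ω => |sgn (Z i ω + m) - sgn (Z i ω)|) P := fun i m => by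
    have h0 : AEStronglyMeasurable (fun ω => sgn (Z i ω)) P := by
      simpa using h.aestronglyMeasurable_sgn i 0
    refine (integrable_of_abs_le ((h.aestronglyMeasurable_sgn i m).sub h0) (C := 2) fun ω => ?_).abs
    refine (abs_sub _ _).trans ?_
    rw [abs_sgn, abs_sgn]; norm_num
  rw [← integral_sub i1 i0, ← Real.norm_eq_abs]
  calc _ ≤ ∫ ω, (|sgn (Z i ω + m) - sgn (Z i ω)| + |sgn (Z j ω + m') - sgn (Z j ω)|) ∂P :=
        norm_integral_le_of_norm_le ((iA i m).add (iA j m')) (Eventually.of_forall fun ω =>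
          abs_sgn_mul_sub_sgn_mul_le _ _ _ _)
    _ ≤ _ := by
        rw [integral_add (iA i m) (iA j m')]
        exact add_le_add (h.integral_abs_sgn_sub_le i m) (h.integral_abs_sgn_sub_le j m')

theorem integrable_sgn_mul_sgn_mul_sgn (h : IsNoiseTriple Z P) (i j k : Fin 3) (m₁ m₂ m₃ : ℝ) :
    Integrable (fun ω => sgn (Z i ω + m₁) * (sgn (Z j ω + m₂) * sgn (Z k ω + m₃))) P := by
  have := h.isProbabilityMeasure
  refine integrable_of_abs_le ((h.aestronglyMeasurable_sgn i m₁).mul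
    ((h.aestronglyMeasurable_sgn j m₂).mul (h.aestronglyMeasurable_sgn k m₃))) (C := 1) fun ω => ?_
  rw [abs_mul, abs_mul, abs_sgn, abs_sgn, abs_sgn, one_mul, one_mul]

/-- Mean response of the product of three signs to a shift: one sample is shifted at a time. -/
theorem abs_integral_sgn_triple_sub_le (h : IsNoiseTriple Z P) (m₀ m₁ m₂ : ℝ) :
    |∫ ω, sgn (Z 0 ω + m₀) * (sgn (Z 1 ω + m₁) * sgn (Z 2 ω + m₂)) ∂P
      - ∫ ω, sgn (Z 0 ω) * (sgn (Z 1 ω) * sgn (Z 2 ω)) ∂P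
      - 2 / √(2 * Real.pi) * (kappaSide * (m₀ + m₂) - kappaMid * m₁)|
      ≤ 180 * (m₀ ^ 2 + m₁ ^ 2 + m₂ ^ 2) := by
  have := h.isProbabilityMeasure
  have hρ := rho_sq_le
  have hρ0 := sq_nonneg rho
  have h0 := h.abs_integral_sgn_shift_sub_le (i := 0) (j := 1) (k := 2) (p := rho) (q := 0) (s := rho)
    (by simp [noiseCorr]) (by simp [noiseCorr]) (by simp [noiseCorr]) (by linarith) (by norm_num)
    (by nlinarith) m₀ m₁ m₂
  have h1 := h.abs_integral_sgn_shift_sub_le (i := 1) (j := 0) (k := 2) (p := rho) (q := rho) (s := 0)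
    (by simp [noiseCorr]) (by simp [noiseCorr]) (by simp [noiseCorr]) (by linarith) (by linarith)
    (by nlinarith) m₁ 0 m₂
  have h2 := h.abs_integral_sgn_shift_sub_le (i := 2) (j := 0) (k := 1) (p := 0) (q := rho) (s := rho)
    (by simp [noiseCorr]) (by simp [noiseCorr]) (by simp [noiseCorr]) (by norm_num) (by linarith)
    (by nlinarith) m₂ 0 0
  have eS : (2 / Real.pi * Real.arcsin ((rho - rho * 0) / √((1 - rho ^ 2) * (1 - 0 ^ 2)))) = kappaSide := by
    simp [kappaSide]
  have eS' : (2 / Real.pi * Real.arcsin ((rho - 0 * rho) / √((1 - 0 ^ 2) * (1 - rho ^ 2)))) = kappaSide := by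
    simp [kappaSide]
  have eM : (2 / Real.pi * Real.arcsin ((0 - rho * rho) / √((1 - rho ^ 2) * (1 - rho ^ 2))))
      = -kappaMid := by
    rw [Real.sqrt_mul_self (by linarith), kappaMid, ← mul_neg, ← Real.arcsin_neg]
    congr 2
    ring
  rw [eS] at h0
  rw [eM] at h1
  rw [eS'] at h2
  simp only [add_zero] at h1 h2
  have t0 := h.integrable_sgn_mul_sgn_mul_sgn 0 1 2 m₀ m₁ m₂
  have t1 : Integrable (fun ω => sgn (Z 0 ω) * (sgn (Z 1 ω + m₁) * sgn (Z 2 ω + m₂))) P := by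
    simpa using h.integrable_sgn_mul_sgn_mul_sgn 0 1 2 0 m₁ m₂
  have t2 : Integrable (fun ω => sgn (Z 0 ω) * (sgn (Z 1 ω) * sgn (Z 2 ω + m₂))) P := by
    simpa using h.integrable_sgn_mul_sgn_mul_sgn 0 1 2 0 0 m₂
  have t3 : Integrable (fun ω => sgn (Z 0 ω) * (sgn (Z 1 ω) * sgn (Z 2 ω))) P := by
    simpa using h.integrable_sgn_mul_sgn_mul_sgn 0 1 2 0 0 0
  have e0 : ∫ ω, (sgn (Z 0 ω + m₀) - sgn (Z 0 ω)) * (sgn (Z 1 ω + m₁) * sgn (Z 2 ω + m₂)) ∂P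
      = ∫ ω, sgn (Z 0 ω + m₀) * (sgn (Z 1 ω + m₁) * sgn (Z 2 ω + m₂)) ∂P
        - ∫ ω, sgn (Z 0 ω) * (sgn (Z 1 ω + m₁) * sgn (Z 2 ω + m₂)) ∂P := by
    rw [← integral_sub t0 t1]
    exact integral_congr_ae (Eventually.of_forall fun ω => by simp only; ring)
  have e1 : ∫ ω, (sgn (Z 1 ω + m₁) - sgn (Z 1 ω)) * (sgn (Z 0 ω) * sgn (Z 2 ω + m₂)) ∂P
      = ∫ ω, sgn (Z 0 ω) * (sgn (Z 1 ω + m₁) * sgn (Z 2 ω + m₂)) ∂P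
        - ∫ ω, sgn (Z 0 ω) * (sgn (Z 1 ω) * sgn (Z 2 ω + m₂)) ∂P := by
    rw [← integral_sub t1 t2]
    exact integral_congr_ae (Eventually.of_forall fun ω => by simp only; ring)
  have e2 : ∫ ω, (sgn (Z 2 ω + m₂) - sgn (Z 2 ω)) * (sgn (Z 0 ω) * sgn (Z 1 ω)) ∂P
      = ∫ ω, sgn (Z 0 ω) * (sgn (Z 1 ω) * sgn (Z 2 ω + m₂)) ∂P
        - ∫ ω, sgn (Z 0 ω) * (sgn (Z 1 ω) * sgn (Z 2 ω)) ∂P := by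
    rw [← integral_sub t2 t3]
    exact integral_congr_ae (Eventually.of_forall fun ω => by simp only; ring)
  rw [e0] at h0
  rw [e1] at h1
  rw [e2] at h2
  rw [abs_le] at h0 h1 h2 ⊢
  have := sq_nonneg m₀
  have := sq_nonneg m₁
  have := sq_nonneg m₂
  constructor <;> linarith

/-- Mean response of `signPoly` to a shift of the three samples. -/
theorem abs_integral_signPoly_sub_le (h : IsNoiseTriple Z P) (α β γ m₀ m₁ m₂ : ℝ) :
    |∫ ω, signPoly α β γ (sgn (Z 0 ω + m₀)) (sgn (Z 1 ω + m₁)) (sgn (Z 2 ω + m₂)) ∂P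
      - ∫ ω, signPoly α β γ (sgn (Z 0 ω)) (sgn (Z 1 ω)) (sgn (Z 2 ω)) ∂P
      - 2 / √(2 * Real.pi) * ((α + γ * kappaSide) * (m₀ + m₂) + (β - γ * kappaMid) * m₁)|
      ≤ 180 * (|α| + |β| + |γ|) * (m₀ ^ 2 + m₁ ^ 2 + m₂ ^ 2) := by
  have := h.isProbabilityMeasure
  have i1 : ∀ i m, Integrable (fun ω => sgn (Z i ω + m)) P := fun i m =>
    integrable_of_abs_le (h.aestronglyMeasurable_sgn i m) (C := 1) fun ω => (abs_sgn _).le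
  have e : ∀ m₀ m₁ m₂ : ℝ, ∫ ω, signPoly α β γ (sgn (Z 0 ω + m₀)) (sgn (Z 1 ω + m₁)) (sgn (Z 2 ω + m₂)) ∂P
      = α * (∫ ω, sgn (Z 0 ω + m₀) ∂P + ∫ ω, sgn (Z 2 ω + m₂) ∂P) + β * ∫ ω, sgn (Z 1 ω + m₁) ∂P
        + γ * ∫ ω, sgn (Z 0 ω + m₀) * (sgn (Z 1 ω + m₁) * sgn (Z 2 ω + m₂)) ∂P := fun m₀ m₁ m₂ => by
    have j1 : Integrable (fun ω => α * (sgn (Z 0 ω + m₀) + sgn (Z 2 ω + m₂))) P :=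
      ((i1 0 m₀).add (i1 2 m₂)).const_mul α
    have j2 : Integrable (fun ω => β * sgn (Z 1 ω + m₁)) P := (i1 1 m₁).const_mul β
    have j12 : Integrable (fun ω => α * (sgn (Z 0 ω + m₀) + sgn (Z 2 ω + m₂)) + β * sgn (Z 1 ω + m₁)) P :=
      j1.add j2
    simp only [signPoly]
    rw [integral_add j12 ((h.integrable_sgn_mul_sgn_mul_sgn 0 1 2 m₀ m₁ m₂).const_mul γ),
      integral_add j1 j2, integral_const_mul, integral_const_mul, integral_const_mul,
      integral_add (i1 0 m₀) (i1 2 m₂)]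
  have e0 := e 0 0 0
  simp only [add_zero] at e0
  rw [e, e0]
  have h0 := h.abs_integral_sgn_sub_le 0 m₀
  have h1 := h.abs_integral_sgn_sub_le 1 m₁
  have h2 := h.abs_integral_sgn_sub_le 2 m₂
  have h3 := h.abs_integral_sgn_triple_sub_le m₀ m₁ m₂
  set A0 := ∫ ω, sgn (Z 0 ω + m₀) ∂P - ∫ ω, sgn (Z 0 ω) ∂P - 2 / √(2 * Real.pi) * m₀ with hA0
  set A1 := ∫ ω, sgn (Z 1 ω + m₁) ∂P - ∫ ω, sgn (Z 1 ω) ∂P - 2 / √(2 * Real.pi) * m₁ with hA1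
  set A2 := ∫ ω, sgn (Z 2 ω + m₂) ∂P - ∫ ω, sgn (Z 2 ω) ∂P - 2 / √(2 * Real.pi) * m₂ with hA2
  set A3 := ∫ ω, sgn (Z 0 ω + m₀) * (sgn (Z 1 ω + m₁) * sgn (Z 2 ω + m₂)) ∂P
      - ∫ ω, sgn (Z 0 ω) * (sgn (Z 1 ω) * sgn (Z 2 ω)) ∂P
      - 2 / √(2 * Real.pi) * (kappaSide * (m₀ + m₂) - kappaMid * m₁) with hA3
  have e' : α * (∫ ω, sgn (Z 0 ω + m₀) ∂P + ∫ ω, sgn (Z 2 ω + m₂) ∂P) + β * ∫ ω, sgn (Z 1 ω + m₁) ∂P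
        + γ * ∫ ω, sgn (Z 0 ω + m₀) * (sgn (Z 1 ω + m₁) * sgn (Z 2 ω + m₂)) ∂P
      - (α * (∫ ω, sgn (Z 0 ω) ∂P + ∫ ω, sgn (Z 2 ω) ∂P) + β * ∫ ω, sgn (Z 1 ω) ∂P
        + γ * ∫ ω, sgn (Z 0 ω) * (sgn (Z 1 ω) * sgn (Z 2 ω)) ∂P)
      - 2 / √(2 * Real.pi) * ((α + γ * kappaSide) * (m₀ + m₂) + (β - γ * kappaMid) * m₁)
      = α * A0 + α * A2 + β * A1 + γ * A3 := by
    rw [hA0, hA1, hA2, hA3]; ring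
  rw [e']
  have q0 := sq_nonneg m₀
  have q1 := sq_nonneg m₁
  have q2 := sq_nonneg m₂
  set S := m₀ ^ 2 + m₁ ^ 2 + m₂ ^ 2 with hS
  have hA02 : |A0| + |A2| ≤ 180 * S := by linarith
  have hA1' : |A1| ≤ 180 * S := by linarith
  calc |α * A0 + α * A2 + β * A1 + γ * A3|
      ≤ |α * A0| + |α * A2| + |β * A1| + |γ * A3| := by
        refine (abs_add_le _ _).trans (add_le_add_left ((abs_add_le _ _).trans
          (add_le_add_left (abs_add_le _ _) _)) _)
    _ = |α| * (|A0| + |A2|) + |β| * |A1| + |γ| * |A3| := by simp only [abs_mul]; ring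
    _ ≤ |α| * (180 * S) + |β| * (180 * S) + |γ| * (180 * S) := by gcongr
    _ = _ := by ring

theorem abs_integral_signPoly_sq_sub_le (h : IsNoiseTriple Z P) (α β γ m₀ m₁ m₂ : ℝ) :
    |∫ ω, signPoly α β γ (sgn (Z 0 ω + m₀)) (sgn (Z 1 ω + m₁)) (sgn (Z 2 ω + m₂)) ^ 2 ∂P
      - signPolyMoment α β γ|
      ≤ 16 * (|α| + |β| + |γ|) ^ 2 * (|m₀| + |m₁| + |m₂|) := by
  have := h.isProbabilityMeasure
  simp_rw [signPoly_sgn_sq]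
  have hρ := rho_sq_le
  have s01 := h.integral_sgn_mul_sgn (i := 0) (j := 1) (by change rho ^ 2 < 1; linarith)
  have s12 := h.integral_sgn_mul_sgn (i := 1) (j := 2) (by change rho ^ 2 < 1; linarith)
  have s02 := h.integral_sgn_mul_sgn (i := 0) (j := 2) (by simp [noiseCorr])
  simp only [noiseCorr, Matrix.of_apply, Matrix.cons_val', Matrix.cons_val_zero, Matrix.cons_val_one,
    Matrix.cons_val, Real.arcsin_zero, mul_zero] at s01 s12 s02
  have d01 := h.abs_integral_sgn_mul_sgn_sub_le 0 1 m₀ m₁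
  have d12 := h.abs_integral_sgn_mul_sgn_sub_le 1 2 m₁ m₂
  have d02 := h.abs_integral_sgn_mul_sgn_sub_le 0 2 m₀ m₂
  rw [s01] at d01
  rw [s12] at d12
  rw [s02] at d02
  have i01 := h.integrable_sgn_mul_sgn 0 1 m₀ m₁
  have i12 := h.integrable_sgn_mul_sgn 1 2 m₁ m₂
  have i02 := h.integrable_sgn_mul_sgn 0 2 m₀ m₂
  have j1 : Integrable (fun ω => 2 * α ^ 2 + β ^ 2 + γ ^ 2
      + (2 * α * β + 2 * α * γ) * (sgn (Z 0 ω + m₀) * sgn (Z 1 ω + m₁))) P :=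
    (integrable_const _).add (i01.const_mul _)
  have j2 : Integrable (fun ω => 2 * α ^ 2 + β ^ 2 + γ ^ 2
      + (2 * α * β + 2 * α * γ) * (sgn (Z 0 ω + m₀) * sgn (Z 1 ω + m₁))
      + (2 * α * β + 2 * α * γ) * (sgn (Z 1 ω + m₁) * sgn (Z 2 ω + m₂))) P :=
    j1.add (i12.const_mul _)
  rw [integral_add j2 (i02.const_mul _), integral_add j1 (i12.const_mul _),
    integral_add (integrable_const _) (i01.const_mul _), integral_const_mul, integral_const_mul,
    integral_const_mul, integral_const]
  simp only [probReal_univ, one_smul]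
  set a := 2 / Real.pi * Real.arcsin rho with ha
  set I01 := ∫ ω, sgn (Z 0 ω + m₀) * sgn (Z 1 ω + m₁) ∂P
  set I12 := ∫ ω, sgn (Z 1 ω + m₁) * sgn (Z 2 ω + m₂) ∂P
  set I02 := ∫ ω, sgn (Z 0 ω + m₀) * sgn (Z 2 ω + m₂) ∂P
  have e : 2 * α ^ 2 + β ^ 2 + γ ^ 2 + (2 * α * β + 2 * α * γ) * I01 + (2 * α * β + 2 * α * γ) * I12
      + (2 * α ^ 2 + 2 * β * γ) * I02 - signPolyMoment α β γ
      = 2 * (α * β + α * γ) * ((I01 - a) + (I12 - a)) + 2 * (α ^ 2 + β * γ) * (I02 - 0) := by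
    rw [signPolyMoment]; ring
  rw [e]
  set M := |m₀| + |m₁| + |m₂| with hM
  have p0 := abs_nonneg m₀
  have p1 := abs_nonneg m₁
  have p2 := abs_nonneg m₂
  have q0 := abs_nonneg α
  have q1 := abs_nonneg β
  have q2 := abs_nonneg γ
  have c1 : |α * β + α * γ| ≤ |α| * |β| + |α| * |γ| := by
    refine (abs_add_le _ _).trans ?_; rw [abs_mul, abs_mul]
  have c2 : |α ^ 2 + β * γ| ≤ |α| ^ 2 + |β| * |γ| := by
    refine (abs_add_le _ _).trans ?_; rw [abs_mul, abs_pow]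
  have c3 : |(I01 - a) + (I12 - a)| ≤ 8 * M := (abs_add_le _ _).trans (by linarith)
  have c4 : |I02 - 0| ≤ 8 * M := by linarith
  calc _ ≤ |2 * (α * β + α * γ) * ((I01 - a) + (I12 - a))| + |2 * (α ^ 2 + β * γ) * (I02 - 0)| :=
        abs_add_le _ _
    _ = 2 * |α * β + α * γ| * |(I01 - a) + (I12 - a)| + 2 * |α ^ 2 + β * γ| * |I02 - 0| := by
        simp only [abs_mul, abs_two]
    _ ≤ 2 * (|α| * |β| + |α| * |γ|) * (8 * M) + 2 * (|α| ^ 2 + |β| * |γ|) * (8 * M) := by gcongr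
    _ = 16 * (|α| * |β| + |α| * |γ| + |α| ^ 2 + |β| * |γ|) * M := by ring
    _ ≤ 16 * (|α| + |β| + |γ|) ^ 2 * M := by
        have hM0 : 0 ≤ M := by positivity
        refine mul_le_mul_of_nonneg_right ?_ hM0
        nlinarith [mul_nonneg q0 q1, mul_nonneg q0 q2, mul_nonneg q1 q2, sq_nonneg |β|, sq_nonneg |γ|]

end IsNoiseTriple

/-! ### The optimal statistic and its value -/

theorem abs_sin_sub_taylor_le {x : ℝ} (h0 : 0 ≤ x) (h1 : x ≤ 1) :
    |Real.sin x - (x - x ^ 3 / 6 + x ^ 5 / 120 - x ^ 7 / 5040 + x ^ 9 / 362880 - x ^ 11 / 39916800)|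
      ≤ 1 / 400000000 := by
  have hb := Complex.exp_bound (x := (x : ℂ) * Complex.I) (by simp [abs_of_nonneg h0, h1])
    (n := 12) (by norm_num)
  have him : (Complex.exp (x * Complex.I)
      - ∑ m ∈ Finset.range 12, (x * Complex.I : ℂ) ^ m / (m.factorial : ℂ)).im
      = Real.sin x - (x - x ^ 3 / 6 + x ^ 5 / 120 - x ^ 7 / 5040 + x ^ 9 / 362880
        - x ^ 11 / 39916800) := by
    have hI : ∀ k : ℕ, Complex.I ^ (k + 2) = -Complex.I ^ k := fun k => by
      rw [pow_add, Complex.I_sq]; ring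
    have e : ∑ m ∈ Finset.range 12, (x * Complex.I : ℂ) ^ m / (m.factorial : ℂ)
        = ((1 - x ^ 2 / 2 + x ^ 4 / 24 - x ^ 6 / 720 + x ^ 8 / 40320 - x ^ 10 / 3628800 : ℝ) : ℂ)
          + ((x - x ^ 3 / 6 + x ^ 5 / 120 - x ^ 7 / 5040 + x ^ 9 / 362880
            - x ^ 11 / 39916800 : ℝ) : ℂ) * Complex.I := by
      simp only [Finset.sum_range_succ, Finset.sum_range_zero, mul_pow, hI, pow_zero, pow_one,
        Nat.factorial]
      push_cast
      ring
    rw [e, Complex.sub_im, Complex.exp_ofReal_mul_I_im, Complex.add_im, Complex.ofReal_im, zero_add,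
      Complex.im_ofReal_mul, Complex.I_im, mul_one]
  rw [← him]
  refine (Complex.abs_im_le_norm _).trans (hb.trans ?_)
  have hn : ‖(x : ℂ) * Complex.I‖ = x := by simp [abs_of_nonneg h0]
  rw [hn]
  have hx : x ^ 12 ≤ 1 := pow_le_one₀ h0 h1
  calc x ^ 12 * _ ≤ 1 * _ := mul_le_mul_of_nonneg_right hx (by positivity)
    _ ≤ _ := by norm_num [Nat.factorial]

theorem mul_bounds {x y a b c d : ℝ} (hx : a ≤ x ∧ x ≤ b) (hy : c ≤ y ∧ y ≤ d) (ha : 0 ≤ a)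
    (hc : 0 ≤ c) : a * c ≤ x * y ∧ x * y ≤ b * d :=
  ⟨mul_le_mul hx.1 hy.1 hc (ha.trans hx.1),
    mul_le_mul hx.2 hy.2 (hc.trans hy.1) (ha.trans (hx.1.trans hx.2))⟩

theorem sq_bounds {x a b : ℝ} (hx : a ≤ x ∧ x ≤ b) (ha : 0 ≤ a) : a ^ 2 ≤ x ^ 2 ∧ x ^ 2 ≤ b ^ 2 :=
  ⟨pow_le_pow_left₀ ha hx.1 2, pow_le_pow_left₀ (ha.trans hx.1) hx.2 2⟩

theorem div_bounds {x y a b c d : ℝ} (hx : a ≤ x ∧ x ≤ b) (hy : c ≤ y ∧ y ≤ d) (ha : 0 ≤ a)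
    (hc : 0 < c) : a / d ≤ x / y ∧ x / y ≤ b / c :=
  ⟨div_le_div₀ (ha.trans hx.1) hx.1 (hc.trans_le hy.1) hy.2,
    div_le_div₀ (ha.trans (hx.1.trans hx.2)) hx.2 hc hy.1⟩

theorem sqrt_bounds {x a b : ℝ} (ha : a ^ 2 ≤ x) (hb : x ≤ b ^ 2) (hb0 : 0 ≤ b) :
    a ≤ √x ∧ √x ≤ b :=
  ⟨Real.le_sqrt_of_sq_le ha, (Real.sqrt_le_left hb0).2 hb⟩

/-- Bounds for `arcsin` from bounds for the Taylor polynomial of `sin`. -/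
theorem arcsin_bounds {y a b : ℝ} (ha0 : 0 ≤ a) (ha1 : a ≤ 1) (hb0 : 0 ≤ b) (hb1 : b ≤ 1)
    (ha : a - a ^ 3 / 6 + a ^ 5 / 120 - a ^ 7 / 5040 + a ^ 9 / 362880 - a ^ 11 / 39916800
      + 1 / 400000000 ≤ y)
    (hb : y ≤ b - b ^ 3 / 6 + b ^ 5 / 120 - b ^ 7 / 5040 + b ^ 9 / 362880 - b ^ 11 / 39916800
      - 1 / 400000000) : a ≤ Real.arcsin y ∧ Real.arcsin y ≤ b := by
  have h1 := abs_le.1 (abs_sin_sub_taylor_le ha0 ha1)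
  have h2 := abs_le.1 (abs_sin_sub_taylor_le hb0 hb1)
  have hp := Real.pi_gt_three
  have e1 : Real.arcsin (Real.sin a) = a := Real.arcsin_sin (by linarith) (by linarith)
  have e2 : Real.arcsin (Real.sin b) = b := Real.arcsin_sin (by linarith) (by linarith)
  constructor
  · exact e1.symm.le.trans (Real.monotone_arcsin (by linarith))
  · exact (Real.monotone_arcsin (by linarith)).trans e2.le

theorem rho_bounds : 0.636619772 ≤ rho ∧ rho ≤ 0.636619773 := by
  have h1 := Real.pi_gt_d20
  have h2 := Real.pi_lt_d20
  have := div_bounds (x := 2) (y := Real.pi) (a := 2) (b := 2) ⟨le_rfl, le_rfl⟩ ⟨h1.le, h2.le⟩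
    (by norm_num) (by norm_num)
  exact ⟨le_trans (by norm_num) this.1, this.2.trans (by norm_num)⟩

theorem arcsin_rho_bounds : 0.69010706 ≤ Real.arcsin rho ∧ Real.arcsin rho ≤ 0.69010713 := by
  have h := rho_bounds
  exact arcsin_bounds (by norm_num) (by norm_num) (by norm_num) (by norm_num)
    (le_trans (by norm_num) h.1) (h.2.trans (by norm_num))

theorem rho_sq_bounds : 0.405284734 ≤ rho ^ 2 ∧ rho ^ 2 ≤ 0.405284736 := by
  have h := sq_bounds rho_bounds (by norm_num)
  exact ⟨le_trans (by norm_num) h.1, h.2.trans (by norm_num)⟩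

theorem arcsin_side_bounds : 0.9711160 ≤ Real.arcsin (rho / √(1 - rho ^ 2)) ∧
    Real.arcsin (rho / √(1 - rho ^ 2)) ≤ 0.9711163 := by
  have h := rho_sq_bounds
  have h1 : 0.77117784 ≤ √(1 - rho ^ 2) ∧ √(1 - rho ^ 2) ≤ 0.77117786 :=
    sqrt_bounds (by norm_num at h ⊢; linarith) (by norm_num at h ⊢; linarith) (by norm_num)
  have h2 := div_bounds rho_bounds h1 (by norm_num) (by norm_num)
  exact arcsin_bounds (by norm_num) (by norm_num) (by norm_num) (by norm_num)
    (le_trans (by norm_num) h2.1) (h2.2.trans (by norm_num))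

theorem arcsin_mid_bounds : 0.7497787 ≤ Real.arcsin (rho ^ 2 / (1 - rho ^ 2)) ∧
    Real.arcsin (rho ^ 2 / (1 - rho ^ 2)) ≤ 0.7497790 := by
  have h := rho_sq_bounds
  have h1 : 0.594715264 ≤ 1 - rho ^ 2 ∧ 1 - rho ^ 2 ≤ 0.594715266 :=
    ⟨by norm_num at h ⊢; linarith, by norm_num at h ⊢; linarith⟩
  have h2 := div_bounds h h1 (by norm_num) (by norm_num)
  exact arcsin_bounds (by norm_num) (by norm_num) (by norm_num) (by norm_num)
    (le_trans (by norm_num) h2.1) (h2.2.trans (by norm_num))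

/-- The arcsine expression, evaluated at the pulse parameter `1.4` by interval arithmetic. -/
theorem arcsinBound_bounds : 0.7464 < arcsinBound (2 / Real.pi) (pulseZero 1.4) (pulseOne 1.4) ∧
    arcsinBound (2 / Real.pi) (pulseZero 1.4) (pulseOne 1.4) < 0.7465 := by
  have hρ := rho_bounds
  have hs := arcsin_rho_bounds
  have ha := arcsin_side_bounds
  have hb := arcsin_mid_bounds
  have hpi : 3.14159265 ≤ Real.pi ∧ Real.pi ≤ 3.14159266 :=
    ⟨le_trans (by norm_num) Real.pi_gt_d20.le, Real.pi_lt_d20.le.trans (by norm_num)⟩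
  have hinv : 0.31830988 ≤ 1 / Real.pi ∧ 1 / Real.pi ≤ 0.31830989 := by
    have := div_bounds (x := 1) (a := 1) (b := 1) ⟨le_rfl, le_rfl⟩ hpi (by norm_num) (by norm_num)
    exact ⟨le_trans (by norm_num) this.1, this.2.trans (by norm_num)⟩
  have hD : 1.9397255 ≤ √(1 / 2 * (1.4 : ℝ) ^ 2 + 4 / Real.pi * 1.4 + 1) ∧
      √(1 / 2 * (1.4 : ℝ) ^ 2 + 4 / Real.pi * 1.4 + 1) ≤ 1.9397257 := by
    have e : 4 / Real.pi = 2 * rho := by rw [rho]; ring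
    rw [e]
    refine sqrt_bounds ?_ ?_ (by norm_num) <;> norm_num at hρ ⊢ <;> linarith
  have hg0 : 0.9750180 ≤ pulseZero 1.4 ∧ pulseZero 1.4 ≤ 0.9750183 := by
    have h1 : 1.8912676 ≤ 1 + 2 / Real.pi * (1.4 : ℝ) ∧ 1 + 2 / Real.pi * (1.4 : ℝ) ≤ 1.8912677 := by
      change _ ≤ 1 + rho * 1.4 ∧ 1 + rho * 1.4 ≤ _
      constructor <;> norm_num at hρ ⊢ <;> linarith
    have := div_bounds h1 hD (by norm_num) (by norm_num)
    exact ⟨le_trans (by norm_num) this.1, this.2.trans (by norm_num)⟩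
  have hg1 : 0.6890766 ≤ pulseOne 1.4 ∧ pulseOne 1.4 ≤ 0.6890769 := by
    have h1 : 1.33661977 ≤ 2 / Real.pi + 1 / 2 * (1.4 : ℝ) ∧
        2 / Real.pi + 1 / 2 * (1.4 : ℝ) ≤ 1.33661978 := by
      change _ ≤ rho + 1 / 2 * 1.4 ∧ rho + 1 / 2 * 1.4 ≤ _
      constructor <;> norm_num at hρ ⊢ <;> linarith
    have := div_bounds h1 hD (by norm_num) (by norm_num)
    exact ⟨le_trans (by norm_num) this.1, this.2.trans (by norm_num)⟩
  rw [arcsinBound]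
  change _ < rho * ((_ + pulseOne 1.4 / Real.pi * Real.arcsin (rho / √(1 - rho ^ 2))
    - _ / (2 * Real.pi) * Real.arcsin (rho ^ 2 / (1 - rho ^ 2))) ^ 2 /
      (1 / 4 + 1 / Real.pi * Real.arcsin rho)
      + 8 * (pulseZero 1.4 / 4 - pulseOne 1.4 / Real.pi * Real.arcsin (rho / √(1 - rho ^ 2))
    + pulseZero 1.4 / (2 * Real.pi) * Real.arcsin (rho ^ 2 / (1 - rho ^ 2))) ^ 2
      + (pulseOne 1.4 / 2 - pulseZero 1.4 / 4 - pulseOne 1.4 / Real.pi * Real.arcsin (rho / √(1 - rho ^ 2))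
    + pulseZero 1.4 / (2 * Real.pi) * Real.arcsin (rho ^ 2 / (1 - rho ^ 2))) ^ 2
      / (1 / 4 - 1 / Real.pi * Real.arcsin rho)) ∧
    rho * ((_ + pulseOne 1.4 / Real.pi * Real.arcsin (rho / √(1 - rho ^ 2))
    - _ / (2 * Real.pi) * Real.arcsin (rho ^ 2 / (1 - rho ^ 2))) ^ 2 /
      (1 / 4 + 1 / Real.pi * Real.arcsin rho)
      + 8 * (pulseZero 1.4 / 4 - pulseOne 1.4 / Real.pi * Real.arcsin (rho / √(1 - rho ^ 2))
    + pulseZero 1.4 / (2 * Real.pi) * Real.arcsin (rho ^ 2 / (1 - rho ^ 2))) ^ 2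
      + (pulseOne 1.4 / 2 - pulseZero 1.4 / 4 - pulseOne 1.4 / Real.pi * Real.arcsin (rho / √(1 - rho ^ 2))
    + pulseZero 1.4 / (2 * Real.pi) * Real.arcsin (rho ^ 2 / (1 - rho ^ 2))) ^ 2
      / (1 / 4 - 1 / Real.pi * Real.arcsin rho)) < _
  set g0 := pulseZero 1.4
  set g1 := pulseOne 1.4
  set a := Real.arcsin (rho / √(1 - rho ^ 2))
  set b := Real.arcsin (rho ^ 2 / (1 - rho ^ 2))
  set s := Real.arcsin rho
  have hga : 0.2130044 ≤ g1 / Real.pi * a ∧ g1 / Real.pi * a ≤ 0.2130048 := by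
    have h := mul_bounds (mul_bounds hg1 hinv (by norm_num) (by norm_num)) ha (by norm_num)
      (by norm_num)
    rw [mul_one_div] at h
    exact ⟨le_trans (by norm_num) h.1, h.2.trans (by norm_num)⟩
  have hgb : 0.1163497 ≤ g0 / (2 * Real.pi) * b ∧ g0 / (2 * Real.pi) * b ≤ 0.1163502 := by
    have h := mul_bounds (mul_bounds hg0 hinv (by norm_num) (by norm_num)) hb (by norm_num)
      (by norm_num)
    rw [mul_one_div] at h
    have e : g0 / (2 * Real.pi) * b = (g0 / Real.pi * b) / 2 := by ring
    rw [e]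
    constructor <;> norm_num at h ⊢ <;> linarith
  have hsp : 0.2196678 ≤ 1 / Real.pi * s ∧ 1 / Real.pi * s ≤ 0.2196680 := by
    have h := mul_bounds hinv hs (by norm_num) (by norm_num)
    exact ⟨le_trans (by norm_num) h.1, h.2.trans (by norm_num)⟩
  set x := g1 / Real.pi * a
  set y := g0 / (2 * Real.pi) * b
  set z := 1 / Real.pi * s
  have hA : 0.684947 ≤ g1 / 2 + g0 / 4 + x - y ∧ g1 / 2 + g0 / 4 + x - y ≤ 0.684949 := by
    constructor <;> norm_num at hg0 hg1 hga hgb ⊢ <;> linarith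
  have hC : 0.147099 ≤ g0 / 4 - x + y ∧ g0 / 4 - x + y ≤ 0.1471005 := by
    constructor <;> norm_num at hg0 hg1 hga hgb ⊢ <;> linarith
  have hE : 0.004128 ≤ g1 / 2 - g0 / 4 - x + y ∧ g1 / 2 - g0 / 4 - x + y ≤ 0.004130 := by
    constructor <;> norm_num at hg0 hg1 hga hgb ⊢ <;> linarith
  have hp : 0.4696678 ≤ 1 / 4 + z ∧ 1 / 4 + z ≤ 0.4696680 := by
    constructor <;> norm_num at hsp ⊢ <;> linarith
  have hm : 0.0303320 ≤ 1 / 4 - z ∧ 1 / 4 - z ≤ 0.0303322 := by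
    constructor <;> norm_num at hsp ⊢ <;> linarith
  have hA2 := sq_bounds hA (by norm_num)
  have hC2 := sq_bounds hC (by norm_num)
  have hE2 := sq_bounds hE (by norm_num)
  have hAd := div_bounds hA2 hp (by norm_num) (by norm_num)
  have hEd := div_bounds hE2 hm (by norm_num) (by norm_num)
  have hsum : 1.17254 ≤ (g1 / 2 + g0 / 4 + x - y) ^ 2 / (1 / 4 + z) + 8 * (g0 / 4 - x + y) ^ 2
      + (g1 / 2 - g0 / 4 - x + y) ^ 2 / (1 / 4 - z) ∧
      (g1 / 2 + g0 / 4 + x - y) ^ 2 / (1 / 4 + z) + 8 * (g0 / 4 - x + y) ^ 2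
      + (g1 / 2 - g0 / 4 - x + y) ^ 2 / (1 / 4 - z) ≤ 1.17259 := by
    constructor <;> norm_num at hAd hC2 hEd ⊢ <;> linarith
  have := mul_bounds hρ hsum (by norm_num) (by norm_num)
  exact ⟨lt_of_lt_of_le (by norm_num) this.1, lt_of_le_of_lt this.2 (by norm_num)⟩

/-- The optimal statistic: the first-order term of the likelihood ratio of the three signs, written
as a `signPoly`. Its response to the pulse samples `g1, g0, g1` equals its second moment. -/
theorem exists_signPoly_optimal (g0 g1 : ℝ) : ∃ α β γ : ℝ,
    2 / √(2 * Real.pi) * ((α + γ * kappaSide) * (2 * g1) + (β - γ * kappaMid) * g0)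
      = arcsinBound (2 / Real.pi) g0 g1 ∧
    signPolyMoment α β γ = arcsinBound (2 / Real.pi) g0 g1 := by
  set a := Real.arcsin (rho / √(1 - rho ^ 2)) with ha
  set b := Real.arcsin (rho ^ 2 / (1 - rho ^ 2)) with hb
  set s := Real.arcsin rho with hs
  have hpi := Real.pi_pos
  have hs1 := arcsin_rho_bounds
  rw [← hs] at hs1
  norm_num at hs1
  have hp : 1 / 4 + 1 / Real.pi * s ≠ 0 := by
    have : 0 ≤ 1 / Real.pi * s := mul_nonneg (by positivity) (by linarith)
    linarith
  have hm : 1 / 4 - 1 / Real.pi * s ≠ 0 := by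
    have : 1 / Real.pi * s < 1 / 4 := by
      rw [one_div, inv_mul_lt_iff₀ hpi]; linarith [Real.pi_gt_three]
    linarith
  set A := g1 / 2 + g0 / 4 + g1 / Real.pi * a - g0 / (2 * Real.pi) * b with hA
  set C := g0 / 4 - g1 / Real.pi * a + g0 / (2 * Real.pi) * b with hC
  set E := g1 / 2 - g0 / 4 - g1 / Real.pi * a + g0 / (2 * Real.pi) * b with hE
  set c := √(2 * Real.pi) with hc
  have hc2 : c ^ 2 = 2 * Real.pi := Real.sq_sqrt (by positivity)
  have hc0 : c ≠ 0 := by positivity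
  have hB : arcsinBound (2 / Real.pi) g0 g1 = 4 / c ^ 2 * (A ^ 2 / (1 / 4 + 1 / Real.pi * s)
      + 8 * C ^ 2 + E ^ 2 / (1 / 4 - 1 / Real.pi * s)) := by
    rw [hc2, show 4 / (2 * Real.pi) = 2 / Real.pi by field_simp; norm_num]
    rfl
  -- the values of the statistic at the signs `(1, 1, 1)`, `(1, 1, -1)` and `(1, -1, 1)`: the first-order
  -- response of the probability of these signs, divided by their probability under the noise law
  set A' := 2 * A / (c * (1 / 4 + 1 / Real.pi * s)) with hA'
  set C' := 8 * C / c with hC'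
  set E' := 2 * E / (c * (1 / 4 - 1 / Real.pi * s)) with hE'
  refine ⟨(A' + E') / 4, (A' - E') / 4 + C' / 2, (A' - E') / 4 - C' / 2, ?_, ?_⟩
  · have e1 : 2 / c * (((A' + E') / 4 + ((A' - E') / 4 - C' / 2) * kappaSide) * (2 * g1)
        + ((A' - E') / 4 + C' / 2 - ((A' - E') / 4 - C' / 2) * kappaMid) * g0)
        = 2 / c * (A * A' + 2 * C * C' + E * E') := by
      rw [kappaSide, kappaMid, ← ha, ← hb, hA, hC, hE]
      ring
    rw [e1, hB, hA', hC', hE']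
    field_simp
    ring
  · have e1 : signPolyMoment ((A' + E') / 4) ((A' - E') / 4 + C' / 2) ((A' - E') / 4 - C' / 2)
        = (1 / 4 + 1 / Real.pi * s) * A' ^ 2 + 1 / 2 * C' ^ 2 + (1 / 4 - 1 / Real.pi * s) * E' ^ 2 := by
      rw [signPolyMoment, ← hs]
      ring
    rw [e1, hB, hA', hC', hE']
    field_simp
    ring

/-! ### The Donsker–Varadhan bound and antipodal inputs -/

/-- The Donsker–Varadhan lower bound for the Kullback–Leibler divergence, with an unnormalized test
density `h`. It is Young's inequality `r log r - r ≥ r log h - h`, integrated. -/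
theorem ofReal_integral_log_le_klDiv {α : Type*} {_ : MeasurableSpace α} {ν μ : Measure α}
    [IsProbabilityMeasure ν] [IsProbabilityMeasure μ] {h : α → ℝ} (hpos : ∀ᵐ x ∂μ, 0 < h x)
    (hint : Integrable h μ) (hle : ∫ x, h x ∂μ ≤ 1)
    (hlog : Integrable (fun x => Real.log (h x)) ν) :
    ENNReal.ofReal (∫ x, Real.log (h x) ∂ν) ≤ InformationTheory.klDiv ν μ := by
  rw [InformationTheory.klDiv_eq_integral_klFun]
  split_ifs with hc
  swap; · exact le_top
  obtain ⟨hac, hllr⟩ := hc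
  refine ENNReal.ofReal_le_ofReal ?_
  have hk := (InformationTheory.integrable_klFun_rnDeriv_iff hac).2 hllr
  have hr : Integrable (fun x => (ν.rnDeriv μ x).toReal * Real.log (h x)) μ :=
    (integrable_rnDeriv_smul_iff hac).2 hlog
  have e : ∫ x, (ν.rnDeriv μ x).toReal * Real.log (h x) ∂μ = ∫ x, Real.log (h x) ∂ν :=
    integral_rnDeriv_smul hac
  have h1 : Integrable (fun x => 1 - h x) μ := (integrable_const _).sub hint
  have key : ∫ x, ((ν.rnDeriv μ x).toReal * Real.log (h x) + (1 - h x)) ∂μ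
      ≤ ∫ x, InformationTheory.klFun (ν.rnDeriv μ x).toReal ∂μ := by
    refine integral_mono_ae (hr.add h1) hk ?_
    filter_upwards [hpos] with x hx
    set r := (ν.rnDeriv μ x).toReal
    have hr0 : 0 ≤ r := ENNReal.toReal_nonneg
    simp only [InformationTheory.klFun_apply]
    rcases hr0.eq_or_lt with h0 | h0
    · rw [← h0]; simp; linarith
    · have := Real.log_le_sub_one_of_pos (div_pos hx h0)
      rw [Real.log_div hx.ne' h0.ne'] at this
      have h2 := mul_le_mul_of_nonneg_left this h0.le
      have h3 : r * (h x / r - 1) = h x - r := by field_simp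
      linarith
  rw [integral_add hr h1, e, integral_sub (integrable_const _) hint] at key
  simp at key
  linarith

theorem log_one_add_ge {t : ℝ} (ht : |t| ≤ 1 / 2) :
    t - t ^ 2 / 2 - 2 * |t| ^ 3 ≤ Real.log (1 + t) := by
  have h := Real.abs_log_sub_add_sum_range_le (x := -t) (by rw [abs_neg]; linarith) 2
  simp only [Finset.sum_range_succ, Finset.sum_range_zero, sub_neg_eq_add, abs_neg] at h
  norm_num at h
  have h1 : |t| ^ 3 / (1 - |t|) ≤ 2 * |t| ^ 3 := by
    rw [div_le_iff₀ (by linarith)]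
    have : 0 ≤ |t| ^ 3 := by positivity
    nlinarith
  have h2 := (abs_le.1 h).1
  linarith

/-- The law of a symbol that is `ε` or `-ε` with equal probabilities. -/
def twoPoint (ε : ℝ) : Measure ℝ :=
  (2⁻¹ : ℝ≥0∞) • Measure.dirac ε + (2⁻¹ : ℝ≥0∞) • Measure.dirac (-ε)

instance (ε : ℝ) : IsProbabilityMeasure (twoPoint ε) :=
  ⟨by simp [twoPoint, ENNReal.inv_two_add_inv_two]⟩

theorem integral_twoPoint (ε : ℝ) (f : ℝ → ℝ) :
    ∫ t, f t ∂twoPoint ε = (f ε + f (-ε)) / 2 := by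
  have h : ∀ a, Integrable f ((2⁻¹ : ℝ≥0∞) • Measure.dirac a) := fun a =>
    (integrable_dirac (by simp)).smul_measure (by simp)
  rw [twoPoint, integral_add_measure (h _) (h _), integral_smul_measure, integral_smul_measure]
  simp
  ring

theorem ae_twoPoint (ε : ℝ) : ∀ᵐ t ∂twoPoint ε, |t| = |ε| := by
  rw [twoPoint, ae_add_measure_iff]
  constructor <;> refine Measure.ae_smul_measure ?_ _ <;> rw [ae_dirac_eq] <;> simp

/-- The input law: independent equiprobable antipodal symbols. -/
def antipodal (n : ℕ) (ε : ℝ) : Measure (Fin n → ℝ) := Measure.pi fun _ => twoPoint ε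

instance (n : ℕ) (ε : ℝ) : IsProbabilityMeasure (antipodal n ε) := by
  unfold antipodal; infer_instance

section Antipodal

variable {n : ℕ} {ε : ℝ}

theorem measurePreserving_eval_antipodal (k : Fin n) :
    MeasurePreserving (fun x : Fin n → ℝ => x k) (antipodal n ε) (twoPoint ε) :=
  measurePreserving_eval (fun _ : Fin n => twoPoint ε) k

theorem ae_abs_antipodal (n : ℕ) (ε : ℝ) : ∀ᵐ x ∂antipodal n ε, ∀ k : Fin n, |x k| = |ε| := by
  rw [ae_all_iff]
  exact fun k => (measurePreserving_eval_antipodal k).quasiMeasurePreserving.ae (ae_twoPoint ε)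

theorem memLp_antipodal (k : Fin n) (p : ℝ≥0∞) :
    MemLp (fun x : Fin n → ℝ => x k) p (antipodal n ε) := by
  refine MemLp.of_bound (measurable_pi_apply k).aestronglyMeasurable |ε| ?_
  filter_upwards [ae_abs_antipodal n ε] with x hx
  exact (hx k).le

theorem integral_antipodal (k : Fin n) : ∫ x, x k ∂antipodal n ε = 0 := by
  rw [(measurePreserving_eval_antipodal k).hasLaw.integral_eq, integral_twoPoint]
  ring

theorem integral_antipodal_mul (k l : Fin n) :
    ∫ x, x k * x l ∂antipodal n ε = if k = l then ε ^ 2 else 0 := by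
  split_ifs with h
  · subst h
    have : ∀ᵐ x ∂antipodal n ε, x k * x k = ε ^ 2 := by
      filter_upwards [ae_abs_antipodal n ε] with x hx
      rw [← sq, ← sq_abs, hx k, sq_abs]
    rw [integral_congr_ae this]
    simp
  · have hi : iIndepFun (fun (i : Fin n) (x : Fin n → ℝ) => x i) (antipodal n ε) :=
      iIndepFun_pi (X := fun _ : Fin n => id) fun _ => aemeasurable_id
    rw [(hi.indepFun h).integral_fun_mul_eq_mul_integral
      (measurable_pi_apply k).aestronglyMeasurable (measurable_pi_apply l).aestronglyMeasurable,
      integral_antipodal, zero_mul]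

theorem memLp_sum_antipodal (c : Fin n → ℝ) (p : ℝ≥0∞) :
    MemLp (fun x : Fin n → ℝ => ∑ ℓ, x ℓ * c ℓ) p (antipodal n ε) :=
  memLp_finsetSum _ fun ℓ _ => (memLp_antipodal ℓ p).mul_const _

theorem integral_antipodal_mul_sum (k : Fin n) (c : Fin n → ℝ) :
    ∫ x, x k * ∑ ℓ, x ℓ * c ℓ ∂antipodal n ε = ε ^ 2 * c k := by
  have i : ∀ ℓ, Integrable (fun x : Fin n → ℝ => x k * x ℓ * c ℓ) (antipodal n ε) := fun ℓ =>
    ((memLp_antipodal k 2).integrable_mul (memLp_antipodal ℓ 2)).mul_const _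
  simp_rw [Finset.mul_sum, ← mul_assoc]
  rw [integral_finsetSum _ fun ℓ _ => i ℓ]
  simp_rw [integral_mul_const, integral_antipodal_mul]
  simp

theorem integral_antipodal_sum_sq (c : Fin n → ℝ) :
    ∫ x, (∑ ℓ, x ℓ * c ℓ) ^ 2 ∂antipodal n ε = ε ^ 2 * ∑ ℓ, c ℓ ^ 2 := by
  have i : ∀ k, Integrable (fun x : Fin n → ℝ => c k * (x k * ∑ ℓ, x ℓ * c ℓ)) (antipodal n ε) :=
    fun k => ((memLp_antipodal k 2).integrable_mul (memLp_sum_antipodal c 2)).const_mul _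
  have e : ∀ x : Fin n → ℝ, (∑ ℓ, x ℓ * c ℓ) ^ 2 = ∑ k, c k * (x k * ∑ ℓ, x ℓ * c ℓ) := fun x => by
    rw [sq]
    nth_rw 1 [Finset.sum_mul]
    exact Finset.sum_congr rfl fun k _ => by ring
  simp_rw [e]
  rw [integral_finsetSum _ fun k _ => i k, Finset.mul_sum]
  refine Finset.sum_congr rfl fun k _ => ?_
  rw [integral_const_mul, integral_antipodal_mul_sum]
  ring

/-- Independent centred symbols make a product of factors `1 + x k * a k` a probability density. -/
theorem integral_antipodal_prod (a : Fin n → ℝ) :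
    ∫ x, ∏ k, (1 + x k * a k) ∂antipodal n ε = 1 := by
  rw [antipodal, integral_fintype_prod_eq_prod (f := fun k t => 1 + t * a k)]
  refine Finset.prod_eq_one fun k _ => ?_
  rw [integral_twoPoint]
  ring

end Antipodal

/-! ### The contribution of one symbol -/

/-- The contribution of the symbol `x k` to the Donsker–Varadhan bound. The three samples are
`Z i + ∑ ℓ, x ℓ * c i ℓ`; only the response to `x k` enters the leading term, since the interference
of the other symbols has mean zero and bounded power. -/
theorem integral_log_one_add_signPoly_ge {Ω : Type*} {mΩ : MeasurableSpace Ω} {P : Measure Ω}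
    {Z : Fin 3 → Ω → ℝ} (h : IsNoiseTriple Z P) (hZ : ∀ i, Measurable (Z i)) {n : ℕ} {ε s K : ℝ}
    (hε : 0 < ε) (hs : 0 < s) (c : Fin 3 → Fin n → ℝ) (hK : ∀ i, ∑ ℓ, c i ℓ ^ 2 ≤ K) (k : Fin n)
    (α β γ : ℝ) (hsmall : s * ε * (2 * (|α| + |β| + |γ|)) ≤ 1 / 2) :
    s * ε ^ 2 * (2 / √(2 * Real.pi) *
        ((α + γ * kappaSide) * (c 0 k + c 2 k) + (β - γ * kappaMid) * c 1 k))
      - s ^ 2 * ε ^ 2 / 2 * signPolyMoment α β γ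
      - ε ^ 3 * (540 * s * (|α| + |β| + |γ|) * K
        + 12 * s ^ 2 * (|α| + |β| + |γ|) ^ 2 * (K + 1) + 16 * s ^ 3 * (|α| + |β| + |γ|) ^ 3)
      ≤ ∫ p : (Fin n → ℝ) × Ω, Real.log (1 + p.1 k * (s * signPoly α β γ
          (sgn (Z 0 p.2 + ∑ ℓ, p.1 ℓ * c 0 ℓ)) (sgn (Z 1 p.2 + ∑ ℓ, p.1 ℓ * c 1 ℓ))
          (sgn (Z 2 p.2 + ∑ ℓ, p.1 ℓ * c 2 ℓ)))) ∂(antipodal n ε).prod P := by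
  have := h.isProbabilityMeasure
  set M := |α| + |β| + |γ| with hM
  have hM0 : 0 ≤ M := by positivity
  set μ := antipodal n ε with hμ
  set m : Fin 3 → (Fin n → ℝ) → ℝ := fun i x => ∑ ℓ, x ℓ * c i ℓ with hm
  have hmm : ∀ i, Measurable (m i) := fun i => by simp only [hm]; fun_prop
  set F : (Fin n → ℝ) × Ω → ℝ := fun p => signPoly α β γ (sgn (Z 0 p.2 + m 0 p.1))
    (sgn (Z 1 p.2 + m 1 p.1)) (sgn (Z 2 p.2 + m 2 p.1)) with hF
  have hsm : ∀ i, Measurable fun p : (Fin n → ℝ) × Ω => sgn (Z i p.2 + m i p.1) := fun i =>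
    measurable_sgn.comp (((hZ i).comp measurable_snd).add ((hmm i).comp measurable_fst))
  have hFm : Measurable F := by
    simp only [hF, signPoly]
    exact ((((hsm 0).add (hsm 2)).const_mul α).add ((hsm 1).const_mul β)).add
      (((hsm 0).mul ((hsm 1).mul (hsm 2))).const_mul γ)
  have hFb : ∀ p, |F p| ≤ 2 * M := fun p => abs_signPoly_sgn_le _ _ _ _ _ _
  have hF2b : ∀ p, |F p ^ 2| ≤ (2 * M) ^ 2 := fun p => by
    rw [abs_pow]; exact pow_le_pow_left₀ (abs_nonneg _) (hFb p) 2
  have hae : ∀ᵐ p ∂μ.prod P, |p.1 k| = ε := by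
    refine (Measure.quasiMeasurePreserving_fst (μ := μ) (ν := P)).ae (p := fun x => |x k| = ε) ?_
    filter_upwards [ae_abs_antipodal n ε] with x hx
    rw [hx k, abs_of_pos hε]
  have hxm : Measurable fun p : (Fin n → ℝ) × Ω => p.1 k := (measurable_pi_apply k).comp measurable_fst
  have iF2 : Integrable (fun p => F p ^ 2) (μ.prod P) :=
    integrable_of_abs_le (hFm.pow_const 2).aestronglyMeasurable hF2b
  have ixF : Integrable (fun p : (Fin n → ℝ) × Ω => p.1 k * F p) (μ.prod P) := by
    refine Integrable.of_bound (hxm.mul hFm).aestronglyMeasurable (ε * (2 * M)) ?_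
    filter_upwards [hae] with p hp
    rw [Real.norm_eq_abs, abs_mul, hp]
    exact mul_le_mul_of_nonneg_left (hFb p) hε.le
  have hmL : ∀ i, MemLp (m i) 2 μ := fun i => memLp_sum_antipodal (c i) 2
  have hxL : MemLp (fun x : Fin n → ℝ => x k) 2 μ := memLp_antipodal k 2
  have ixm : ∀ i, Integrable (fun x => x k * m i x) μ := fun i => hxL.integrable_mul (hmL i)
  have im2 : ∀ i, Integrable (fun x => m i x ^ 2) μ := fun i => (hmL i).integrable_sq
  have ix : Integrable (fun x : Fin n → ℝ => x k) μ := hxL.integrable (by norm_num)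
  have hm2 : ∀ i, ∫ x, m i x ^ 2 ∂μ ≤ ε ^ 2 * K := fun i => by
    rw [integral_antipodal_sum_sq]
    exact mul_le_mul_of_nonneg_left (hK i) (sq_nonneg ε)
  have hK0 : 0 ≤ K := le_trans (Finset.sum_nonneg fun _ _ => sq_nonneg _) (hK 0)
  set I2 := ∫ x, (m 0 x ^ 2 + m 1 x ^ 2 + m 2 x ^ 2) ∂μ with hI2
  have iS : Integrable (fun x => m 0 x ^ 2 + m 1 x ^ 2 + m 2 x ^ 2) μ :=
    ((im2 0).add (im2 1)).add (im2 2)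
  have hI2le : I2 ≤ 3 * (ε ^ 2 * K) := by
    have i01 : Integrable (fun x => m 0 x ^ 2 + m 1 x ^ 2) μ := (im2 0).add (im2 1)
    rw [hI2, integral_add i01 (im2 2), integral_add (im2 0) (im2 1)]
    linarith [hm2 0, hm2 1, hm2 2]
  -- the response to the means `m i x` is linear up to a quadratic error, and averaging against `x k`
  -- leaves only the coefficients of symbol `k`
  set Λ : (Fin n → ℝ) → ℝ := fun x => 2 / √(2 * Real.pi) *
    ((α + γ * kappaSide) * (m 0 x + m 2 x) + (β - γ * kappaMid) * m 1 x) with hΛ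
  set Φ₀ := ∫ ω, signPoly α β γ (sgn (Z 0 ω)) (sgn (Z 1 ω)) (sgn (Z 2 ω)) ∂P with hΦ₀
  have exΛ : ∀ x : Fin n → ℝ, x k * Λ x = 2 / √(2 * Real.pi) *
      ((α + γ * kappaSide) * (x k * m 0 x + x k * m 2 x) + (β - γ * kappaMid) * (x k * m 1 x)) :=
    fun x => by simp only [hΛ]; ring
  have ixΛ : Integrable (fun x => x k * Λ x) μ := by
    simp_rw [exΛ]
    exact ((((ixm 0).add (ixm 2)).const_mul _).add ((ixm 1).const_mul _)).const_mul _
  have hxΛ : ∫ x, x k * Λ x ∂μ = ε ^ 2 * (2 / √(2 * Real.pi) *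
      ((α + γ * kappaSide) * (c 0 k + c 2 k) + (β - γ * kappaMid) * c 1 k)) := by
    have i1 : Integrable (fun x => (α + γ * kappaSide) * (x k * m 0 x + x k * m 2 x)) μ :=
      ((ixm 0).add (ixm 2)).const_mul _
    simp_rw [exΛ]
    rw [integral_const_mul, integral_add i1 ((ixm 1).const_mul _), integral_const_mul,
      integral_const_mul, integral_add (ixm 0) (ixm 2), integral_antipodal_mul_sum,
      integral_antipodal_mul_sum, integral_antipodal_mul_sum]
    ring
  have hlin : ε ^ 2 * (2 / √(2 * Real.pi) *
      ((α + γ * kappaSide) * (c 0 k + c 2 k) + (β - γ * kappaMid) * c 1 k))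
      - ε * (180 * M) * (3 * (ε ^ 2 * K)) ≤ ∫ p, p.1 k * F p ∂μ.prod P := by
    rw [integral_prod _ ixF]
    have i0 : Integrable (fun x : Fin n → ℝ => x k * Φ₀) μ := ix.mul_const _
    have i1 : Integrable (fun x : Fin n → ℝ => x k * Φ₀ + x k * Λ x) μ := i0.add ixΛ
    have i2 : Integrable (fun x => ε * (180 * M) * (m 0 x ^ 2 + m 1 x ^ 2 + m 2 x ^ 2)) μ :=
      iS.const_mul _
    have e : ∫ x, (x k * Φ₀ + x k * Λ x - ε * (180 * M) * (m 0 x ^ 2 + m 1 x ^ 2 + m 2 x ^ 2)) ∂μ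
        = ε ^ 2 * (2 / √(2 * Real.pi) *
      ((α + γ * kappaSide) * (c 0 k + c 2 k) + (β - γ * kappaMid) * c 1 k))
        - ε * (180 * M) * I2 := by
      rw [integral_sub i1 i2, integral_add i0 ixΛ, integral_mul_const, integral_const_mul, hxΛ,
        integral_antipodal]
      ring
    calc _ ≤ ∫ x, (x k * Φ₀ + x k * Λ x
          - ε * (180 * M) * (m 0 x ^ 2 + m 1 x ^ 2 + m 2 x ^ 2)) ∂μ := by
          rw [e]
          have := mul_le_mul_of_nonneg_left hI2le (show 0 ≤ ε * (180 * M) by positivity)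
          linarith
      _ ≤ _ := by
          refine integral_mono_ae (i1.sub i2) ixF.integral_prod_left ?_
          filter_upwards [ae_abs_antipodal n ε] with x hx
          rw [integral_const_mul]
          have hr := h.abs_integral_signPoly_sub_le α β γ (m 0 x) (m 1 x) (m 2 x)
          have hxk : |x k| = ε := by rw [hx k, abs_of_pos hε]
          have h2 : |x k * (∫ ω, F (x, ω) ∂P - Φ₀ - Λ x)|
              ≤ ε * (180 * M * (m 0 x ^ 2 + m 1 x ^ 2 + m 2 x ^ 2)) := by
            rw [abs_mul, hxk]
            exact mul_le_mul_of_nonneg_left hr hε.le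
          have h3 := (abs_le.1 h2).1
          linarith
  -- the second moment is multiplied by `ε²` below, so it may be off by `O(ε)`: `am` turns the
  -- first-order error `|m i x|` into a mean square
  have hquad : ∫ p, F p ^ 2 ∂μ.prod P ≤ signPolyMoment α β γ + 16 * M ^ 2 * (3 * (ε * (K + 1)) / 2) := by
    rw [integral_prod _ iF2]
    have i2 : Integrable (fun x => 16 * M ^ 2 * ((m 0 x ^ 2 + m 1 x ^ 2 + m 2 x ^ 2) / (2 * ε))) μ :=
      (iS.div_const _).const_mul _
    have i3 : Integrable (fun x => (signPolyMoment α β γ + 16 * M ^ 2 * (3 * ε / 2))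
        + 16 * M ^ 2 * ((m 0 x ^ 2 + m 1 x ^ 2 + m 2 x ^ 2) / (2 * ε))) μ :=
      (integrable_const _).add i2
    calc _ ≤ ∫ x, ((signPolyMoment α β γ + 16 * M ^ 2 * (3 * ε / 2))
        + 16 * M ^ 2 * ((m 0 x ^ 2 + m 1 x ^ 2 + m 2 x ^ 2) / (2 * ε))) ∂μ := by
          refine integral_mono_ae iF2.integral_prod_left i3 (Eventually.of_forall fun x => ?_)
          have hr := h.abs_integral_signPoly_sq_sub_le α β γ (m 0 x) (m 1 x) (m 2 x)
          have h1 := (abs_le.1 hr).2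
          have am : ∀ t : ℝ, |t| ≤ ε / 2 + t ^ 2 / (2 * ε) := fun t => by
            rw [div_add_div _ _ (by norm_num) (by positivity), le_div_iff₀ (by positivity),
              ← sq_abs t]
            nlinarith [sq_nonneg (|t| - ε)]
          have h2 : |m 0 x| + |m 1 x| + |m 2 x| ≤ 3 * ε / 2
              + (m 0 x ^ 2 + m 1 x ^ 2 + m 2 x ^ 2) / (2 * ε) := by
            have := am (m 0 x)
            have := am (m 1 x)
            have := am (m 2 x)
            rw [add_div, add_div]
            linarith
          have h3 := mul_le_mul_of_nonneg_left h2 (show 0 ≤ 16 * M ^ 2 by positivity)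
          simp only
          have h4 : ∫ ω, F (x, ω) ^ 2 ∂P - signPolyMoment α β γ
              ≤ 16 * M ^ 2 * (|m 0 x| + |m 1 x| + |m 2 x|) := h1
          linarith
      _ = signPolyMoment α β γ + 16 * M ^ 2 * (3 * ε / 2) + 16 * M ^ 2 * (I2 / (2 * ε)) := by
          rw [integral_add (integrable_const _) i2, integral_const_mul, integral_div, ← hI2,
            integral_const]
          simp
      _ ≤ _ := by
          have h1 : I2 / (2 * ε) ≤ 3 * (ε * K) / 2 := by
            rw [div_le_div_iff₀ (by positivity) (by norm_num)]
            nlinarith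
          have h2 := mul_le_mul_of_nonneg_left h1 (show 0 ≤ 16 * M ^ 2 by positivity)
          linarith
  -- `log (1 + t) ≥ t - t² / 2 - 2 |t|³`, where `|t| ≤ 2 s ε M` and `|p.1 k| = ε`
  have i4 : Integrable (fun p : (Fin n → ℝ) × Ω => s * (p.1 k * F p) - s ^ 2 * ε ^ 2 / 2 * F p ^ 2) (μ.prod P) :=
    (ixF.const_mul s).sub (iF2.const_mul _)
  have i5 : Integrable (fun p : (Fin n → ℝ) × Ω => s * (p.1 k * F p) - s ^ 2 * ε ^ 2 / 2 * F p ^ 2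
      - 16 * s ^ 3 * ε ^ 3 * M ^ 3) (μ.prod P) := i4.sub (integrable_const _)
  have ht : ∀ᵐ p ∂μ.prod P, |p.1 k * (s * F p)| ≤ s * ε * (2 * M) := by
    filter_upwards [hae] with p hp
    rw [abs_mul, abs_mul, hp, abs_of_pos hs]
    have := mul_le_mul_of_nonneg_left (hFb p) (show 0 ≤ s * ε by positivity)
    linarith
  have ilog : Integrable (fun p : (Fin n → ℝ) × Ω => Real.log (1 + p.1 k * (s * F p))) (μ.prod P) := by
    refine Integrable.of_bound (C := 1) (Real.measurable_log.comp
      ((hxm.mul (hFm.const_mul s)).const_add 1)).aestronglyMeasurable ?_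
    filter_upwards [ht] with p hp
    have h1 := abs_le.1 (hp.trans hsmall)
    have h2 := log_one_add_ge (hp.trans hsmall)
    have h3 := Real.log_le_sub_one_of_pos (x := 1 + p.1 k * (s * F p)) (by linarith)
    rw [Real.norm_eq_abs, abs_le]
    have h4 := hp.trans hsmall
    have h5 := abs_nonneg (p.1 k * (s * F p))
    refine ⟨le_trans ?_ h2, by linarith⟩
    have h6 : |p.1 k * (s * F p)| ^ 3 ≤ (1 / 2) ^ 3 := pow_le_pow_left₀ h5 h4 3
    have h7 : (p.1 k * (s * F p)) ^ 2 ≤ (1 / 2) ^ 2 := by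
      rw [← sq_abs]; exact pow_le_pow_left₀ h5 h4 2
    have h8 : ((1 : ℝ) / 2) ^ 3 = 1 / 8 := by norm_num
    have h9 : ((1 : ℝ) / 2) ^ 2 = 1 / 4 := by norm_num
    linarith
  calc _ ≤ s * (∫ p, p.1 k * F p ∂μ.prod P) - s ^ 2 * ε ^ 2 / 2 * ∫ p, F p ^ 2 ∂μ.prod P
        - 16 * s ^ 3 * ε ^ 3 * M ^ 3 := by
        have h1 := mul_le_mul_of_nonneg_left hlin hs.le
        have h2 := mul_le_mul_of_nonneg_left hquad (show 0 ≤ s ^ 2 * ε ^ 2 / 2 by positivity)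
        linarith
    _ = ∫ p, (s * (p.1 k * F p) - s ^ 2 * ε ^ 2 / 2 * F p ^ 2 - 16 * s ^ 3 * ε ^ 3 * M ^ 3) ∂μ.prod P := by
        rw [integral_sub i4 (integrable_const _), integral_sub (ixF.const_mul s) (iF2.const_mul _),
          integral_const_mul, integral_const_mul, integral_const]
        simp
    _ ≤ _ := by
        refine integral_mono_ae i5 ilog ?_
        filter_upwards [ht, hae] with p hp hpk
        have h2 := log_one_add_ge (hp.trans hsmall)
        refine le_trans ?_ h2
        have h3 : |p.1 k * (s * F p)| ^ 3 ≤ (s * ε * (2 * M)) ^ 3 := pow_le_pow_left₀ (abs_nonneg _) hp 3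
        have h4 : (p.1 k * (s * F p)) ^ 2 = s ^ 2 * ε ^ 2 * F p ^ 2 := by
          rw [mul_pow, mul_pow, ← sq_abs (p.1 k), hpk]; ring
        rw [h4]
        have h5 : (s * ε * (2 * M)) ^ 3 = 8 * s ^ 3 * ε ^ 3 * M ^ 3 := by ring
        rw [h5] at h3
        linarith

/-! ### The noise at the receiver -/

theorem noiseAutocov_eq {W : ℝ} (hW : 0 < W) (N0 τ : ℝ) :
    noiseAutocov W N0 τ = N0 / 2 * lpf W τ := by
  have hc : Continuous fun f : ℝ => Complex.exp (2 * Real.pi * Complex.I * f * τ) := by fun_prop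
  have h := Complex.reCLM.integral_comp_comm
    (hc.integrableOn_Icc (μ := volume) (a := -W) (b := W))
  rw [integral_exp_eq_lpf hW] at h
  rw [noiseAutocov, integral_const_mul]
  congr 1
  refine Eq.trans (integral_congr_ae (Eventually.of_forall fun f => ?_)) h
  have e : (2 * Real.pi * Complex.I * f * τ : ℂ)
      = ((2 * Real.pi * f * τ : ℝ) : ℂ) * Complex.I := by push_cast; ring
  simp only [Complex.reCLM_apply]
  rw [e, Complex.exp_ofReal_mul_I_re]

theorem noiseCov_apply {W : ℝ} (hW : 0 < W) (N0 : ℝ) (s : Finset ℤ) (i j : s) :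
    noiseCov W N0 (1 / (4 * W)) s i j
      = N0 * W * Real.sinc (Real.pi * ((i : ℝ) - (j : ℝ)) / 2) := by
  have e : (i : ℝ) * (1 / (4 * W)) - (j : ℝ) * (1 / (4 * W)) = ((i : ℝ) - (j : ℝ)) / (4 * W) := by
    ring
  simp only [noiseCov, Matrix.of_apply]
  rw [noiseAutocov_eq hW, e, lpf_sample hW]
  ring

/-- The numbers of the three samples that are nearest to the peak of the pulse of symbol `k`, which
has number `k + 1` and is sent at time `(k + 1)/(2W)`. -/
def sampleIndex (k : ℕ) (i : Fin 3) : ℤ := 2 * ((k : ℤ) + 1) - 1 + (i : ℕ)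

theorem sampleIndex_mem {W : ℝ} (hW : 0 < W) {n : ℕ} (k : Fin n) (i : Fin 3) :
    sampleIndex k i ∈ samples W (1 / (4 * W)) n := by
  have e : 4 * W * (1 / (4 * W)) = 1 := by field_simp
  refine Finset.mem_biUnion.2 ⟨k + 1, Finset.mem_Icc.2 ⟨by omega, by omega⟩, ?_⟩
  rw [blockSamples, e, div_one, div_one, Finset.mem_Icc, Int.ceil_le, Int.le_floor, sampleIndex]
  have h0 : (0 : ℝ) ≤ ((i : ℕ) : ℝ) := Nat.cast_nonneg _
  have h2 : ((i : ℕ) : ℝ) ≤ 2 := by exact_mod_cast Nat.lt_succ_iff.1 i.2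
  push_cast
  constructor <;> linarith

theorem noiseCorr_eq_sinc (k : ℕ) (i j : Fin 3) :
    noiseCorr i j
      = Real.sinc (Real.pi * ((sampleIndex k i : ℝ) - (sampleIndex k j : ℝ)) / 2) := by
  have e : (sampleIndex k i : ℝ) - (sampleIndex k j : ℝ) = ((i : ℕ) : ℝ) - ((j : ℕ) : ℝ) := by
    simp only [sampleIndex]; push_cast; ring
  rw [e]
  have e2 : Real.pi * (1 - 2) / 2 = -(Real.pi / 2) := by ring
  have e3 : Real.pi * (2 - 1) / 2 = Real.pi / 2 := by ring
  fin_cases i <;> fin_cases j <;>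
    simp [noiseCorr, rho, e2, e3, Real.sinc_neg, sinc_pi_div_two, sinc_pi, neg_div]

/-- The filtered noise at the three samples nearest to the pulse of symbol `k`, normalized to unit
variance. -/
def noiseTriple {W : ℝ} (hW : 0 < W) (N0 : ℝ) {n : ℕ} (k : Fin n) (i : Fin 3)
    (z : EuclideanSpace ℝ (samples W (1 / (4 * W)) n)) : ℝ :=
  (√(N0 * W))⁻¹ * z ⟨sampleIndex k i, sampleIndex_mem hW k i⟩

theorem measurable_noiseTriple {W : ℝ} (hW : 0 < W) (N0 : ℝ) {n : ℕ} (k : Fin n) (i : Fin 3) :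
    Measurable (noiseTriple hW N0 k i) := by
  unfold noiseTriple; fun_prop

instance (W N0 Ts : ℝ) (s : Finset ℤ) : IsProbabilityMeasure (noiseLaw W N0 Ts s) := by
  unfold noiseLaw; infer_instance

theorem isNoiseTriple_noiseTriple {W N0 : ℝ} (hW : 0 < W) (hN0 : 0 < N0) {n : ℕ} (k : Fin n) :
    IsNoiseTriple (noiseTriple hW N0 k) (noiseLaw W N0 (1 / (4 * W)) (samples W (1 / (4 * W)) n)) := by
  set s := samples W (1 / (4 * W)) n
  have hS := noiseCov_posSemidef W N0 (1 / (4 * W)) hN0.le s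
  have hG : IsGaussian (noiseLaw W N0 (1 / (4 * W)) s) := isGaussian_multivariateGaussian
  have hσ : (√(N0 * W))⁻¹ * (√(N0 * W))⁻¹ * (N0 * W) = 1 := by
    rw [← mul_inv, Real.mul_self_sqrt (by positivity), inv_mul_cancel₀ (by positivity)]
  refine ⟨?_, fun i => ?_, fun i j => ?_⟩
  · let L : EuclideanSpace ℝ s →L[ℝ] (Fin 3 → ℝ) := ContinuousLinearMap.pi fun i =>
      (√(N0 * W))⁻¹ • EuclideanSpace.proj ⟨sampleIndex k i, sampleIndex_mem hW k i⟩
    exact (IsGaussian.hasGaussianLaw_id (μ := noiseLaw W N0 (1 / (4 * W)) s)).map L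
  · have h := (measurePreserving_eval_multivariateGaussian (μ := 0) hS
      (i := ⟨sampleIndex k i, sampleIndex_mem hW k i⟩))
    have h1 : ∫ z, z ⟨sampleIndex k i, sampleIndex_mem hW k i⟩ ∂noiseLaw W N0 (1 / (4 * W)) s = 0 := by
      have := h.hasLaw.integral_eq
      rw [integral_id_gaussianReal] at this
      simpa [noiseLaw] using this
    simp only [noiseTriple]
    rw [integral_const_mul, h1, mul_zero]
  · refine (covariance_const_mul_left _).trans ?_
    rw [noiseCorr_eq_sinc k]
    refine (congrArg _ (covariance_const_mul_right _)).trans ?_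
    rw [noiseLaw, covariance_eval_multivariateGaussian hS, noiseCov_apply hW, ← mul_assoc,
      ← mul_assoc, hσ, one_mul]

/-! ### Mutual information of antipodal signalling -/

/-- The Donsker–Varadhan bound for antipodal inputs, with a product test density: for every value of
the second component, the product has mean one under the input law. -/
theorem sum_integral_log_le_mutualInfo {β : Type*} {_ : MeasurableSpace β} {n : ℕ} {ε c : ℝ}
    {ν : Measure ((Fin n → ℝ) × β)} [IsProbabilityMeasure ν] (hν : ν.fst = antipodal n ε)
    {φ : Fin n → β → ℝ} (hφ : ∀ k, Measurable (φ k)) (hc : ∀ k y, |φ k y| ≤ c)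
    (hsmall : |ε| * c ≤ 1 / 2) :
    ENNReal.ofReal (∑ k, ∫ p, Real.log (1 + p.1 k * φ k p.2) ∂ν) ≤ mutualInfo ν := by
  have hm : ∀ k, Measurable fun p : (Fin n → ℝ) × β => 1 + p.1 k * φ k p.2 := fun k =>
    (((measurable_pi_apply k).comp measurable_fst).mul ((hφ k).comp measurable_snd)).const_add 1
  have hb : ∀ {x : Fin n → ℝ}, (∀ k, |x k| = |ε|) → ∀ k y, |x k * φ k y| ≤ 1 / 2 :=
    fun {x} hx k y => by
      rw [abs_mul, hx k]
      exact (mul_le_mul_of_nonneg_left (hc k y) (abs_nonneg ε)).trans hsmall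
  have haeν : ∀ᵐ p ∂ν, ∀ k, |p.1 k| = |ε| := by
    have h := ae_abs_antipodal n ε
    rw [← hν] at h
    exact ae_of_ae_map measurable_fst.aemeasurable h
  have haeμ : ∀ᵐ p ∂ν.fst.prod ν.snd, ∀ k, |p.1 k| = |ε| := by
    rw [hν]
    exact (Measure.quasiMeasurePreserving_fst (μ := antipodal n ε) (ν := ν.snd)).ae
      (p := fun x => ∀ k, |x k| = |ε|) (ae_abs_antipodal n ε)
  have hlog : ∀ k, Integrable (fun p => Real.log (1 + p.1 k * φ k p.2)) ν := fun k => by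
    refine Integrable.of_bound (C := 1) (Real.measurable_log.comp (hm k)).aestronglyMeasurable ?_
    filter_upwards [haeν] with p hp
    have h1 := hb hp k p.2
    have h2 := abs_le.1 h1
    have h3 := Real.one_sub_inv_le_log_of_pos (x := 1 + p.1 k * φ k p.2) (by linarith)
    have h4 := Real.log_le_sub_one_of_pos (x := 1 + p.1 k * φ k p.2) (by linarith)
    have h5 : (1 + p.1 k * φ k p.2)⁻¹ ≤ 2 := by
      rw [inv_le_comm₀ (by linarith) two_pos]; linarith
    rw [Real.norm_eq_abs, abs_le]
    constructor <;> linarith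
  have hpos : ∀ᵐ p ∂ν.fst.prod ν.snd, 0 < ∏ k, (1 + p.1 k * φ k p.2) := by
    filter_upwards [haeμ] with p hp
    exact Finset.prod_pos fun k _ => by linarith [(abs_le.1 (hb hp k p.2)).1]
  have hint : Integrable (fun p : (Fin n → ℝ) × β => ∏ k, (1 + p.1 k * φ k p.2))
      (ν.fst.prod ν.snd) := by
    refine Integrable.of_bound (C := 2 ^ n)
      (Finset.measurable_prod _ fun k _ => hm k).aestronglyMeasurable ?_
    filter_upwards [haeμ] with p hp
    rw [Real.norm_eq_abs, Finset.abs_prod]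
    refine (Finset.prod_le_prod (g := fun _ => (2 : ℝ)) (fun k _ => abs_nonneg _)
      fun k _ => ?_).trans (by simp)
    have := abs_le.1 (hb hp k p.2)
    rw [abs_le]
    constructor <;> linarith
  have hone : ∫ p, ∏ k, (1 + p.1 k * φ k p.2) ∂ν.fst.prod ν.snd = 1 := by
    rw [integral_prod_symm _ hint]
    simp_rw [hν, fun y => integral_antipodal_prod (ε := ε) fun k => φ k y]
    simp
  have hsum : ∀ᵐ p ∂ν, Real.log (∏ k, (1 + p.1 k * φ k p.2))
      = ∑ k, Real.log (1 + p.1 k * φ k p.2) := by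
    filter_upwards [haeν] with p hp
    exact Real.log_prod fun k _ => by linarith [(abs_le.1 (hb hp k p.2)).1]
  rw [← integral_finsetSum _ fun k _ => hlog k, ← integral_congr_ae hsum]
  exact ofReal_integral_log_le_klDiv hpos hint hone.le
    ((integrable_finsetSum _ fun k _ => hlog k).congr (hsum.mono fun _ h => h.symm))

theorem measurable_hardLimiter : Measurable hardLimiter :=
  Measurable.ite measurableSet_Ici measurable_const measurable_const

theorem sgn_hardLimiter (r : ℝ) : sgn (((hardLimiter r : ℤˣ) : ℤ) : ℝ) = sgn r := by
  by_cases h : 0 ≤ r <;> simp [hardLimiter, sgn, h]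

theorem measurable_channel {W : ℝ} (hW : 0 < W) (l : ℝ) (n : ℕ) :
    Measurable fun p : (Fin n → ℝ) × EuclideanSpace ℝ (samples W (1 / (4 * W)) n) =>
      (p.1, fun j : samples W (1 / (4 * W)) n =>
        hardLimiter (filteredSignal W (waveform W l) p.1 ((j : ℝ) * (1 / (4 * W))) + p.2 j)) := by
  simp_rw [filteredSignal_waveform hW]
  refine measurable_fst.prodMk (measurable_pi_lambda _ fun j => measurable_hardLimiter.comp ?_)
  fun_prop

/-- The mutual information of antipodal signalling, up to terms of third order in the amplitude; the
constant does not depend on the number `n` of symbols. -/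
theorem exists_le_mutualInfo {W N0 l : ℝ} (hW : 0 < W) (hN0 : 0 < N0) :
    ∃ C, ∃ δ > 0, ∀ ε, 0 < ε → ε < δ → ∀ n : ℕ,
      ENNReal.ofReal (n * (ε ^ 2 *
        (arcsinBound (2 / Real.pi) (pulseZero l) (pulseOne l) / (2 * (N0 * W))) - C * ε ^ 3))
      ≤ mutualInfo (jointLaw W N0 (1 / (4 * W)) (waveform W l) (antipodal n ε)) := by
  obtain ⟨α, β, γ, h1, h2⟩ := exists_signPoly_optimal (pulseZero l) (pulseOne l)
  set B := arcsinBound (2 / Real.pi) (pulseZero l) (pulseOne l)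
  set s := (√(N0 * W))⁻¹ with hs
  have hs0 : 0 < s := by positivity
  have hs2 : s ^ 2 = 1 / (N0 * W) := by
    rw [hs, inv_pow, Real.sq_sqrt (by positivity), one_div]
  set M := |α| + |β| + |γ| with hM
  have hM0 : 0 ≤ M := by positivity
  set K := s ^ 2 * ∑' m : ℤ, pulseSample l m ^ 2
  refine ⟨540 * s * M * K + 12 * s ^ 2 * M ^ 2 * (K + 1) + 16 * s ^ 3 * M ^ 3,
    1 / (4 * s * (M + 1)), by positivity, fun ε hε hεδ n => ?_⟩
  have hsmall : s * ε * (2 * M) ≤ 1 / 2 := by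
    rw [lt_div_iff₀ (by positivity)] at hεδ
    have : 0 < ε * s := by positivity
    nlinarith
  set S := samples W (1 / (4 * W)) n
  set N := noiseLaw W N0 (1 / (4 * W)) S
  set ν := jointLaw W N0 (1 / (4 * W)) (waveform W l) (antipodal n ε) with hν
  have hF := measurable_channel hW l n
  have hνp : IsProbabilityMeasure ν := Measure.isProbabilityMeasure_map hF.aemeasurable
  have hfst : ν.fst = antipodal n ε := by
    rw [hν, jointLaw, Measure.fst, Measure.map_map measurable_fst hF]
    exact Measure.fst_prod
  let y : Fin n → Fin 3 → (S → ℤˣ) → ℝ := fun k i v =>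
    sgn (((v ⟨sampleIndex k i, sampleIndex_mem hW k i⟩ : ℤˣ) : ℤ) : ℝ)
  let φ : Fin n → (S → ℤˣ) → ℝ := fun k v => s * signPoly α β γ (y k 0 v) (y k 1 v) (y k 2 v)
  have hφ : ∀ k, Measurable (φ k) := fun k => by
    have hy : ∀ i, Measurable (y k i) := fun i =>
      (Measurable.of_discrete (f := fun u : ℤˣ => sgn ((u : ℤ) : ℝ))).comp (measurable_pi_apply _)
    exact (((((hy 0).add (hy 2)).const_mul α).add ((hy 1).const_mul β)).add
      (((hy 0).mul ((hy 1).mul (hy 2))).const_mul γ)).const_mul s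
  have hc : ∀ k v, |φ k v| ≤ s * (2 * M) := fun k v => by
    rw [abs_mul, abs_of_pos hs0]
    exact mul_le_mul_of_nonneg_left (abs_signPoly_sgn_le _ _ _ _ _ _) hs0.le
  refine le_trans (ENNReal.ofReal_le_ofReal ?_) (sum_integral_log_le_mutualInfo hfst hφ hc
    (by rw [abs_of_pos hε]; linarith))
  rw [← nsmul_eq_mul]
  refine (le_of_eq (by rw [Finset.card_fin])).trans
    (Finset.card_nsmul_le_sum Finset.univ _ _ fun k _ => ?_)
  let c : Fin 3 → Fin n → ℝ := fun i ℓ =>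
    s * pulseSample l ((sampleIndex k i : ℝ) - 2 * ((ℓ : ℝ) + 1))
  have hK : ∀ i, ∑ ℓ, c i ℓ ^ 2 ≤ K := fun i => by
    simp only [c, mul_pow]
    rw [← Finset.mul_sum]
    exact mul_le_mul_of_nonneg_left (sum_pulseSample_sq_le l n _) (sq_nonneg s)
  have hlog : Measurable fun p : (Fin n → ℝ) × (S → ℤˣ) => Real.log (1 + p.1 k * φ k p.2) :=
    Real.measurable_log.comp ((((measurable_pi_apply k).comp measurable_fst).mul
      ((hφ k).comp measurable_snd)).const_add 1)
  have hy : ∀ i (x : Fin n → ℝ) (z : EuclideanSpace ℝ S), y k i (fun j => hardLimiter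
      (filteredSignal W (waveform W l) x ((j : ℝ) * (1 / (4 * W))) + z j))
      = sgn (noiseTriple hW N0 k i z + ∑ ℓ, x ℓ * c i ℓ) := fun i x z => by
    simp only [y]
    rw [sgn_hardLimiter, filteredSignal_waveform hW, ← sgn_mul_of_pos hs0, noiseTriple, mul_add,
      Finset.mul_sum, add_comm]
    congr 2
    exact Finset.sum_congr rfl fun ℓ _ => by simp only [c]; ring
  have key := integral_log_one_add_signPoly_ge (isNoiseTriple_noiseTriple hW hN0 k)
    (measurable_noiseTriple hW N0 k) hε hs0 c hK k α β γ hsmall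
  rw [hν, jointLaw, integral_map hF.aemeasurable hlog.aestronglyMeasurable]
  simp_rw [← hy] at key
  refine le_trans (le_of_eq ?_) key
  have c0 : c 0 k = s * pulseOne l := by
    simp only [c, sampleIndex]
    rw [← pulseSample_neg_one]; congr 2; simp
  have c1 : c 1 k = s * pulseZero l := by
    simp only [c, sampleIndex]
    rw [← pulseSample_zero]; congr 2; simp
  have c2 : c 2 k = s * pulseOne l := by
    simp only [c, sampleIndex]
    rw [← pulseSample_one]; congr 2; simp; ring
  rw [c0, c1, c2, h2]
  have e : 2 / √(2 * Real.pi) * ((α + γ * kappaSide) * (s * pulseOne l + s * pulseOne l)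
      + (β - γ * kappaMid) * (s * pulseZero l)) = s * B := by rw [← h1]; ring
  have e' : B / (2 * (N0 * W)) = s ^ 2 * B / 2 := by rw [hs2]; field_simp
  rw [e, e']
  ring

/-! ### Power constraints and the limit of small power -/

theorem symbolPower_antipodal (n : ℕ) (ε : ℝ) : SymbolPower (ε ^ 2) (antipodal n ε) := by
  have h : ∀ k : Fin n, ∫⁻ x, ENNReal.ofReal (x k ^ 2) ∂antipodal n ε = ENNReal.ofReal (ε ^ 2) :=
    fun k => by
      have : ∀ᵐ x ∂antipodal n ε, ENNReal.ofReal (x k ^ 2) = ENNReal.ofReal (ε ^ 2) := by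
        filter_upwards [ae_abs_antipodal n ε] with x hx
        rw [← sq_abs, hx k, sq_abs]
      rw [lintegral_congr_ae this]
      simp
  unfold SymbolPower
  simp_rw [h]
  refine ENNReal.div_le_of_le_mul ?_
  simp [mul_comm]

/-- Uncorrelated symbols of mean zero add up in energy, whatever the overlap of the pulses. -/
theorem signalPower_antipodal {W l : ℝ} (hW : 0 < W) (hl : 0 ≤ l) (n : ℕ) (ε : ℝ) :
    SignalPower W (ε ^ 2) (waveform W l) (antipodal n ε) := by
  have e1 : ∀ x : Fin n → ℝ, ∫⁻ t, ENNReal.ofReal (pamSignal W (waveform W l) x t ^ 2)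
      = ENNReal.ofReal (∫ t, pamSignal W (waveform W l) x t ^ 2) := fun x =>
    (ofReal_integral_eq_lintegral_ofReal (memLp_pamSignal hW l x).integrable_sq
      (Eventually.of_forall fun t => sq_nonneg _)).symm
  have i1 : ∀ k m : Fin n, Integrable (fun x : Fin n → ℝ => x k * x m *
      ∫ t, waveform W l (t - ((k : ℝ) + 1) / (2 * W)) *
        waveform W l (t - ((m : ℝ) + 1) / (2 * W))) (antipodal n ε) := fun k m =>
    ((memLp_antipodal k 2).integrable_mul (memLp_antipodal m 2)).mul_const _
  have i2 : Integrable (fun x : Fin n → ℝ => ∫ t, pamSignal W (waveform W l) x t ^ 2)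
      (antipodal n ε) := by
    simp_rw [integral_pamSignal_sq hW]
    exact (integrable_finsetSum _ fun k _ => integrable_finsetSum _ fun m _ => i1 k m).const_mul _
  have e2 : ∫ x, (∫ t, pamSignal W (waveform W l) x t ^ 2) ∂antipodal n ε
      = ε ^ 2 * (n / (2 * W)) := by
    simp_rw [integral_pamSignal_sq hW]
    rw [integral_const_mul,
      integral_finsetSum _ fun k _ => integrable_finsetSum _ fun m _ => i1 k m]
    simp_rw [integral_finsetSum _ fun m _ => i1 _ m, integral_mul_const, integral_antipodal_mul,
      ite_mul, zero_mul, Finset.sum_ite_eq, Finset.mem_univ, if_true, ← sq,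
      integral_waveform_sq hW hl]
    simp
    ring
  unfold SignalPower
  simp_rw [e1]
  rw [← ofReal_integral_eq_lintegral_ofReal i2
    (Eventually.of_forall fun x => integral_nonneg fun t => sq_nonneg _), e2]
  refine ENNReal.div_le_of_le_mul ?_
  rw [← ENNReal.ofReal_mul (sq_nonneg ε)]

theorem signalCapacity_le_capacity (W N0 Ts P : ℝ) :
    signalCapacity W N0 Ts P ≤ capacity W N0 Ts P := by
  refine liminf_le_liminf (Eventually.of_forall fun n => ?_)
  gcongr with g hg hb μ hμ
  exact iSup_le fun _ => le_rfl

theorem exists_le_signalCapacity {W N0 l : ℝ} (hW : 0 < W) (hN0 : 0 < N0) (hl : 0 ≤ l) :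
    ∃ C, ∃ δ > 0, ∀ P, 0 < P → P < δ →
      ENNReal.ofReal P * ENNReal.ofReal
        (arcsinBound (2 / Real.pi) (pulseZero l) (pulseOne l) / N0 - C * √P)
      ≤ signalCapacity W N0 (1 / (4 * W)) P := by
  obtain ⟨C, δ, hδ, h⟩ := exists_le_mutualInfo (l := l) hW hN0
  set B := arcsinBound (2 / Real.pi) (pulseZero l) (pulseOne l)
  refine ⟨2 * W * C, δ ^ 2, by positivity, fun P hP hPδ => ?_⟩
  have hP2 : √P ^ 2 = P := Real.sq_sqrt hP.le
  refine le_liminf_of_le (by isBoundedDefault) ?_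
  filter_upwards [eventually_ge_atTop 1] with n hn
  have hn0 : (0 : ℝ) < n := by exact_mod_cast hn
  have hs := symbolPower_antipodal n (√P)
  have hx := signalPower_antipodal hW hl n (√P)
  rw [hP2] at hs hx
  refine le_trans ?_ (le_iSup_of_le (waveform W l) <| le_iSup_of_le (unitEnergy_waveform hW hl) <|
    le_iSup_of_le (bandlimited_waveform hW l) <|
    le_iSup_of_le ⟨antipodal n (√P), inferInstance⟩ <| le_iSup_of_le hs <| le_iSup_of_le hx le_rfl)
  have h1 := h (√P) (Real.sqrt_pos.2 hP) ((Real.sqrt_lt' hδ).2 hPδ) n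
  refine le_trans (le_of_eq ?_) (mul_le_mul_right h1 (ENNReal.ofReal (2 * W / n)))
  rw [← ENNReal.ofReal_mul hP.le, ← ENNReal.ofReal_mul (by positivity)]
  congr 1
  have h3 : √P ^ 3 = P * √P := by rw [pow_succ, hP2]
  rw [hP2, h3]
  field_simp

theorem ofReal_le_perUnitCost {F : ℝ → ℝ≥0∞} {b C δ : ℝ} (hδ : 0 < δ)
    (h : ∀ P, 0 < P → P < δ → ENNReal.ofReal P * ENNReal.ofReal (b - C * √P) ≤ F P) :
    ENNReal.ofReal b ≤ perUnitCost F := by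
  have ht : Tendsto (fun P : ℝ => ENNReal.ofReal (b - C * √P)) (𝓝[>] 0) (𝓝 (ENNReal.ofReal b)) := by
    have hc : Continuous fun P : ℝ => ENNReal.ofReal (b - C * √P) :=
      ENNReal.continuous_ofReal.comp (by fun_prop)
    have := (hc.tendsto 0).mono_left (nhdsWithin_le_nhds (s := Set.Ioi 0))
    simpa using this
  rw [← ht.limsup_eq]
  refine limsup_le_limsup ?_
  filter_upwards [Ioo_mem_nhdsGT hδ] with P hP
  rw [ENNReal.le_div_iff_mul_le (Or.inl (by simpa using hP.1)) (Or.inl ENNReal.ofReal_ne_top),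
    mul_comm]
  exact h P hP.1 hP.2

end OneBitAWGN

end

theorem theorem1 (W N0 : ℝ) (hW : 0 < W) (hN0 : 0 < N0) (B : ℝ)
    (hB : B = OneBitAWGN.arcsinBound (2 / Real.pi)
      (OneBitAWGN.pulseZero 1.4) (OneBitAWGN.pulseOne 1.4)) :
    ENNReal.ofReal (B / N0)
        ≤ OneBitAWGN.perUnitCost (OneBitAWGN.capacity W N0 (1 / (4 * W))) ∧
      ENNReal.ofReal (B / N0)
        ≤ OneBitAWGN.perUnitCost (OneBitAWGN.signalCapacity W N0 (1 / (4 * W))) ∧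
      0.7464 < B ∧ B < 0.7465 ∧
      2 / Real.pi / N0 < B / N0 := by
  obtain ⟨C, δ, hδ, h⟩ := OneBitAWGN.exists_le_signalCapacity (l := 1.4) hW hN0 (by norm_num)
  obtain ⟨h1, h2⟩ := OneBitAWGN.arcsinBound_bounds
  rw [← hB] at h h1 h2
  refine ⟨OneBitAWGN.ofReal_le_perUnitCost hδ fun P hP hPδ =>
    (h P hP hPδ).trans (OneBitAWGN.signalCapacity_le_capacity _ _ _ _),
    OneBitAWGN.ofReal_le_perUnitCost hδ h, h1, h2, ?_⟩
  have h3 : 2 / Real.pi ≤ 2 / 3 :=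
    div_le_div_of_nonneg_left (by norm_num) (by norm_num) Real.pi_gt_three.le
  exact div_lt_div_of_pos_right (by linarith) hN0
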